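/- A \emph{knot projection} is the image $P$ of a generic immersion of a circle into $S^2$, all of whose singularities are (finitely many) transverse double points. Knot projections are considered up to homeomorphism of $S^2$ (so mirror images are not distinguished), hence as combinatorial objects: $4$-valent maps on the sphere (cyclic order of the four ends of the curve at each double point, together with the arcs joining these ends) that are traversed by a single closed curve; $O$ denotes the simple closed curve, which has no double point. A \emph{splice} at a double point replaces the crossing by two disjoint arcs; it can be done in two ways. One of them (the Seifert splice) gives a two-component curve, the other one gives a knot projection. The latter is of type $\mathrm{RI}^-$ if the double point is the corner of a $1$-gon, i.e. of a region of $S^2\setminus P$ whose boundary contains only this double point and one arc (the splice then removes a kink), and of type $S^-$ otherwise. Let $u^-(P)$ be the minimal number of splices of type $S^-$ in a finite sequence of splices of types $S^-$ and $\mathrm{RI}^-$ leading from $P$ to $O$. Write $P\sim Q$ if $P$ and $Q$ are related by a finite sequence of splices of type $\mathrm{RI}^-$ and their inverses, and for a set $\mathcal S$ of knot projections let $\langle\mathcal S\rangle=\{P \mid P\sim Q \text{ for some } Q\in\mathcal S\}$. A connected sum $P_1\sharp P_2$ is obtained by removing from each of the two spheres a small disk centred at a point of $P_i$ that is not a double point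 and gluing along the boundary circles, matching the endpoints of the curves; it depends on the choices made. For sets $\mathcal A,\mathcal B$ let $\mathcal A\sharp\mathcal B$ be the set of all connected sums of some $P_1\in\mathcal A$ and some $P_2\in\mathcal B$. Let $\mathcal T$ be the set of $(2,2l-1)$-torus knot projections with $l\ge 2$ (closures of the $2$-braid with $2l-1$ crossings); $\mathcal R$ the set of $(2m,2n-1)$-rational knot projections with $m\ge1$, $n\ge2$ (the standard projections with Conway notation $C(2m,2n-1)$: a vertical twist of $2m$ crossings and a horizontal twist of $2n-1$ crossings side by side, the right ends of each being joined to the left ends of the other); and $\mathcal P$ the set of $(2p,2q-1,2r-1)$-pretzel knot projections with $p,q,r\ge1$ (three vertical twists with these numbers of crossings side by side, the right ends of each being joined to the left ends of the next, cyclically). \textbf{Theorem.} Let $P$ be a knot projection. \begin{enumerate} \item $u^-(P)=1$ if and only if $P\in\langle\mathcal T\rangle$. \item $u^-(P)=2$ if and only if $P\in\langle\mathcal R\rangle\cup\langle\mathcal P\rangle\cup\langle\mathcal T\rangle\sharp\langle\mathcal T\rangle$. \end{enumerate} -/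

import Mathlib

/-- The number of cycles (orbits) of a permutation, fixed points included. -/
noncomputable def numCycles {α : Type} (f : Equiv.Perm α) : ℕ :=
  Nat.card (Quotient (Equiv.Perm.SameCycle.setoid f))

/-- A knot projection (the image of a generic immersion of a circle into the sphere, with finitely
many transverse double points), taken up to orientation preserving homeomorphism of the sphere and
given by its combinatorial map.

A dart is one of the four ends of the curve at a double point. `rot` sends a dart to the next one,
counterclockwise, at the same double point; the two branches of the curve at the double point are
`{x, rot² x}` and `{rot x, rot³ x}`. `edge` sends a dart to the other end of the arc of the curve
(running between consecutive double points) that begins with it.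

The simple closed curve has no double point, and it is the projection without darts. -/
structure KnotProjection where
  /-- The ends of the curve at the double points. -/
  Dart : Type
  /-- There are finitely many double points. -/
  finite : Finite Dart
  /-- Counterclockwise rotation about the double points. -/
  rot : Equiv.Perm Dart
  /-- The two ends of each arc. -/
  edge : Equiv.Perm Dart
  /-- Together with `rot_two_ne`: there are exactly four darts at every double point. -/
  rot_four : ∀ x, rot (rot (rot (rot x))) = x
  rot_two_ne : ∀ x, rot (rot x) ≠ x
  edge_edge : ∀ x, edge (edge x) = x
  edge_ne : ∀ x, edge x ≠ x
  /-- The curve is the image of one circle: all darts are met when one travels along the arcs and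
  straight through the double points. -/
  one_component : ∀ x y,
    Relation.EqvGen (fun a b => b = edge a ∨ b = rot (rot a)) x y
  /-- The surface is the sphere: (double points) + (regions) = (arcs) + 2. The cycles of
  `edge` followed by `rot` are the boundaries of the regions. -/
  spherical : Nonempty Dart →
    numCycles rot + numCycles (edge.trans rot) = numCycles edge + 2

namespace KnotProjection

/-- The simple closed curve: there are no double points. -/
def IsSimpleClosedCurve (P : KnotProjection) : Prop := IsEmpty P.Dart

/-- Two projections are the same if a homeomorphism of the sphere carries one to the other. It may
reverse the orientation: a projection is not distinguished from its mirror image. -/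
def Same (P Q : KnotProjection) : Prop :=
  ∃ e : P.Dart ≃ Q.Dart,
    (∀ x, e (P.edge x) = Q.edge (e x)) ∧
      ((∀ x, e (P.rot x) = Q.rot (e x)) ∨ (∀ x, e (P.rot x) = Q.rot.symm (e x)))

/-- The four darts at the double point of the dart `d`. -/
def dartsAt (P : KnotProjection) (d : P.Dart) : Set P.Dart :=
  {x | x = d ∨ x = P.rot d ∨ x = P.rot (P.rot d) ∨ x = P.rot (P.rot (P.rot d))}

open Classical in
/-- How the darts at each double point are joined after the splice at the double point of `d` whose
two new arcs join `d` to `rot d` and `rot² d` to `rot³ d`. At the other double points one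
goes straight through. (The other splice at the same double point is the one given by `rot d`.) -/
noncomputable def smooth (P : KnotProjection) (d x : P.Dart) : P.Dart :=
  if x = d then P.rot d
  else if x = P.rot d then d
  else if x = P.rot (P.rot d) then P.rot (P.rot (P.rot d))
  else if x = P.rot (P.rot (P.rot d)) then P.rot (P.rot d)
  else P.rot (P.rot x)

/-- The splice given by `d` yields a curve with one component, so that it is not a Seifert
splice. -/
def SpliceConnected (P : KnotProjection) (d : P.Dart) : Prop :=
  ∀ x y, Relation.EqvGen (fun a b => b = P.edge a ∨ b = P.smooth d a) x y

open Classical in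
/-- If an arc ends at the spliced double point, cross it along the new arc and take the next arc. -/
noncomputable def cross (P : KnotProjection) (d y : P.Dart) : P.Dart :=
  if y ∈ P.dartsAt d then P.edge (P.smooth d y) else y

/-- The other end of the arc that begins with the dart `x` (at a remaining double point), after the
splice given by `d`. The arc may cross the spliced double point once or twice. -/
noncomputable def spliceEdge (P : KnotProjection) (d x : P.Dart) : P.Dart :=
  P.cross d (P.cross d (P.edge x))

/-- `Q` is the result of the splice of `P` given by `d`: its double points are those of `P` except
that of `d`, with the same rotation, and its arcs are those of the spliced curve. -/
def IsSplice (P : KnotProjection) (d : P.Dart) (Q : KnotProjection) : Prop :=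
  ∃ f : Q.Dart → P.Dart, Function.Injective f ∧ Set.range f = (P.dartsAt d)ᶜ ∧
    (∀ x, f (Q.rot x) = P.rot (f x)) ∧ (∀ x, f (Q.edge x) = P.spliceEdge d (f x))

/-- Some region is a 1-gon whose only corner is the double point of `d`: an arc joins two
neighbouring darts there, with nothing in between. -/
def HasOneGonAt (P : KnotProjection) (d : P.Dart) : Prop :=
  ∃ x ∈ P.dartsAt d, P.edge x = P.rot x

/-- A splice of type `RI⁻`: the splice that is not Seifert, at the corner of a 1-gon. It removes
a kink. -/
def RIMinus (P Q : KnotProjection) : Prop :=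
  ∃ d, P.SpliceConnected d ∧ P.HasOneGonAt d ∧ P.IsSplice d Q

/-- A splice of type `S⁻`: a splice that is neither Seifert nor of type `RI⁻`. -/
def SMinus (P Q : KnotProjection) : Prop :=
  ∃ d, P.SpliceConnected d ∧ ¬ P.HasOneGonAt d ∧ P.IsSplice d Q

/-- `Unknots P k`: some finite sequence of splices of type `S⁻` and `RI⁻`, exactly `k` of which are
of type `S⁻`, leads from `P` to the simple closed curve. -/
inductive Unknots : KnotProjection → ℕ → Prop
  | done (P : KnotProjection) : P.IsSimpleClosedCurve → Unknots P 0
  | ri (P Q : KnotProjection) (k : ℕ) : P.RIMinus Q → Unknots Q k → Unknots P k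
  | s (P Q : KnotProjection) (k : ℕ) : P.SMinus Q → Unknots Q k → Unknots P (k + 1)

/-- The unknotting-type number `u⁻(P)`. -/
noncomputable def uMinus (P : KnotProjection) : ℕ := sInf {k | P.Unknots k}

/-- `P ∼ Q`: related by a finite sequence of splices of type `RI⁻` and their inverses. -/
def RIEquiv : KnotProjection → KnotProjection → Prop :=
  Relation.EqvGen (fun P Q => P.Same Q ∨ P.RIMinus Q)

/-- The set `⟨S⟩` of the projections that are RI-equivalent to a member of `S`. -/
def riClass (S : Set KnotProjection) : Set KnotProjection := {P | ∃ Q ∈ S, RIEquiv P Q}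

/-- `Q` is a connected sum of `P₁` and `P₂`: the arc of `P₁` between `a` and `edge a` and the arc of
`P₂` between `b` and `edge b` are cut, and the loose ends are joined, `a` to `b` and `edge a` to
`edge b`. (The other way of joining them is got from the dart `edge b`.) The connected sum with the
simple closed curve changes nothing. -/
def IsConnectedSum (P₁ P₂ Q : KnotProjection) : Prop :=
  (P₁.IsSimpleClosedCurve ∧ P₂.Same Q) ∨ (P₂.IsSimpleClosedCurve ∧ P₁.Same Q) ∨
  ∃ (a : P₁.Dart) (b : P₂.Dart) (e : P₁.Dart ⊕ P₂.Dart ≃ Q.Dart),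
    (∀ x, Q.rot (e (.inl x)) = e (.inl (P₁.rot x))) ∧
    (∀ y, Q.rot (e (.inr y)) = e (.inr (P₂.rot y))) ∧
    Q.edge (e (.inl a)) = e (.inr b) ∧
    Q.edge (e (.inl (P₁.edge a))) = e (.inr (P₂.edge b)) ∧
    (∀ x, x ≠ a → x ≠ P₁.edge a → Q.edge (e (.inl x)) = e (.inl (P₁.edge x))) ∧
    (∀ y, y ≠ b → y ≠ P₂.edge b → Q.edge (e (.inr y)) = e (.inr (P₂.edge y)))

/-- The set `A ♯ B` of the connected sums of a member of `A` and a member of `B`. -/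
def connectedSums (A B : Set KnotProjection) : Set KnotProjection :=
  {Q | ∃ P₁ ∈ A, ∃ P₂ ∈ B, IsConnectedSum P₁ P₂ Q}

/-- The corners of a crossing drawn as an X, in counterclockwise order. -/
abbrev NE : Fin 4 := 0
/-- The upper left corner. -/
abbrev NW : Fin 4 := 1
/-- The lower left corner. -/
abbrev SW : Fin 4 := 2
/-- The lower right corner. -/
abbrev SE : Fin 4 := 3

/-- The `(2, k)`-torus projection: the closure of the 2-braid with `k` crossings, which are stacked
in one cyclic vertical twist. -/
def IsTorus (k : ℕ) (P : KnotProjection) : Prop :=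
  ∃ e : ZMod k × Fin 4 ≃ P.Dart,
    (∀ j c, P.rot (e (j, c)) = e (j, c + 1)) ∧
    (∀ j, P.edge (e (j, SW)) = e (j + 1, NW) ∧ P.edge (e (j, SE)) = e (j + 1, NE))

/-- The `(a, b)`-rational projection, with Conway notation `C(a, b)`: a vertical twist of `a`
crossings (numbered downwards) beside a horizontal twist of `b` crossings (numbered to the right).
The right ends of the vertical twist are joined to the left ends of the horizontal one, and the
right ends of the horizontal twist are joined, around the picture, to the left ends of the vertical
one, upper to upper and lower to lower. -/
def IsRational (a b : ℕ) (P : KnotProjection) : Prop :=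
  ∃ e : (Fin a ⊕ Fin b) × Fin 4 ≃ P.Dart,
    (∀ v c, P.rot (e (v, c)) = e (v, c + 1)) ∧
    (∀ i j : Fin a, (j : ℕ) = i + 1 →
      P.edge (e (.inl i, SW)) = e (.inl j, NW) ∧ P.edge (e (.inl i, SE)) = e (.inl j, NE)) ∧
    (∀ i j : Fin b, (j : ℕ) = i + 1 →
      P.edge (e (.inr i, NE)) = e (.inr j, NW) ∧ P.edge (e (.inr i, SE)) = e (.inr j, SW)) ∧
    (∀ (top bottom : Fin a) (left right : Fin b), (top : ℕ) = 0 → (bottom : ℕ) + 1 = a →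
      (left : ℕ) = 0 → (right : ℕ) + 1 = b →
      P.edge (e (.inl top, NE)) = e (.inr left, NW) ∧
      P.edge (e (.inl bottom, SE)) = e (.inr left, SW) ∧
      P.edge (e (.inr right, NE)) = e (.inl top, NW) ∧
      P.edge (e (.inr right, SE)) = e (.inl bottom, SW))

/-- The `(a 0, a 1, a 2)`-pretzel projection: three vertical twists side by side, of `a i` crossings
each (numbered downwards), where the right ends of each twist are joined to the left ends of the
next one (cyclically), upper to upper and lower to lower. -/
def IsPretzel (a : Fin 3 → ℕ) (P : KnotProjection) : Prop :=
  ∃ e : (Σ i : Fin 3, Fin (a i)) × Fin 4 ≃ P.Dart,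
    (∀ v c, P.rot (e (v, c)) = e (v, c + 1)) ∧
    (∀ (i : Fin 3) (j k : Fin (a i)), (k : ℕ) = j + 1 →
      P.edge (e (⟨i, j⟩, SW)) = e (⟨i, k⟩, NW) ∧ P.edge (e (⟨i, j⟩, SE)) = e (⟨i, k⟩, NE)) ∧
    (∀ (i : Fin 3) (j : Fin (a i)) (k : Fin (a (i + 1))), (j : ℕ) = 0 → (k : ℕ) = 0 →
      P.edge (e (⟨i, j⟩, NE)) = e (⟨i + 1, k⟩, NW)) ∧
    (∀ (i : Fin 3) (j : Fin (a i)) (k : Fin (a (i + 1))), (j : ℕ) + 1 = a i →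
      (k : ℕ) + 1 = a (i + 1) → P.edge (e (⟨i, j⟩, SE)) = e (⟨i + 1, k⟩, SW))

/-- The set `𝒯` of the `(2, 2l - 1)`-torus projections, `l ≥ 2`. -/
def torusProjections : Set KnotProjection :=
  {P | ∃ l : ℕ, 2 ≤ l ∧ P.IsTorus (2 * l - 1)}

/-- The set `ℛ` of the `(2m, 2n - 1)`-rational projections, `m ≥ 1`, `n ≥ 2`. -/
def rationalProjections : Set KnotProjection :=
  {P | ∃ m n : ℕ, 1 ≤ m ∧ 2 ≤ n ∧ P.IsRational (2 * m) (2 * n - 1)}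

/-- The set `𝒫` of the `(2p, 2q - 1, 2r - 1)`-pretzel projections, `p, q, r ≥ 1`. -/
def pretzelProjections : Set KnotProjection :=
  {P | ∃ p q r : ℕ, 1 ≤ p ∧ 1 ≤ q ∧ 1 ≤ r ∧ P.IsPretzel ![2 * p, 2 * q - 1, 2 * r - 1]}

end KnotProjection

/-! Along the curve every double point is visited twice; two double points are interlaced if their
visits alternate. The proof replaces a projection by its interlacement graph, with adjacency matrix
over `ZMod 2`. The splice that keeps the curve connected reverses one of the two loops at its double
point; on the graph this is local complementation at that vertex, followed by its deletion
(`SpliceMap.inter_eq`). The corner of a 1-gon is an isolated vertex. Conversely, a projection with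
double points and an edgeless graph has a 1-gon, namely an innermost loop, so it unravels by `RI⁻`
alone. Hence `u⁻` is the least number of eliminations that lead to an edgeless graph
(`eliminatesIn_iff_unknots`, `uMinus_eq_succ_iff`), and it is invariant under `∼`.

The values on the listed families come from their graphs. Double points of one twist have the same
neighbours elsewhere, so each graph is described by a small matrix: a torus projection gives a
complete graph, a connected sum a disjoint union. A graph that one elimination makes edgeless is a
clique with isolated vertices. Its adjacency is transitive, which fails for rational and pretzel
projections, and it does not have two components with edges.

For the classification, 1-gons are first removed from `P`; then the first splice is of type `S⁻`,
with result `Q`. The spliced double point is a twist of length one put on two arcs of `Q` that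
border one region (`SMinus.exists_openTwist`). Since `P` has no 1-gon, every 1-gon of `Q` uses one
of these arcs, and removing it from `Q` amounts to lengthening the twist by its corner
(`OpenTwist.extend`, `OpenTwist.reduce`). In the end either `Q` has no 1-gon left, or two ends of
the twist on one side get joined and `P` is a connected sum with a torus projection, or this happens
on both sides and `P` is a torus projection. If `u⁻ = 1`, only the last outcome is possible. If `u⁻
= 2`, the reduced `Q` is a torus projection, and `P` arises by putting a twist on two arcs of one of
its regions: a 2-gon yields a rational projection, one of the other two regions a pretzel
projection. The parities are forced because the curve has one component.

Planarity enters through the inequality `numCycles_add_le`: it shows that a connected splice merges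
two different regions, and that no arc has the same region on both sides. Finally, the kinks removed
from a connected sum have to be put back on its summands (`RIMinus.mem_connectedSums`). -/

open Equiv Equiv.Perm in
theorem Equiv.Perm.SameCycle.mem_of_closed {α : Type} [Finite α] {f : Equiv.Perm α} {x y : α}
    (h : f.SameCycle x y) {S : Set α} (hS : ∀ a ∈ S, f a ∈ S) (hx : x ∈ S) : y ∈ S := by
  obtain ⟨i, -, rfl⟩ := h.exists_pow_eq'
  clear h
  induction i with
  | zero => simpa
  | succ n ih =>
    rw [pow_succ', Perm.mul_apply]
    exact hS _ ih

/-! ### Cycles of permutations and the genus of a combinatorial map. -/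

section Cycles

open Equiv Equiv.Perm

variable {α β : Type}

theorem sameCycle_apply_self (f : Perm α) (x : α) : f.SameCycle x (f x) :=
  sameCycle_apply_right.2 (SameCycle.refl f x)

/-- A transposition cuts a cycle in two: the stretch from `a` to just before the first visit to `b`
is closed under the new permutation. -/
theorem not_sameCycle_swap_mul [Finite α] [DecidableEq α] {f : Perm α} {a b : α} (hab : a ≠ b)
    (h : f.SameCycle a b) : ¬ (swap a b * f).SameCycle a b := by
  intro hg
  have hex : ∃ m, (f ^ m) a = b := by
    obtain ⟨i, -, hi⟩ := h.exists_pow_eq'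
    exact ⟨i, hi⟩
  classical
  let m := Nat.find hex
  have hm : (f ^ m) a = b := Nat.find_spec hex
  have hmin : ∀ i < m, (f ^ i) a ≠ b := fun i hi => Nat.find_min hex hi
  have hb : b ∈ {x | ∃ i < m, (f ^ i) a = x} := by
    refine hg.mem_of_closed (S := {x | ∃ i < m, (f ^ i) a = x}) ?_ ?_
    · rintro _ ⟨i, hi, rfl⟩
      have e : f ((f ^ i) a) = (f ^ (i + 1)) a := by rw [pow_succ', Perm.mul_apply]
      simp only [Perm.mul_apply, Set.mem_ofPred_eq, e]
      -- At the end of the stretch `f` would reach `b`; the transposition sends this back to `a`.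
      by_cases him : i + 1 = m
      · refine ⟨0, by omega, ?_⟩
        rw [him, hm]; simp
      · have hlt : i + 1 < m := by omega
        refine ⟨i + 1, hlt, ?_⟩
        rw [swap_apply_of_ne_of_ne _ (hmin _ hlt)]
        intro hcon
        apply hmin (m - (i + 1)) (by omega)
        have : (f ^ m) a = (f ^ (m - (i + 1))) ((f ^ (i + 1)) a) := by
          rw [← Perm.mul_apply, ← pow_add]; congr 2; omega
        rw [hcon, hm] at this
        exact this.symm
    · refine ⟨0, ?_, rfl⟩
      rcases Nat.eq_zero_or_pos m with h0 | h0
      · rw [h0] at hm; exact absurd hm hab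
      · exact h0
  obtain ⟨i, hi, hib⟩ := hb
  exact hmin i hi hib

/-- The new permutation follows the old cycle of `a`, which avoids `b`, from `a` to `f⁻¹ a`, and
from there it jumps to `b`. -/
theorem sameCycle_swap_mul [Finite α] [DecidableEq α] {f : Perm α} {a b : α}
    (h : ¬ f.SameCycle a b) : (swap a b * f).SameCycle a b := by
  by_contra hg
  set g := swap a b * f with hgdef
  have key : f⁻¹ a ∈ {x | f.SameCycle a x ∧ g.SameCycle a x} := by
    have h1 : f.SameCycle a (f⁻¹ a) := (sameCycle_apply_right (f := f)).1 (by simp [SameCycle.refl])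
    refine h1.mem_of_closed (S := {x | f.SameCycle a x ∧ g.SameCycle a x}) ?_
      ⟨SameCycle.refl _ _, SameCycle.refl _ _⟩
    rintro x ⟨hx1, hx2⟩
    refine ⟨sameCycle_apply_right.2 hx1, ?_⟩
    have hfx : f x ≠ b := by
      rintro rfl; exact h (sameCycle_apply_right.2 hx1)
    by_cases hfa : f x = a
    · rw [hfa]
    · have : g x = f x := by simp [hgdef, swap_apply_of_ne_of_ne hfa hfx]
      rw [← this]; exact sameCycle_apply_right.2 hx2
  apply hg
  have : g (f⁻¹ a) = b := by simp [hgdef]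
  rw [← this]
  exact sameCycle_apply_right.2 key.2

/-- Gluing two classes of a setoid lowers the number of classes by one. -/
theorem card_quotient_glue [Finite α] (R S : Setoid α) {a b : α} (hRS : ∀ x y, R x y → S x y)
    (hab : ¬ R a b) (hS : S a b)
    (hSR : ∀ x y, S x y → R x y ∨ (R x a ∧ R y b) ∨ (R x b ∧ R y a)) :
    Nat.card (Quotient R) = Nat.card (Quotient S) + 1 := by
  classical
  have e : Quotient R ≃ Option (Quotient S) := by
    refine Equiv.ofBijective (Quotient.lift
      (fun x => if R x b then none else some (Quotient.mk S x)) ?_) ⟨?_, ?_⟩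
    · intro x y (hxy : R x y)
      have h1 : R x b ↔ R y b :=
        ⟨fun h => R.trans (R.symm hxy) h, fun h => R.trans hxy h⟩
      have h2 : Quotient.mk S x = Quotient.mk S y := Quotient.sound (hRS _ _ hxy)
      simp [h1, h2]
    · intro p q
      induction p using Quotient.inductionOn with | h x => ?_
      induction q using Quotient.inductionOn with | h y => ?_
      simp only [Quotient.lift_mk]
      by_cases hx : R x b <;> by_cases hy : R y b <;> simp only [hx, hy, if_true, if_false]
      · intro _; exact Quotient.sound (R.trans hx (R.symm hy))
      · simp
      · simp
      · intro h
        have h' : S x y := Quotient.exact (Option.some.inj h)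
        rcases hSR _ _ h' with h1 | ⟨h1, h2⟩ | ⟨h1, h2⟩
        · exact Quotient.sound h1
        · exact absurd h2 hy
        · exact absurd h1 hx
    · intro o
      cases o with
      | none => exact ⟨Quotient.mk R b, by simp⟩
      | some q =>
        induction q using Quotient.inductionOn with | h y => ?_
        by_cases hy : R y b
        · refine ⟨Quotient.mk R a, ?_⟩
          simp only [Quotient.lift_mk, hab, if_false]
          congr 1
          exact Quotient.sound (S.trans hS (S.symm (hRS _ _ hy)))
        · exact ⟨Quotient.mk R y, by simp [hy]⟩
  rw [Nat.card_congr e]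
  exact Finite.card_option

theorem numCycles_swap_mul_of_not_sameCycle [Finite α] [DecidableEq α] {f : Perm α} {a b : α}
    (h : ¬ f.SameCycle a b) : numCycles f = numCycles (swap a b * f) + 1 := by
  have hab := sameCycle_swap_mul h
  set g := swap a b * f with hgdef
  refine card_quotient_glue (SameCycle.setoid f) (SameCycle.setoid g) (a := a) (b := b) ?_ h hab ?_
  · intro x y hxy
    have hxy' : f.SameCycle x y := hxy
    refine hxy'.mem_of_closed (S := {y | g.SameCycle x y}) ?_ (SameCycle.refl _ _)
    intro y hy
    have hgy : g.SameCycle x (g y) := sameCycle_apply_right.2 hy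
    have hfg : f y = swap a b (g y) := by simp [hgdef]
    simp only [Set.mem_ofPred_eq, hfg]
    rcases eq_or_ne (g y) a with h1 | h1
    · rw [h1, swap_apply_left]; rw [h1] at hgy; exact hgy.trans hab
    · rcases eq_or_ne (g y) b with h2 | h2
      · rw [h2, swap_apply_right]; rw [h2] at hgy; exact hgy.trans hab.symm
      · rwa [swap_apply_of_ne_of_ne h1 h2]
  · intro x y hxy
    have hxy' : g.SameCycle x y := hxy
    refine hxy'.mem_of_closed (S := {y | f.SameCycle x y ∨ (f.SameCycle x a ∧ f.SameCycle y b) ∨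
      (f.SameCycle x b ∧ f.SameCycle y a)}) ?_ (Or.inl (SameCycle.refl _ _))
    intro y hy
    simp only [Set.mem_ofPred_eq] at hy ⊢
    have hfg : g y = swap a b (f y) := rfl
    have hy' : f.SameCycle x (f y) ∨ (f.SameCycle x a ∧ f.SameCycle (f y) b) ∨
      (f.SameCycle x b ∧ f.SameCycle (f y) a) := by
      simpa only [sameCycle_apply_left, sameCycle_apply_right] using hy
    rw [hfg]
    rcases eq_or_ne (f y) a with h1 | h1
    · rw [h1] at hy' ⊢
      rw [swap_apply_left]
      rcases hy' with h2 | ⟨h2, h3⟩ | ⟨h2, h3⟩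
      · exact Or.inr (Or.inl ⟨h2, SameCycle.refl _ _⟩)
      · exact absurd h3 h
      · exact Or.inl h2
    · rcases eq_or_ne (f y) b with h2 | h2
      · rw [h2] at hy' ⊢
        rw [swap_apply_right]
        rcases hy' with h2 | ⟨h2, h3⟩ | ⟨h2, h3⟩
        · exact Or.inr (Or.inr ⟨h2, SameCycle.refl _ _⟩)
        · exact Or.inl h2
        · exact absurd h3.symm h
      · rwa [swap_apply_of_ne_of_ne h1 h2]

theorem numCycles_swap_mul_of_sameCycle [Finite α] [DecidableEq α] {f : Perm α} {a b : α}
    (hab : a ≠ b) (h : f.SameCycle a b) : numCycles (swap a b * f) = numCycles f + 1 := by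
  have := numCycles_swap_mul_of_not_sameCycle (not_sameCycle_swap_mul hab h)
  rwa [← mul_assoc, swap_mul_self, one_mul] at this

/-- The orbits of the group generated by two permutations. -/
def orbitSetoid (r e : Perm α) : Setoid α :=
  Relation.EqvGen.setoid fun x y => y = r x ∨ y = e x

theorem orbitSetoid_left (r e : Perm α) (x : α) : orbitSetoid r e x (r x) :=
  Relation.EqvGen.rel _ _ (Or.inl rfl)

theorem orbitSetoid_right (r e : Perm α) (x : α) : orbitSetoid r e x (e x) :=
  Relation.EqvGen.rel _ _ (Or.inr rfl)

theorem orbitSetoid_le (r e : Perm α) (S : Setoid α) (h1 : ∀ x, S x (r x)) (h2 : ∀ x, S x (e x))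
    {x y : α} (h : orbitSetoid r e x y) : S x y := by
  have h' : Relation.EqvGen (fun x y => y = r x ∨ y = e x) x y := h
  clear h
  induction h' with
  | rel x y h =>
    rcases h with rfl | rfl
    · exact h1 _
    · exact h2 _
  | refl x => exact S.refl x
  | symm x y _ ih => exact S.symm ih
  | trans x y z _ _ ih1 ih2 => exact S.trans ih1 ih2

theorem sameCycle_le_setoid [Finite α] (f : Perm α) (S : Setoid α) (h : ∀ x, S x (f x)) {x y : α}
    (hxy : f.SameCycle x y) : S x y :=
  hxy.mem_of_closed (S := {y | S x y}) (fun a ha => S.trans ha (h a)) (S.refl x)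

/-- The two classes of `a` and `b` glued. -/
def glueSetoid (R : Setoid α) (a b : α) : Setoid α where
  r x y := R x y ∨ (R x a ∧ R y b) ∨ (R x b ∧ R y a)
  iseqv := by
    refine ⟨fun x => Or.inl (R.refl x), ?_, ?_⟩
    · rintro x y (h | ⟨h1, h2⟩ | ⟨h1, h2⟩)
      · exact Or.inl (R.symm h)
      · exact Or.inr (Or.inr ⟨h2, h1⟩)
      · exact Or.inr (Or.inl ⟨h2, h1⟩)
    · rintro x y z (h | ⟨h1, h2⟩ | ⟨h1, h2⟩) (k | ⟨k1, k2⟩ | ⟨k1, k2⟩)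
      · exact Or.inl (R.trans h k)
      · exact Or.inr (Or.inl ⟨R.trans h k1, k2⟩)
      · exact Or.inr (Or.inr ⟨R.trans h k1, k2⟩)
      · exact Or.inr (Or.inl ⟨h1, R.trans (R.symm k) h2⟩)
      · exact Or.inl (R.trans h1 (R.trans (R.symm k1) (R.trans h2 (R.symm k2))))
      · exact Or.inl (R.trans h1 (R.symm k2))
      · exact Or.inr (Or.inr ⟨h1, R.trans (R.symm k) h2⟩)
      · exact Or.inl (R.trans h1 (R.symm k2))
      · exact Or.inl (R.trans h1 (R.trans (R.symm k1) (R.trans h2 (R.symm k2))))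

theorem numCycles_one [Finite α] : numCycles (1 : Perm α) = Nat.card α := by
  refine Nat.card_congr (Equiv.ofBijective (fun x => Quotient.mk _ x) ⟨?_, Quotient.mk_surjective⟩).symm
  intro x y h
  exact sameCycle_one.1 (Quotient.exact h)

/-- The genus of a combinatorial map is not negative. -/
theorem numCycles_add_le [Finite α] (r e : Perm α) :
    numCycles r + numCycles e + numCycles (r * e) ≤
      Nat.card α + 2 * Nat.card (Quotient (orbitSetoid r e)) := by
  classical
  have := Fintype.ofFinite α
  -- A transposition is split off from `e`. Putting it back costs one cycle of `e` and changes the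
  -- cycles of `r * e` by one. The orbits stay the same unless two of them are glued, and in that
  -- case two cycles of `r * e` are merged as well.
  induction hn : e.support.card using Nat.strong_induction_on generalizing e with | _ n ih => ?_
  by_cases he : e = 1
  · subst he
    have h1 : r * (1 : Perm α) = r := Equiv.ext fun x => by simp
    have h2 : Nat.card (Quotient (orbitSetoid r 1)) = numCycles r := by
      refine Nat.card_congr (Quotient.congr (Equiv.refl α) ?_)
      intro x y
      refine ⟨fun h => orbitSetoid_le r 1 (SameCycle.setoid r) (sameCycle_apply_self r)
        (fun x => SameCycle.refl _ _) h, fun h => ?_⟩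
      exact sameCycle_le_setoid r _ (orbitSetoid_left r 1) h
    rw [h1, h2, numCycles_one]
    omega
  · obtain ⟨x, hx⟩ : ∃ x, e x ≠ x := by
      by_contra hcon
      push Not at hcon
      exact he (Equiv.ext hcon)
    set y := e x with hy
    set e' := swap x y * e with he'
    have hlt : e'.support.card < n := by
      rw [← hn]
      apply card_support_swap_mul
      exact hx
    have hIH := ih _ hlt e' rfl
    have hfix : e' x = x := by simp [he', ← hy]
    have hee : e = swap x y * e' := by rw [he', ← mul_assoc, swap_mul_self, one_mul]
    have hns : ¬ e'.SameCycle x y := by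
      intro h
      exact hx (h.eq_of_left hfix).symm
    have hE := numCycles_swap_mul_of_not_sameCycle hns
    rw [← hee] at hE
    have hcomp : r * e = swap (r x) (r y) * (r * e') := by
      ext z
      conv_lhs => rw [hee]
      simp only [Perm.mul_apply]
      exact r.injective.map_swap _ _ _
    have hx1 := orbitSetoid_left r e' x
    have hy1 := orbitSetoid_left r e' y
    have hle : ∀ u v, orbitSetoid r e' u v → orbitSetoid r e u v := by
      intro u v h
      refine orbitSetoid_le r e' _ (orbitSetoid_left r e) ?_ h
      intro z
      have hz := orbitSetoid_right r e z
      have hxy := orbitSetoid_right r e x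
      rw [← hy] at hxy
      have : e' z = swap x y (e z) := rfl
      rw [this]
      rcases eq_or_ne (e z) x with h1 | h1
      · rw [h1, swap_apply_left]; rw [h1] at hz; exact (orbitSetoid r e).trans hz hxy
      · rcases eq_or_ne (e z) y with h2 | h2
        · rw [h2, swap_apply_right]; rw [h2] at hz
          exact (orbitSetoid r e).trans hz ((orbitSetoid r e).symm hxy)
        · rwa [swap_apply_of_ne_of_ne h1 h2]
    have hge : ∀ u v, orbitSetoid r e u v → glueSetoid (orbitSetoid r e') x y u v := by
      intro u v h
      refine orbitSetoid_le r e _ (fun z => Or.inl (orbitSetoid_left r e' z)) ?_ h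
      intro z
      have hz := orbitSetoid_right r e' z
      rw [hee, Perm.mul_apply]
      rcases eq_or_ne (e' z) x with h1 | h1
      · rw [h1, swap_apply_left]; rw [h1] at hz
        exact Or.inr (Or.inl ⟨hz, (orbitSetoid r e').refl _⟩)
      · rcases eq_or_ne (e' z) y with h2 | h2
        · rw [h2, swap_apply_right]; rw [h2] at hz
          exact Or.inr (Or.inr ⟨hz, (orbitSetoid r e').refl _⟩)
        · rw [swap_apply_of_ne_of_ne h1 h2]
          exact Or.inl hz
    have hxye : orbitSetoid r e x y := orbitSetoid_right r e x
    by_cases hO : orbitSetoid r e' x y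
    · have hcard : Nat.card (Quotient (orbitSetoid r e)) = Nat.card (Quotient (orbitSetoid r e')) := by
        refine Nat.card_congr (Quotient.congr (Equiv.refl α) ?_)
        intro u v
        refine ⟨fun h => ?_, fun h => hle _ _ h⟩
        rcases hge _ _ h with h | ⟨h1, h2⟩ | ⟨h1, h2⟩
        · exact h
        · exact (orbitSetoid r e').trans h1 ((orbitSetoid r e').trans hO ((orbitSetoid r e').symm h2))
        · exact (orbitSetoid r e').trans h1 ((orbitSetoid r e').trans ((orbitSetoid r e').symm hO) ((orbitSetoid r e').symm h2))
      rw [hcard]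
      by_cases hF : (r * e').SameCycle (r x) (r y)
      · have hne : r x ≠ r y := fun h => hx (r.injective h).symm
        have := numCycles_swap_mul_of_sameCycle hne hF
        rw [← hcomp] at this
        omega
      · have := numCycles_swap_mul_of_not_sameCycle hF
        rw [← hcomp] at this
        omega
    · have hcard := card_quotient_glue (orbitSetoid r e') (orbitSetoid r e) hle hO hxye hge
      have hF : ¬ (r * e').SameCycle (r x) (r y) := by
        intro h
        apply hO
        have : orbitSetoid r e' (r x) (r y) := by
          refine sameCycle_le_setoid (r * e') _ (fun z => ?_) h
          exact (orbitSetoid r e').trans (orbitSetoid_right r e' z) (orbitSetoid_left r e' _)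
        exact (orbitSetoid r e').trans hx1 ((orbitSetoid r e').trans this ((orbitSetoid r e').symm hy1))
      have := numCycles_swap_mul_of_not_sameCycle hF
      rw [← hcomp] at this
      omega

/-- `s` is the first return map of `t` to the subset that is embedded by `f`. -/
def IsFirstReturn (f : α → β) (s : Perm α) (t : Perm β) : Prop :=
  ∀ x, ∃ n : ℕ, (t ^ (n + 1)) (f x) = f (s x) ∧
    ∀ i, 0 < i → i ≤ n → (t ^ i) (f x) ∉ Set.range f

theorem IsFirstReturn.sameCycle_iff [Finite α] [Finite β] {f : α → β} {s : Perm α} {t : Perm β}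
    (h : IsFirstReturn f s t) (hf : Function.Injective f) (x y : α) :
    s.SameCycle x y ↔ t.SameCycle (f x) (f y) := by
  constructor
  · intro hxy
    refine hxy.mem_of_closed (S := {y | t.SameCycle (f x) (f y)}) ?_ (SameCycle.refl _ _)
    intro z hz
    obtain ⟨n, hn, -⟩ := h z
    simp only [Set.mem_ofPred_eq, ← hn]
    exact sameCycle_pow_right.2 hz
  · intro hxy
    obtain ⟨m, -, hm⟩ := hxy.exists_pow_eq'
    induction m using Nat.strong_induction_on generalizing x with | _ m ih => ?_
    rcases Nat.eq_zero_or_pos m with rfl | hpos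
    · have hxy' : x = y := hf (by simpa using hm)
      rw [hxy']
    · obtain ⟨n, hn, hni⟩ := h x
      have hle : n + 1 ≤ m := by
        by_contra hlt
        exact hni m hpos (by omega) ⟨y, hm.symm⟩
      have hm' : (t ^ (m - (n + 1))) (f (s x)) = f y := by
        rw [← hn, ← Perm.mul_apply, ← pow_add, ← hm]
        congr 2; omega
      have := ih (m - (n + 1)) (by omega) (s x) ⟨(m - (n + 1) : ℕ), by simpa using hm'⟩ hm'
      exact sameCycle_apply_left.1 this

/-- Cycles correspond to cycles provided that none of them avoids the subset. This is how the
regions of a spliced projection are counted. -/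
theorem numCycles_eq_of_firstReturn [Finite α] [Finite β] {f : α → β} {s : Perm α} {t : Perm β}
    (h : ∀ x y, s.SameCycle x y ↔ t.SameCycle (f x) (f y))
    (hmeet : ∀ y, ∃ x, t.SameCycle y (f x)) : numCycles t = numCycles s := by
  refine Nat.card_congr (Equiv.ofBijective
    (Quotient.lift (fun x => Quotient.mk (SameCycle.setoid t) (f x)) ?_) ⟨?_, ?_⟩).symm
  · intro x y hxy
    exact Quotient.sound ((h x y).1 hxy)
  · intro p q
    induction p using Quotient.inductionOn with | h x => ?_
    induction q using Quotient.inductionOn with | h y => ?_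
    intro hxy
    exact Quotient.sound ((h x y).2 (Quotient.exact hxy))
  · intro p
    induction p using Quotient.inductionOn with | h y => ?_
    obtain ⟨x, hx⟩ := hmeet y
    exact ⟨Quotient.mk _ x, Quotient.sound hx.symm⟩

/-- If all cycles but one meet the subset, the first return map has one cycle less. -/
theorem numCycles_eq_succ_of_firstReturn [Finite α] [Finite β] {f : α → β} {s : Perm α}
    {t : Perm β} (h : ∀ x y, s.SameCycle x y ↔ t.SameCycle (f x) (f y)) (z : β)
    (hz : ∀ x, ¬ t.SameCycle z (f x))
    (hmeet : ∀ y, t.SameCycle z y ∨ ∃ x, t.SameCycle y (f x)) :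
    numCycles t = numCycles s + 1 := by
  have e : Option (Quotient (SameCycle.setoid s)) ≃ Quotient (SameCycle.setoid t) := by
    refine Equiv.ofBijective (fun o => o.elim (Quotient.mk _ z)
      (Quotient.lift (fun x => Quotient.mk (SameCycle.setoid t) (f x)) ?_)) ⟨?_, ?_⟩
    · intro x y hxy
      exact Quotient.sound ((h x y).1 hxy)
    · rintro (_ | p) (_ | q)
      · simp
      · induction q using Quotient.inductionOn with | h y => ?_
        intro hxy
        exact absurd (Quotient.exact hxy) (hz y)
      · induction p using Quotient.inductionOn with | h y => ?_
        intro hxy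
        exact absurd (Quotient.exact hxy.symm) (hz y)
      · induction p using Quotient.inductionOn with | h x => ?_
        induction q using Quotient.inductionOn with | h y => ?_
        intro hxy
        exact congrArg some (Quotient.sound ((h x y).2 (Quotient.exact hxy)))
    · intro p
      induction p using Quotient.inductionOn with | h y => ?_
      rcases hmeet y with hy | ⟨x, hx⟩
      · exact ⟨none, Quotient.sound hy⟩
      · exact ⟨some (Quotient.mk _ x), Quotient.sound hx.symm⟩
  unfold numCycles
  rw [← Nat.card_congr e, Finite.card_option]

theorem numCycles_mul_of_card [Finite α] (f : Perm α) (k : ℕ)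
    (h : ∀ x, Nat.card {y // f.SameCycle x y} = k) : numCycles f * k = Nat.card α := by
  classical
  have := Fintype.ofFinite α
  have e : α ≃ Σ q : Quotient (SameCycle.setoid f), {y // Quotient.mk (SameCycle.setoid f) y = q} :=
    (Equiv.sigmaFiberEquiv _).symm
  rw [Nat.card_congr e, Nat.card_sigma]
  have : ∀ q : Quotient (SameCycle.setoid f),
      Nat.card {y // Quotient.mk (SameCycle.setoid f) y = q} = k := by
    intro q
    induction q using Quotient.inductionOn with | h x => ?_
    rw [← h x]
    refine Nat.card_congr (Equiv.subtypeEquivRight fun y => ?_)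
    rw [@eq_comm (Quotient (SameCycle.setoid f))]
    exact ⟨fun h => Quotient.exact h, fun h => Quotient.sound h⟩
  simp only [this, Finset.sum_const, numCycles, Finset.card_univ, smul_eq_mul, Nat.card_eq_fintype_card]

end Cycles

open Equiv Equiv.Perm

/-- The form in which connectedness is used throughout. Since both maps are involutions, a set
closed under them is a union of classes. -/
theorem eqvGen_iff_closed {α : Type} {e s : α → α} (he : ∀ x, e (e x) = x)
    (hs : ∀ x, s (s x) = x) :
    (∀ x y, Relation.EqvGen (fun a b => b = e a ∨ b = s a) x y) ↔
      ∀ S : Set α, (∀ x ∈ S, e x ∈ S) → (∀ x ∈ S, s x ∈ S) → ∀ x ∈ S, ∀ y, y ∈ S := by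
  constructor
  · intro h S h1 h2 x hx y
    suffices H : ∀ x y, Relation.EqvGen (fun a b => b = e a ∨ b = s a) x y → (x ∈ S ↔ y ∈ S) from
      (H x y (h x y)).1 hx
    intro x y hxy
    induction hxy with
    | rel x y h =>
      rcases h with rfl | rfl
      · exact ⟨h1 _, fun h => by simpa [he] using h1 _ h⟩
      · exact ⟨h2 _, fun h => by simpa [hs] using h2 _ h⟩
    | refl x => exact Iff.rfl
    | symm x y _ ih => exact ih.symm
    | trans x y z _ _ ih1 ih2 => exact ih1.trans ih2
  · intro h x y
    exact h {y | Relation.EqvGen (fun a b => b = e a ∨ b = s a) x y}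
      (fun a ha => ha.trans _ _ _ (.rel _ _ (Or.inl rfl)))
      (fun a ha => ha.trans _ _ _ (.rel _ _ (Or.inr rfl))) x (.refl x) y

namespace ZModTwo

theorem add_self (a : ZMod 2) : a + a = 0 := CharTwo.add_self_eq_zero a

theorem eq_zero_or_one (a : ZMod 2) : a = 0 ∨ a = 1 := by
  revert a; decide

theorem add_eq_zero_iff (a b : ZMod 2) : a + b = 0 ↔ a = b := by
  revert a b; decide

end ZModTwo

/-! ### The darts at a double point and how a splice joins them. -/

namespace KnotProjection

variable {P Q : KnotProjection}

instance (P : KnotProjection) : Finite P.Dart := P.finite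

attribute [simp] rot_four edge_edge

theorem rot_ne (x : P.Dart) : P.rot x ≠ x := fun h => P.rot_two_ne x (by rw [h, h])

theorem rot_three_ne (x : P.Dart) : P.rot (P.rot (P.rot x)) ≠ x := fun h => by
  have := P.rot_four x
  rw [h] at this
  exact rot_ne x this

theorem edge_inj {x y : P.Dart} : P.edge x = P.edge y ↔ x = y := P.edge.injective.eq_iff

theorem rot_inj {x y : P.Dart} : P.rot x = P.rot y ↔ x = y := P.rot.injective.eq_iff

theorem edge_eq_iff {x y : P.Dart} : P.edge x = y ↔ x = P.edge y :=
  ⟨fun h => by rw [← h, edge_edge], fun h => by rw [h, edge_edge]⟩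

theorem mem_dartsAt {d x : P.Dart} : x ∈ P.dartsAt d ↔ x = d ∨ x = P.rot d ∨ x = P.rot (P.rot d) ∨
    x = P.rot (P.rot (P.rot d)) := Iff.rfl

theorem self_mem_dartsAt (d : P.Dart) : d ∈ P.dartsAt d := Or.inl rfl

theorem rot_mem_dartsAt {d x : P.Dart} : P.rot x ∈ P.dartsAt d ↔ x ∈ P.dartsAt d := by
  have h4 := P.rot_four d
  simp only [mem_dartsAt]
  constructor
  · rintro (h | h | h | h)
    · rw [← h4, rot_inj] at h; simp [h]
    · rw [rot_inj] at h; simp [h]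
    · rw [rot_inj] at h; simp [h]
    · rw [rot_inj] at h; simp [h]
  · rintro (h | h | h | h) <;> simp [h]

theorem mem_dartsAt_comm {d x : P.Dart} : x ∈ P.dartsAt d ↔ d ∈ P.dartsAt x := by
  have : ∀ d x : P.Dart, x ∈ P.dartsAt d → d ∈ P.dartsAt x := by
    intro d x h
    rcases h with rfl | rfl | rfl | rfl <;> simp [mem_dartsAt]
  exact ⟨this _ _, this _ _⟩

theorem dartsAt_eq_of_mem {d x : P.Dart} (h : x ∈ P.dartsAt d) : P.dartsAt x = P.dartsAt d := by
  ext y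
  rw [mem_dartsAt_comm, mem_dartsAt_comm (d := d)]
  rcases h with rfl | rfl | rfl | rfl <;> simp [rot_mem_dartsAt]

theorem rot_symm_apply (x : P.Dart) : P.rot.symm x = P.rot (P.rot (P.rot x)) := by
  rw [Equiv.symm_apply_eq, rot_four]

theorem closed_univ {S : Set P.Dart} (h1 : ∀ x ∈ S, P.edge x ∈ S)
    (h2 : ∀ x ∈ S, P.rot (P.rot x) ∈ S) {x : P.Dart} (hx : x ∈ S) (y : P.Dart) : y ∈ S :=
  (eqvGen_iff_closed (s := fun x => P.rot (P.rot x)) P.edge_edge (fun _ => P.rot_four _)).1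
    P.one_component S h1 h2 x hx y

theorem eq_of_invariant {γ : Type*} {χ : P.Dart → γ} (h1 : ∀ x, χ (P.edge x) = χ x)
    (h2 : ∀ x, χ (P.rot (P.rot x)) = χ x) (x y : P.Dart) : χ x = χ y :=
  (closed_univ (S := {y | χ x = χ y}) (fun z hz => by simpa [h1] using hz)
    (fun z hz => by simpa [h2] using hz) (x := x) rfl y)

section smooth

variable (d : P.Dart)

@[simp] theorem smooth_zero : P.smooth d d = P.rot d := by simp [smooth]

@[simp] theorem smooth_one : P.smooth d (P.rot d) = d := by simp [smooth, rot_ne]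

@[simp] theorem smooth_two : P.smooth d (P.rot (P.rot d)) = P.rot (P.rot (P.rot d)) := by
  simp [smooth, rot_ne, P.rot_two_ne]

@[simp] theorem smooth_three : P.smooth d (P.rot (P.rot (P.rot d))) = P.rot (P.rot d) := by
  simp [smooth, rot_ne, P.rot_two_ne, rot_three_ne]

variable {d}

theorem smooth_of_notMem {x : P.Dart} (h : x ∉ P.dartsAt d) : P.smooth d x = P.rot (P.rot x) := by
  simp only [mem_dartsAt, not_or] at h
  simp [smooth, h]

theorem smooth_mem_dartsAt {x : P.Dart} : P.smooth d x ∈ P.dartsAt d ↔ x ∈ P.dartsAt d := by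
  by_cases h : x ∈ P.dartsAt d
  · simp only [h, iff_true]
    rcases h with rfl | rfl | rfl | rfl <;> simp [mem_dartsAt]
  · simp [smooth_of_notMem h, rot_mem_dartsAt]

theorem smooth_smooth (x : P.Dart) : P.smooth d (P.smooth d x) = x := by
  by_cases h : x ∈ P.dartsAt d
  · rcases h with rfl | rfl | rfl | rfl <;> simp
  · rw [smooth_of_notMem h, smooth_of_notMem (by simpa [rot_mem_dartsAt] using h), rot_four]

theorem smooth_ne (x : P.Dart) : P.smooth d x ≠ x := by
  by_cases h : x ∈ P.dartsAt d
  · rcases h with rfl | rfl | rfl | rfl <;> simp [rot_ne, (rot_ne _).symm]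
  · rw [smooth_of_notMem h]; exact P.rot_two_ne x

theorem spliceConnected_iff : P.SpliceConnected d ↔
    ∀ S : Set P.Dart, (∀ x ∈ S, P.edge x ∈ S) → (∀ x ∈ S, P.smooth d x ∈ S) →
      ∀ x ∈ S, ∀ y, y ∈ S :=
  eqvGen_iff_closed P.edge_edge smooth_smooth

end smooth

/-! ### Potentials -/

/-- The travelling permutation: along the arc, then straight through the double point. -/
def travel (P : KnotProjection) : Equiv.Perm P.Dart := P.rot * P.rot * P.edge

theorem travel_apply (x : P.Dart) : P.travel x = P.rot (P.rot (P.edge x)) := rfl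

theorem edge_rot_two_travel (x : P.Dart) : P.edge (P.rot (P.rot (P.travel x))) = x := by
  simp [travel_apply]

/-- A journey that ends on its first arc in the opposite direction can be shortened by one step at
each end, until an arc or a branch at a double point would be its own reverse. -/
theorem travel_pow_ne_edge (n : ℕ) (x : P.Dart) : (P.travel ^ n) x ≠ P.edge x := by
  induction n using Nat.strong_induction_on generalizing x with | _ n ih => ?_
  match n with
  | 0 => exact fun h => P.edge_ne x h.symm
  | 1 => exact fun h => P.rot_two_ne _ h
  | n + 2 =>
    intro h
    apply ih n (by omega) (P.travel x)
    have h1 : P.travel ((P.travel ^ n) (P.travel x)) = P.edge x := by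
      rw [← h, pow_succ', pow_succ]; rfl
    have h2 := edge_rot_two_travel ((P.travel ^ n) (P.travel x))
    rw [h1] at h2
    rw [← h2, travel_apply]

theorem not_sameCycle_travel_edge (x : P.Dart) : ¬ P.travel.SameCycle x (P.edge x) := by
  intro h
  obtain ⟨i, -, hi⟩ := h.exists_pow_eq'
  exact travel_pow_ne_edge i x hi

theorem sameCycle_travel_or (x y : P.Dart) :
    P.travel.SameCycle x y ∨ P.travel.SameCycle x (P.edge y) := by
  refine closed_univ (S := {y | P.travel.SameCycle x y ∨ P.travel.SameCycle x (P.edge y)})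
    ?_ ?_ (Or.inl (SameCycle.refl _ x)) y
  · rintro y (h | h)
    · right; simpa
    · left; exact h
  · rintro y (h | h)
    · right
      have : P.travel (P.edge (P.rot (P.rot y))) = y := by simp [travel_apply]
      exact sameCycle_apply_right.1 (by rw [this]; exact h)
    · left
      have : P.travel (P.edge y) = P.rot (P.rot y) := by simp [travel_apply]
      rw [← this]
      exact sameCycle_apply_right.2 h

/-- The travelling permutation has two cycles, the two orientations of the curve, and `edge`
exchanges them. -/
theorem sameCycle_travel_edge_iff (x y : P.Dart) :
    P.travel.SameCycle x (P.edge y) ↔ ¬ P.travel.SameCycle x y := by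
  constructor
  · intro h1 h2
    exact not_sameCycle_travel_edge y (h2.symm.trans h1)
  · intro h
    exact (sameCycle_travel_or x y).resolve_left h

theorem sameCycle_travel_rot_two_iff (x y : P.Dart) :
    P.travel.SameCycle x (P.rot (P.rot y)) ↔ ¬ P.travel.SameCycle x y := by
  have : P.travel (P.edge y) = P.rot (P.rot y) := by simp [travel_apply]
  rw [← this, sameCycle_apply_right, sameCycle_travel_edge_iff]

/-- A function on the darts, modulo 2, that is constant along the curve, except that it changes
whenever the curve passes through the double point of `c`. -/
structure IsPot (P : KnotProjection) (c : P.Dart) (f : P.Dart → ZMod 2) : Prop where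
  edge : ∀ x, f (P.edge x) = f x
  at_mem : ∀ x ∈ P.dartsAt c, f (P.rot (P.rot x)) = f x + 1
  off : ∀ x ∉ P.dartsAt c, f (P.rot (P.rot x)) = f x

theorem IsPot.of_mem {c c' : P.Dart} {f : P.Dart → ZMod 2} (h : P.IsPot c f)
    (hc : c' ∈ P.dartsAt c) : P.IsPot c' f := by
  refine ⟨h.edge, ?_, ?_⟩ <;> rw [dartsAt_eq_of_mem hc]
  · exact h.at_mem
  · exact h.off

theorem IsPot.add_eq {c : P.Dart} {f g : P.Dart → ZMod 2} (hf : P.IsPot c f) (hg : P.IsPot c g)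
    (x y : P.Dart) : f x + f y = g x + g y := by
  have := eq_of_invariant (χ := fun x => f x + g x) (fun x => by simp [hf.edge, hg.edge])
    (fun x => by
      by_cases hx : x ∈ P.dartsAt c
      · simp only [hf.at_mem x hx, hg.at_mem x hx]
        generalize f x = a; generalize g x = b; revert a b; decide
      · simp only [hf.off x hx, hg.off x hx]) x y
  revert this
  generalize f x = a; generalize g x = b; generalize f y = a'; generalize g y = b'
  revert a b a' b'; decide

/-- The double point of `c` cuts the curve into two loops, and a potential is the indicator of one
of them. On the cycle of `P.travel` through `c`, the cut is multiplication by a transposition; a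
dart of the opposite orientation gets the value of the other end of its arc. -/
theorem exists_isPot (c : P.Dart) : ∃ f, P.IsPot c f := by
  classical
  -- `b` is the dart by which the other branch leaves the double point, in the orientation given by
  -- `c`.
  obtain ⟨b, hb, hcb, hO⟩ : ∃ b, b ≠ c ∧ P.travel.SameCycle c b ∧
      ∀ x ∈ P.dartsAt c, P.travel.SameCycle c x ↔ x = c ∨ x = b := by
    have h2 := (sameCycle_travel_rot_two_iff c c).not_left.2 (SameCycle.refl _ _)
    have h13 := sameCycle_travel_rot_two_iff c (P.rot c)
    by_cases h1 : P.travel.SameCycle c (P.rot c)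
    · refine ⟨P.rot c, rot_ne c, h1, ?_⟩
      have h3 : ¬ P.travel.SameCycle c (P.rot (P.rot (P.rot c))) := by rw [h13]; simpa
      rintro x (rfl | rfl | rfl | rfl)
      · simp [SameCycle.refl]
      · simp [h1]
      · simp [h2, P.rot_two_ne, rot_ne]
      · simp [h3, rot_three_ne, P.rot_two_ne]
    · have h3 : P.travel.SameCycle c (P.rot (P.rot (P.rot c))) := by rw [h13]; simpa
      refine ⟨P.rot (P.rot (P.rot c)), rot_three_ne c, h3, ?_⟩
      rintro x (rfl | rfl | rfl | rfl)
      · simp [SameCycle.refl]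
      · simp [h1, rot_ne, (P.rot_two_ne _).symm]
      · simp [h2, P.rot_two_ne, (rot_ne _).symm]
      · simp [h3]
  set t := swap c b * P.travel with ht
  have hns : ¬ t.SameCycle c b := not_sameCycle_swap_mul hb.symm hcb
  let g : P.Dart → ZMod 2 := fun x => if t.SameCycle c x then 1 else 0
  let f : P.Dart → ZMod 2 := fun x => if P.travel.SameCycle c x then g x else g (P.edge x)
  have hgt : ∀ x, g (t x) = g x := fun x => by simp only [g, sameCycle_apply_right]
  have hgc : g c = 1 := by simp [g, SameCycle.refl]
  have hgb : g b = 0 := by simp [g, hns]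
  have key : ∀ x, P.travel.SameCycle c x →
      g (P.travel x) = g x + if P.travel x ∈ P.dartsAt c then 1 else 0 := by
    intro x hx
    rw [← hgt x]
    have hx' : P.travel.SameCycle c (P.travel x) := sameCycle_apply_right.2 hx
    have htx : t x = swap c b (P.travel x) := rfl
    rw [htx]
    rcases eq_or_ne (P.travel x) c with h1 | h1
    · rw [h1, swap_apply_left, hgc, hgb, if_pos (self_mem_dartsAt c)]; rfl
    · rcases eq_or_ne (P.travel x) b with h2 | h2
      · have hbm : b ∈ P.dartsAt c := by
          by_contra hbm
          have := hO b
          simp only [mem_dartsAt, not_or] at hbm this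
          have h13 := sameCycle_travel_rot_two_iff c (P.rot c)
          have h1 := hO (P.rot c) (by simp [mem_dartsAt])
          have h3 := hO (P.rot (P.rot (P.rot c))) (by simp [mem_dartsAt])
          rw [h1, h3] at h13
          simp [rot_ne, rot_three_ne, Ne.symm hbm.2.1, Ne.symm hbm.2.2.2] at h13
        rw [h2, swap_apply_right, hgc, hgb, if_pos hbm]; rfl
      · rw [swap_apply_of_ne_of_ne h1 h2, if_neg, add_zero]
        intro hm
        rcases (hO _ hm).1 hx' with h | h
        · exact h1 h
        · exact h2 h
  have hedge : ∀ x, f (P.edge x) = f x := by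
    intro x
    simp only [f, sameCycle_travel_edge_iff, edge_edge]
    by_cases h : P.travel.SameCycle c x <;> simp [h]
  have hmain : ∀ x, f (P.rot (P.rot x)) = f x + if x ∈ P.dartsAt c then 1 else 0 := by
    have hA : ∀ x, ¬ P.travel.SameCycle c x →
        f (P.rot (P.rot x)) = f x + if x ∈ P.dartsAt c then 1 else 0 := by
      intro x hx
      have h1 : P.travel.SameCycle c (P.rot (P.rot x)) := by
        rw [sameCycle_travel_rot_two_iff]; exact hx
      have h2 : P.travel.SameCycle c (P.edge x) := by
        rw [sameCycle_travel_edge_iff]; exact hx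
      have h3 : P.travel (P.edge x) = P.rot (P.rot x) := by simp [travel_apply]
      have := key _ h2
      rw [h3] at this
      simp only [f, h1, hx, if_true, if_false, this, rot_mem_dartsAt]
    intro x
    by_cases hx : P.travel.SameCycle c x
    · have h1 : ¬ P.travel.SameCycle c (P.rot (P.rot x)) := by
        rw [sameCycle_travel_rot_two_iff]; simpa
      have := hA _ h1
      simp only [rot_four, rot_mem_dartsAt] at this
      rw [this]
      generalize f (P.rot (P.rot x)) = a
      split_ifs
      · revert a; decide
      · simp
    · exact hA x hx
  exact ⟨f, hedge, fun x hx => by rw [hmain, if_pos hx], fun x hx => by rw [hmain, if_neg hx, add_zero]⟩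

/-- A chosen potential. -/
noncomputable def pot (P : KnotProjection) (c : P.Dart) : P.Dart → ZMod 2 := (exists_isPot c).choose

theorem isPot_pot (c : P.Dart) : P.IsPot c (P.pot c) := (exists_isPot c).choose_spec

/-- The interlacement of the double points of `c` and `y`, modulo 2. -/
noncomputable def inter (P : KnotProjection) (c y : P.Dart) : ZMod 2 :=
  P.pot c y + P.pot c (P.rot y)

theorem IsPot.inter_eq {c : P.Dart} {f : P.Dart → ZMod 2} (hf : P.IsPot c f) (y : P.Dart) :
    P.inter c y = f y + f (P.rot y) := (isPot_pot c).add_eq hf _ _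

theorem inter_eq_of_mem_left {c c' : P.Dart} (h : c' ∈ P.dartsAt c) (y : P.Dart) :
    P.inter c' y = P.inter c y :=
  ((isPot_pot c).of_mem h).inter_eq y

theorem inter_rot_of_notMem {c y : P.Dart} (h : y ∉ P.dartsAt c) :
    P.inter c (P.rot y) = P.inter c y := by
  rw [inter, inter, (isPot_pot c).off y h, add_comm]

/-- At its own double point the value depends on the dart; it will tell the two splices apart
(`spliceConnected_iff_inter`). -/
theorem inter_rot_of_mem {c y : P.Dart} (h : y ∈ P.dartsAt c) :
    P.inter c (P.rot y) = P.inter c y + 1 := by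
  rw [inter, inter, (isPot_pot c).at_mem y h]
  ring

theorem inter_eq_of_mem_right {c y y' : P.Dart} (h : y ∉ P.dartsAt c) (hy : y' ∈ P.dartsAt y) :
    P.inter c y' = P.inter c y := by
  rcases hy with rfl | rfl | rfl | rfl
  · rfl
  · exact inter_rot_of_notMem h
  · rw [inter_rot_of_notMem (by rwa [rot_mem_dartsAt]), inter_rot_of_notMem h]
  · rw [inter_rot_of_notMem (by rwa [rot_mem_dartsAt, rot_mem_dartsAt]),
      inter_rot_of_notMem (by rwa [rot_mem_dartsAt]), inter_rot_of_notMem h]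

/-- An oriented curve leaves the double point by exactly one of `d`, `rot² d` and exactly one of
`rot d`, `rot³ d`; by `hG` it does not matter which. -/
theorem sum_travel_cycle_at (x d : P.Dart) [Fintype P.Dart] [DecidablePred (P.travel.SameCycle x)]
    [DecidablePred (· ∈ P.dartsAt d)] {G : P.Dart → ZMod 2} (hG : ∀ y ∈ P.dartsAt d, G (P.rot (P.rot y)) = G y) :
    (∑ y with P.travel.SameCycle x y, if y ∈ P.dartsAt d then G y else 0) = G d + G (P.rot d) := by
  classical
  have hs : (Finset.univ.filter fun y => y ∈ P.dartsAt d) =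
      {d, P.rot d, P.rot (P.rot d), P.rot (P.rot (P.rot d))} := by
    ext y; simp [mem_dartsAt]
  rw [← Finset.sum_filter, Finset.filter_filter]
  simp_rw [and_comm (a := P.travel.SameCycle x _)]
  rw [← Finset.filter_filter, Finset.sum_filter, hs, Finset.sum_insert, Finset.sum_insert,
    Finset.sum_insert, Finset.sum_singleton]
  · simp only [sameCycle_travel_rot_two_iff, hG d (by simp [mem_dartsAt]),
      hG (P.rot d) (by simp [mem_dartsAt])]
    by_cases h1 : P.travel.SameCycle x d <;> by_cases h2 : P.travel.SameCycle x (P.rot d) <;>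
      simp [h1, h2, add_comm]
  · simp [(rot_ne _).symm]
  · simp [(rot_ne _).symm, (P.rot_two_ne _).symm]
  · simp [(rot_ne _).symm, (P.rot_two_ne _).symm, (rot_three_ne _).symm]

/-- Integration by parts modulo 2. The two potentials never jump together, so the increment of `f *
g` along the curve is `f` at the passages of `d` plus `g` at the passages of `c`. Around the closed
curve the increments add up to zero. -/
theorem inter_comm {c d : P.Dart} (h : d ∉ P.dartsAt c) : P.inter c d = P.inter d c := by
  classical
  have := Fintype.ofFinite P.Dart
  have h' : c ∉ P.dartsAt d := fun h1 => h (mem_dartsAt_comm.1 h1)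
  have hdisj : ∀ y, y ∈ P.dartsAt c → y ∈ P.dartsAt d → False := fun y h1 h2 => by
    rw [← dartsAt_eq_of_mem h2, dartsAt_eq_of_mem h1] at h'
    exact h' (self_mem_dartsAt c)
  set f := P.pot c with hf
  set g := P.pot d with hg
  have hpf := isPot_pot c
  have hpg := isPot_pot d
  rw [← hf] at hpf
  rw [← hg] at hpg
  have key : ∀ y, f (P.travel y) * g (P.travel y) + f y * g y =
      (if P.travel y ∈ P.dartsAt d then f (P.travel y) else 0) +
      (if P.travel y ∈ P.dartsAt c then g (P.travel y) else 0) := by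
    intro y
    have h1 : f (P.travel y) = f y + if P.travel y ∈ P.dartsAt c then 1 else 0 := by
      simp only [travel_apply, rot_mem_dartsAt]
      split_ifs with hm
      · rw [hpf.at_mem _ hm, hpf.edge]
      · rw [hpf.off _ hm, hpf.edge, add_zero]
    have h2 : g (P.travel y) = g y + if P.travel y ∈ P.dartsAt d then 1 else 0 := by
      simp only [travel_apply, rot_mem_dartsAt]
      split_ifs with hm
      · rw [hpg.at_mem _ hm, hpg.edge]
      · rw [hpg.off _ hm, hpg.edge, add_zero]
    rw [h1, h2]
    generalize f y = a; generalize g y = b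
    by_cases m1 : P.travel y ∈ P.dartsAt c <;> by_cases m2 : P.travel y ∈ P.dartsAt d <;>
      simp only [m1, m2, if_true, if_false]
    · exact (hdisj _ m1 m2).elim
    all_goals revert a b; decide
  have hbij : ∀ F : P.Dart → ZMod 2, (∑ y with P.travel.SameCycle c y, F (P.travel y)) =
      ∑ y with P.travel.SameCycle c y, F y := by
    intro F
    refine Finset.sum_equiv P.travel ?_ (fun _ _ => rfl)
    intro y
    simp
  have hsum : (∑ y with P.travel.SameCycle c y, (f (P.travel y) * g (P.travel y) + f y * g y)) = 0 := by
    rw [Finset.sum_add_distrib, hbij (fun y => f y * g y)]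
    exact ZModTwo.add_self _
  simp_rw [key] at hsum
  rw [hbij (fun y => (if y ∈ P.dartsAt d then f y else 0) + if y ∈ P.dartsAt c then g y else 0),
    Finset.sum_add_distrib, sum_travel_cycle_at c d, sum_travel_cycle_at c c] at hsum
  · exact (ZModTwo.add_eq_zero_iff _ _).1 hsum
  · exact fun y hy => hpg.off y fun h2 => hdisj y hy h2
  · exact fun y hy => hpf.off y fun h2 => hdisj y h2 hy

/-- If the potential agrees on the joined darts `d` and `rot d`, then it is constant along the
spliced curve but takes both values, so there are two components. Conversely, a proper nonempty set
closed under the spliced curve has as indicator a potential of `d` that agrees on `d` and `rot d`.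
-/
theorem spliceConnected_iff_inter {d : P.Dart} : P.SpliceConnected d ↔ P.inter d d = 1 := by
  classical
  constructor
  · intro h
    by_contra hne
    have h0 : P.pot d d = P.pot d (P.rot d) := by
      rcases ZModTwo.eq_zero_or_one (P.inter d d) with h0 | h0
      · exact (ZModTwo.add_eq_zero_iff _ _).1 h0
      · exact absurd h0 hne
    have hp := isPot_pot d
    have h2 := hp.at_mem d (by simp [mem_dartsAt])
    have h3 := hp.at_mem (P.rot d) (by simp [mem_dartsAt])
    have hcl := spliceConnected_iff.1 h {y | P.pot d y = P.pot d d} (fun x hx => by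
      simpa [hp.edge] using hx) (fun x hx => by
        by_cases hm : x ∈ P.dartsAt d
        · rcases hm with rfl | rfl | rfl | rfl
          · simp [h0]
          · simp
          · simp only [Set.mem_ofPred_eq] at hx; rw [hx] at h2; simp at h2
          · simp only [Set.mem_ofPred_eq] at hx; rw [hx, h0] at h3; simp at h3
        · simpa [smooth_of_notMem hm, hp.off x hm] using hx) d rfl (P.rot (P.rot d))
    simp only [Set.mem_ofPred_eq] at hcl
    rw [hcl] at h2
    simp at h2
  · intro h
    rw [spliceConnected_iff]
    intro S hS1 hS2 x hx
    have hsm : ∀ x, P.smooth d x ∈ S ↔ x ∈ S := fun x =>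
      ⟨fun h => by simpa [smooth_smooth] using hS2 _ h, hS2 x⟩
    have hed : ∀ x, P.edge x ∈ S ↔ x ∈ S := fun x =>
      ⟨fun h => by simpa using hS1 _ h, hS1 x⟩
    have h01 : P.rot d ∈ S ↔ d ∈ S := by rw [← hsm d, smooth_zero]
    have h23 : P.rot (P.rot (P.rot d)) ∈ S ↔ P.rot (P.rot d) ∈ S := by
      rw [← hsm (P.rot (P.rot d)), smooth_two]
    by_cases hd : P.rot (P.rot d) ∈ S ↔ d ∈ S
    · refine closed_univ hS1 (fun y hy => ?_) hx
      by_cases hm : y ∈ P.dartsAt d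
      · rcases hm with rfl | rfl | rfl | rfl
        · exact hd.2 hy
        · exact h23.2 (hd.2 (h01.1 hy))
        · rw [rot_four]; exact hd.1 hy
        · rw [rot_four]; exact h01.2 (hd.1 (h23.1 hy))
      · rw [← smooth_of_notMem hm]; exact hS2 _ hy
    · exfalso
      have hp : P.IsPot d (fun x => if x ∈ S then 1 else 0) := by
        refine ⟨fun x => by simp [hed], ?_, fun x hm => ?_⟩
        · intro x hm
          have hone : (1 : ZMod 2) + 1 = 0 := by decide
          rcases hm with hm | hm | hm | hm <;> rw [hm] <;> (try simp only [rot_four, h01, h23]) <;>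
            by_cases h1 : d ∈ S <;> by_cases h2 : P.rot (P.rot d) ∈ S <;>
            simp_all
        · simp [← smooth_of_notMem hm, hsm]
      rw [hp.inter_eq d] at h
      simp only [h01] at h
      rw [ZModTwo.add_self] at h
      exact zero_ne_one h

end KnotProjection

namespace KnotProjection

variable {P Q : KnotProjection}

/-! ### Counting -/

theorem ncard_dartsAt (d : P.Dart) : (P.dartsAt d).ncard = 4 := by
  have : P.dartsAt d = {d, P.rot d, P.rot (P.rot d), P.rot (P.rot (P.rot d))} := by
    ext y; simp [mem_dartsAt]
  rw [this, Set.ncard_insert_of_notMem, Set.ncard_insert_of_notMem, Set.ncard_pair]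
  · simp [(rot_ne _).symm]
  · simp [(rot_ne _).symm, (P.rot_two_ne _).symm]
  · simp [(rot_ne _).symm, (P.rot_two_ne _).symm, (rot_three_ne _).symm]

theorem sameCycle_rot_iff {α : Type} [Finite α] {r : Equiv.Perm α} (h4 : ∀ x, r (r (r (r x))) = x)
    (x y : α) : r.SameCycle x y ↔ y = x ∨ y = r x ∨ y = r (r x) ∨ y = r (r (r x)) := by
  constructor
  · intro h
    refine h.mem_of_closed (S := {y | y = x ∨ y = r x ∨ y = r (r x) ∨ y = r (r (r x))}) ?_ (Or.inl rfl)
    rintro y (rfl | rfl | rfl | rfl) <;> simp [h4]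
  · rintro (rfl | rfl | rfl | rfl) <;> simp [SameCycle.refl]

theorem sameCycle_involution_iff {α : Type} [Finite α] {e : Equiv.Perm α} (h2 : ∀ x, e (e x) = x)
    (x y : α) : e.SameCycle x y ↔ y = x ∨ y = e x := by
  constructor
  · intro h
    refine h.mem_of_closed (S := {y | y = x ∨ y = e x}) ?_ (Or.inl rfl)
    rintro y (rfl | rfl) <;> simp [h2]
  · rintro (rfl | rfl) <;> simp [SameCycle.refl]

theorem numCycles_mul_four {α : Type} [Finite α] {r : Equiv.Perm α}
    (h4 : ∀ x, r (r (r (r x))) = x) (h2 : ∀ x, r (r x) ≠ x) : numCycles r * 4 = Nat.card α := by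
  refine numCycles_mul_of_card r 4 fun x => ?_
  have h1 : ∀ x, r x ≠ x := fun x h => h2 x (by rw [h, h])
  have h3 : ∀ x, r (r (r x)) ≠ x := fun x h => by
    have := h4 x
    rw [h] at this
    exact h1 x this
  simp_rw [sameCycle_rot_iff h4]
  have : {y | y = x ∨ y = r x ∨ y = r (r x) ∨ y = r (r (r x))} = {x, r x, r (r x), r (r (r x))} := by
    ext y; simp
  change Set.ncard {y | y = x ∨ y = r x ∨ y = r (r x) ∨ y = r (r (r x))} = 4
  rw [this, Set.ncard_insert_of_notMem, Set.ncard_insert_of_notMem, Set.ncard_pair]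
  · simp [(h1 _).symm]
  · simp [(h1 _).symm, (h2 _).symm]
  · simp [(h1 _).symm, (h2 _).symm, (h3 _).symm]

theorem numCycles_mul_two {α : Type} [Finite α] {e : Equiv.Perm α}
    (h2 : ∀ x, e (e x) = x) (h1 : ∀ x, e x ≠ x) : numCycles e * 2 = Nat.card α := by
  refine numCycles_mul_of_card e 2 fun x => ?_
  simp_rw [sameCycle_involution_iff h2]
  have : {y | y = x ∨ y = e x} = {x, e x} := by
    ext y; simp
  change Set.ncard {y | y = x ∨ y = e x} = 2
  rw [this, Set.ncard_pair (h1 _).symm]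

theorem numCycles_rot_mul (P : KnotProjection) : numCycles P.rot * 4 = Nat.card P.Dart :=
  numCycles_mul_four P.rot_four P.rot_two_ne

theorem numCycles_edge_mul (P : KnotProjection) : numCycles P.edge * 2 = Nat.card P.Dart :=
  numCycles_mul_two P.edge_edge P.edge_ne

/-- The cycles of `face` are the boundaries of the regions: `face x` follows `x` on the boundary of
the region on the right of the arc of `x`. -/
def face (P : KnotProjection) : Equiv.Perm P.Dart := P.rot * P.edge

theorem face_apply (x : P.Dart) : P.face x = P.rot (P.edge x) := rfl

theorem euler (P : KnotProjection) [Nonempty P.Dart] :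
    numCycles P.rot + numCycles P.face = numCycles P.edge + 2 := P.spherical ‹_›

/-- Multiplying the rotation by this transposition breaks the 4-cycle at the double point into the
two 2-cycles of the splice. The spliced curve thus becomes a combinatorial map on the same darts,
with two vertices of valency two, and the genus bound applies to it. -/
theorem swap_mul_rot_of_mem [DecidableEq P.Dart] {d y : P.Dart} (h : y ∈ P.dartsAt d) :
    (swap d (P.rot (P.rot d)) * P.rot) y = P.smooth d y := by
  rcases h with h | h | h | h <;> rw [h] <;> simp only [Perm.mul_apply, rot_four, smooth_zero,
    smooth_one, smooth_two, smooth_three, swap_apply_left, swap_apply_right]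
  · rw [swap_apply_of_ne_of_ne (rot_ne _) (rot_ne _).symm]
  · rw [swap_apply_of_ne_of_ne (rot_three_ne _) (rot_ne _)]

theorem swap_mul_rot_of_notMem [DecidableEq P.Dart] {d y : P.Dart} (h : y ∉ P.dartsAt d) :
    (swap d (P.rot (P.rot d)) * P.rot) y = P.rot y := by
  rw [← rot_mem_dartsAt] at h
  simp only [mem_dartsAt, not_or] at h
  rw [Perm.mul_apply, swap_apply_of_ne_of_ne h.1 h.2.2.1]

theorem card_quotient_eq_one {α : Type} [Nonempty α] {S : Setoid α} (h : ∀ x y, S x y) :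
    Nat.card (Quotient S) = 1 := by
  rw [Nat.card_eq_one_iff_unique]
  refine ⟨⟨fun p q => ?_⟩, ‹Nonempty α›.map (Quotient.mk S)⟩
  induction p using Quotient.inductionOn with | h x => ?_
  induction q using Quotient.inductionOn with | h y => ?_
  exact Quotient.sound (h x y)

/-- The regions at the two corners of a double point that are merged by a splice are different, if
the spliced curve is connected. -/
theorem SpliceConnected.not_sameCycle_face {d : P.Dart} (h : P.SpliceConnected d) :
    ¬ P.face.SameCycle d (P.rot (P.rot d)) := by
  classical
  intro hs
  have : Nonempty P.Dart := ⟨d⟩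
  have hV := numCycles_swap_mul_of_sameCycle (P.rot_two_ne d).symm
    ((sameCycle_rot_iff P.rot_four d (P.rot (P.rot d))).2 (by simp))
  have hF := numCycles_swap_mul_of_sameCycle (P.rot_two_ne d).symm hs
  -- If both corners were in one region, the splice would gain a vertex and a region and keep all
  -- arcs; a connected map would have Euler characteristic 4.
  have hg := numCycles_add_le (swap d (P.rot (P.rot d)) * P.rot) P.edge
  rw [card_quotient_eq_one] at hg
  · have h1 := P.euler
    have h2 := P.numCycles_edge_mul
    rw [mul_assoc] at hg
    change _ + _ + numCycles (swap d (P.rot (P.rot d)) * P.face) ≤ _ at hg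
    omega
  · intro x y
    refine spliceConnected_iff.1 h {y | orbitSetoid (swap d (P.rot (P.rot d)) * P.rot) P.edge x y}
      ?_ ?_ x ((orbitSetoid _ _).refl x) y
    · intro y hy
      exact (orbitSetoid _ _).trans hy (orbitSetoid_right _ _ y)
    · intro y hy
      have h1 := (orbitSetoid _ _).trans hy (orbitSetoid_left _ _ y)
      by_cases hm : y ∈ P.dartsAt d
      · rwa [swap_mul_rot_of_mem hm] at h1
      · rw [swap_mul_rot_of_notMem hm] at h1
        have h2 := (orbitSetoid _ _).trans h1 (orbitSetoid_left _ _ (P.rot y))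
        rw [swap_mul_rot_of_notMem (by rwa [rot_mem_dartsAt])] at h2
        rwa [smooth_of_notMem hm]

/-- The regions on the two sides of an arc are different. -/
theorem not_sameCycle_face_edge (x : P.Dart) : ¬ P.face.SameCycle x (P.edge x) := by
  classical
  intro hs
  have : Nonempty P.Dart := ⟨x⟩
  have hE := numCycles_swap_mul_of_sameCycle (P.edge_ne x).symm (sameCycle_apply_self P.edge x)
  have hcomp : P.rot * (swap x (P.edge x) * P.edge) =
      swap (P.rot x) (P.rot (P.edge x)) * P.face := by
    ext z
    simp only [Perm.mul_apply, face_apply]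
    exact P.rot.injective.map_swap _ _ _
  have hs' : P.face.SameCycle (P.rot x) (P.rot (P.edge x)) := by
    have h1 : P.face.SameCycle x (P.rot (P.edge x)) := sameCycle_apply_self P.face x
    have h2 := sameCycle_apply_self P.face (P.edge x)
    rw [face_apply, edge_edge] at h2
    exact h2.symm.trans (hs.symm.trans h1)
  have hF := numCycles_swap_mul_of_sameCycle
    (fun h => P.edge_ne x (P.rot.injective h).symm) hs'
  -- The arc is deleted by making its two darts fixed points. With one region on both sides, this
  -- would gain a region, which the genus bound forbids as long as the rest is connected.
  have hg := numCycles_add_le P.rot (swap x (P.edge x) * P.edge)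
  rw [hcomp, card_quotient_eq_one] at hg
  · have h1 := P.euler
    have h2 := P.numCycles_edge_mul
    omega
  · set O := orbitSetoid P.rot (swap x (P.edge x) * P.edge)
    have hr : ∀ y, O x y → O x (P.rot (P.rot y)) := fun y hy =>
      O.trans hy (O.trans (orbitSetoid_left _ _ y) (orbitSetoid_left _ _ _))
    have he : ∀ y, O x y → y ≠ x → y ≠ P.edge x → O x (P.edge y) := by
      intro y hy h1 h2
      have h3 := O.trans hy (orbitSetoid_right P.rot (swap x (P.edge x) * P.edge) y)
      rwa [Perm.mul_apply, swap_apply_of_ne_of_ne (fun h => h2 (edge_eq_iff.1 h))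
        (fun h => h1 (edge_inj.1 h))] at h3
    -- The arc is not a bridge, by parity: the orbit of `x` consists of pairs `{y, rot² y}`, but if
    -- it missed `edge x`, then `edge` would pair up all of its darts except `x`.
    have hxe : O x (P.edge x) := by
      by_contra hne
      have := Fintype.ofFinite P.Dart
      have h1 : ∑ y with O x y, (1 : ZMod 2) = 0 := by
        refine Finset.sum_involution (fun y _ => P.rot (P.rot y)) (fun _ _ => by decide)
          (fun y _ _ => P.rot_two_ne y) (fun y hy => ?_) (fun y _ => P.rot_four y)
        simp only [Finset.mem_filter_univ] at hy ⊢
        exact hr y hy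
      have h2 : ∑ y with O x y ∧ y ≠ x, (1 : ZMod 2) = 0 := by
        refine Finset.sum_involution (fun y _ => P.edge y) (fun _ _ => by decide)
          (fun y _ _ => P.edge_ne y) (fun y hy => ?_) (fun y _ => P.edge_edge y)
        simp only [Finset.mem_filter_univ] at hy ⊢
        have : y ≠ P.edge x := by rintro rfl; exact hne hy.1
        refine ⟨he y hy.1 hy.2 this, fun h => this (edge_eq_iff.1 h)⟩
      have h3 : (Finset.univ.filter fun y => O x y) =
          insert x (Finset.univ.filter fun y => O x y ∧ y ≠ x) := by
        ext y
        simp only [Finset.mem_filter_univ, Finset.mem_insert]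
        by_cases h : y = x
        · simp [h]
        · simp [h]
      rw [h3, Finset.sum_insert (by simp), h2] at h1
      exact absurd h1 (by decide)
    have hall : ∀ y, O x y := by
      intro y
      refine closed_univ (S := {y | O x y}) ?_ (fun y hy => hr y hy) (x := x) (O.refl x) y
      intro y hy
      by_cases h1 : y = x
      · rw [h1]; exact hxe
      · by_cases h2 : y = P.edge x
        · rw [h2, edge_edge]; exact O.refl x
        · exact he y hy h1 h2
    exact fun y z => O.trans (O.symm (hall y)) (hall z)

/-! ### Splices -/

theorem cross_of_mem {d y : P.Dart} (h : y ∈ P.dartsAt d) : P.cross d y = P.edge (P.smooth d y) :=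
  if_pos h

theorem cross_of_notMem {d y : P.Dart} (h : y ∉ P.dartsAt d) : P.cross d y = y :=
  if_neg h

theorem spliceEdge_of_notMem {d x : P.Dart} (h : P.edge x ∉ P.dartsAt d) :
    P.spliceEdge d x = P.edge x := by
  rw [spliceEdge, cross_of_notMem h, cross_of_notMem h]

theorem spliceEdge_of_mem {d x : P.Dart} (h : P.edge x ∈ P.dartsAt d)
    (h' : P.edge (P.smooth d (P.edge x)) ∉ P.dartsAt d) :
    P.spliceEdge d x = P.edge (P.smooth d (P.edge x)) := by
  rw [spliceEdge, cross_of_mem h, cross_of_notMem h']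

theorem spliceEdge_of_mem_mem {d x : P.Dart} (h : P.edge x ∈ P.dartsAt d)
    (h' : P.edge (P.smooth d (P.edge x)) ∈ P.dartsAt d) :
    P.spliceEdge d x = P.edge (P.smooth d (P.edge (P.smooth d (P.edge x)))) := by
  rw [spliceEdge, cross_of_mem h, cross_of_mem h']

theorem eq_or_eq_of_mem_dartsAt {d y z w : P.Dart} (hy : y ∈ P.dartsAt d) (hz : z ∈ P.dartsAt d)
    (hw : w ∈ P.dartsAt d) (hzy : z ≠ y) (hzy' : z ≠ P.smooth d y) :
    w = y ∨ w = P.smooth d y ∨ w = z ∨ w = P.smooth d z := by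
  rcases hy with rfl | rfl | rfl | rfl <;> rcases hz with rfl | rfl | rfl | rfl <;>
    simp only [smooth_zero, smooth_one, smooth_two, smooth_three] at hzy hzy' ⊢ <;>
    first | exact absurd rfl hzy | exact absurd rfl hzy' | (simp only [mem_dartsAt] at hw; tauto)

/-- Only two new arcs pass through the spliced double point, so an arc that comes from outside is
out again after at most two of them. This is why applying `cross` twice is enough. -/
theorem spliceEdge_notMem {d x : P.Dart} (hx : x ∉ P.dartsAt d) :
    P.spliceEdge d x ∉ P.dartsAt d := by
  by_cases h : P.edge x ∈ P.dartsAt d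
  · by_cases h' : P.edge (P.smooth d (P.edge x)) ∈ P.dartsAt d
    · rw [spliceEdge_of_mem_mem h h']
      set y := P.edge x with hy
      set z := P.edge (P.smooth d y) with hz
      have hxy : x = P.edge y := by rw [hy, edge_edge]
      have hzz : P.edge z = P.smooth d y := by rw [hz, edge_edge]
      intro hw
      have hsz : P.smooth d z ∈ P.dartsAt d := smooth_mem_dartsAt.2 h'
      have hzy : z ≠ y := by
        intro hzy
        rw [hzy, ← hxy] at hzz
        exact hx (by rw [hzz]; exact smooth_mem_dartsAt.2 h)
      have hzy' : z ≠ P.smooth d y := by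
        intro hzy'
        rw [← hzy'] at hzz
        exact P.edge_ne z hzz
      rcases eq_or_eq_of_mem_dartsAt h h' hw hzy hzy' with h1 | h1 | h1 | h1
      · rw [edge_eq_iff, ← hxy] at h1
        exact hx (h1 ▸ hsz)
      · rw [edge_eq_iff, ← hz] at h1
        exact smooth_ne z h1
      · rw [edge_eq_iff, hzz] at h1
        exact hzy (by simpa [smooth_smooth] using congrArg (P.smooth d) h1)
      · exact P.edge_ne _ h1
    · rwa [spliceEdge_of_mem h h']
  · rwa [spliceEdge_of_notMem h]

theorem spliceEdge_spliceEdge {d x : P.Dart} (hx : x ∉ P.dartsAt d) :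
    P.spliceEdge d (P.spliceEdge d x) = x := by
  by_cases h : P.edge x ∈ P.dartsAt d
  · by_cases h' : P.edge (P.smooth d (P.edge x)) ∈ P.dartsAt d
    · rw [spliceEdge_of_mem_mem h h', spliceEdge_of_mem_mem] <;>
        simp [smooth_smooth, smooth_mem_dartsAt, h, h']
    · rw [spliceEdge_of_mem h h', spliceEdge_of_mem] <;>
        simp [smooth_smooth, smooth_mem_dartsAt, h, hx]
  · rw [spliceEdge_of_notMem h, spliceEdge_of_notMem (by simpa), edge_edge]

theorem spliceEdge_ne {d x : P.Dart} : P.spliceEdge d x ≠ x := by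
  by_cases h : P.edge x ∈ P.dartsAt d
  · by_cases h' : P.edge (P.smooth d (P.edge x)) ∈ P.dartsAt d
    · rw [spliceEdge_of_mem_mem h h', Ne, edge_eq_iff]
      intro h1
      have h2 := congrArg (P.smooth d) h1
      rw [smooth_smooth] at h2
      exact P.edge_ne _ h2
    · rw [spliceEdge_of_mem h h', Ne, edge_eq_iff]
      exact smooth_ne _
  · rw [spliceEdge_of_notMem h]
    exact P.edge_ne x

/-- The map `f` exhibits `Q` as the result of the splice of `P` given by `d`. -/
structure SpliceMap (P : KnotProjection) (d : P.Dart) (Q : KnotProjection)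
    (f : Q.Dart → P.Dart) : Prop where
  inj : Function.Injective f
  range : Set.range f = (P.dartsAt d)ᶜ
  rot : ∀ x, f (Q.rot x) = P.rot (f x)
  edge : ∀ x, f (Q.edge x) = P.spliceEdge d (f x)

theorem isSplice_iff {d : P.Dart} : P.IsSplice d Q ↔ ∃ f, P.SpliceMap d Q f :=
  ⟨fun ⟨f, h1, h2, h3, h4⟩ => ⟨f, h1, h2, h3, h4⟩, fun ⟨f, h1, h2, h3, h4⟩ => ⟨f, h1, h2, h3, h4⟩⟩

section firstReturn

variable {α : Type} {d : P.Dart} {f : α → P.Dart}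

/-- The boundary of a region after the splice is a boundary in the map with two vertices of valency
two, where the darts at these vertices are skipped. -/
theorem isFirstReturn_splice [DecidableEq P.Dart] {r e : Equiv.Perm α}
    (hf : Set.range f = (P.dartsAt d)ᶜ) (hr : ∀ x, f (r x) = P.rot (f x))
    (he : ∀ x, f (e x) = P.spliceEdge d (f x)) :
    IsFirstReturn f (r * e) (swap d (P.rot (P.rot d)) * P.face) := by
  intro x
  have hx : f x ∉ P.dartsAt d := by
    have : f x ∈ Set.range f := ⟨x, rfl⟩
    rwa [hf] at this
  have hstep : ∀ z, (swap d (P.rot (P.rot d)) * P.face) z =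
      (swap d (P.rot (P.rot d)) * P.rot) (P.edge z) := fun z => rfl
  rw [Perm.mul_apply, hr, he]
  set t := swap d (P.rot (P.rot d)) * P.face with ht
  have hend : ∀ z, P.edge z ∉ P.dartsAt d → t z = P.rot (P.edge z) := fun z hz => by
    rw [hstep, swap_mul_rot_of_notMem hz]
  have hmid : ∀ z, P.edge z ∈ P.dartsAt d → t z = P.smooth d (P.edge z) := fun z hz => by
    rw [hstep, swap_mul_rot_of_mem hz]
  have hnr : ∀ z, z ∈ P.dartsAt d → z ∉ Set.range f := fun z hz => by simpa [hf]
  have hx' := spliceEdge_notMem hx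
  by_cases h : P.edge (f x) ∈ P.dartsAt d
  · have t1 := hmid _ h
    by_cases h' : P.edge (P.smooth d (P.edge (f x))) ∈ P.dartsAt d
    · rw [spliceEdge_of_mem_mem h h'] at hx' ⊢
      have t2 := hmid _ h'
      have t3 := hend _ hx'
      refine ⟨2, ?_, fun i h0 h2 => ?_⟩
      · simp only [pow_succ', Perm.mul_apply, pow_zero, Perm.one_apply, t1, t2, t3]
      · interval_cases i
        · simp only [pow_one, t1]
          exact hnr _ (smooth_mem_dartsAt.2 h)
        · simp only [pow_succ', Perm.mul_apply, pow_zero, Perm.one_apply, t1, t2]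
          exact hnr _ (smooth_mem_dartsAt.2 h')
    · rw [spliceEdge_of_mem h h'] at hx' ⊢
      have t2 := hend _ h'
      refine ⟨1, ?_, fun i h0 h2 => ?_⟩
      · simp only [pow_succ', Perm.mul_apply, pow_zero, Perm.one_apply, t1, t2]
      · interval_cases i
        simp only [pow_one, t1]
        exact hnr _ (smooth_mem_dartsAt.2 h)
  · rw [spliceEdge_of_notMem h]
    refine ⟨0, ?_, fun i h0 h2 => by omega⟩
    simp [hend _ h]

/-- A boundary consisting only of darts of the spliced double point would split off a circle as a
component of its own, which misses `z`. -/
theorem SpliceConnected.exists_sameCycle [DecidableEq P.Dart] (h : P.SpliceConnected d)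
    {z : P.Dart} (hz : z ∉ P.dartsAt d) (y : P.Dart) :
    ∃ w, w ∉ P.dartsAt d ∧ (swap d (P.rot (P.rot d)) * P.face).SameCycle y w := by
  set t := swap d (P.rot (P.rot d)) * P.face with ht
  by_contra hcon
  push Not at hcon
  have hmem : ∀ w, t.SameCycle y w → w ∈ P.dartsAt d := fun w hw => by
    by_contra hn
    exact hcon w hn hw
  have hstep : ∀ z, t z = (swap d (P.rot (P.rot d)) * P.rot) (P.edge z) := fun z => rfl
  have hedge : ∀ w, t.SameCycle y w → P.edge w ∈ P.dartsAt d ∧ t w = P.smooth d (P.edge w) := by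
    intro w hw
    have h1 : t.SameCycle y (t w) := sameCycle_apply_right.2 hw
    by_cases hm : P.edge w ∈ P.dartsAt d
    · exact ⟨hm, by rw [hstep, swap_mul_rot_of_mem hm]⟩
    · have h2 := hmem _ h1
      rw [hstep, swap_mul_rot_of_notMem hm, rot_mem_dartsAt] at h2
      exact absurd h2 hm
  have := spliceConnected_iff.1 h {w | t.SameCycle y w ∨ t.SameCycle y (P.edge w)} ?_ ?_ y
    (Or.inl (SameCycle.refl _ _)) z
  · rcases this with h1 | h1
    · exact hz (hmem _ h1)
    · have := (hedge _ h1).1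
      rw [edge_edge] at this
      exact hz this
  · rintro w (hw | hw)
    · right; simpa
    · left; exact hw
  · rintro w (hw | hw)
    · right
      obtain ⟨u, rfl⟩ : ∃ u, w = t u := ⟨t⁻¹ w, by simp⟩
      have hu : t.SameCycle y u := sameCycle_apply_right.1 hw
      have := (hedge u hu).2
      rw [this, smooth_smooth, edge_edge]
      exact hu
    · left
      have := (hedge _ hw).2
      rw [edge_edge] at this
      rw [← this]
      exact sameCycle_apply_right.2 hw

end firstReturn

/-- A closed set of remaining darts becomes closed under the spliced curve once the darts met on the
way through the spliced double point are added. -/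
theorem spliceConnected_oneComponent {d : P.Dart} (h : P.SpliceConnected d)
    {S : Set {x // x ∉ P.dartsAt d}}
    (h1 : ∀ x ∈ S, (⟨P.spliceEdge d x, spliceEdge_notMem x.2⟩ : {x // x ∉ P.dartsAt d}) ∈ S)
    (h2 : ∀ x ∈ S, (⟨P.rot (P.rot x), by simpa [rot_mem_dartsAt] using x.2⟩ :
      {x // x ∉ P.dartsAt d}) ∈ S) {x : {x // x ∉ P.dartsAt d}} (hx : x ∈ S)
    (y : {x // x ∉ P.dartsAt d}) : y ∈ S := by
  have := spliceConnected_iff.1 h {y | (∃ x ∈ S, y = x) ∨ ∃ x ∈ S, P.edge x ∈ P.dartsAt d ∧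
    (y = P.edge x ∨ y = P.smooth d (P.edge x) ∨ (P.edge (P.smooth d (P.edge x)) ∈ P.dartsAt d ∧
      (y = P.edge (P.smooth d (P.edge x)) ∨
        y = P.smooth d (P.edge (P.smooth d (P.edge x))))))} ?_ ?_ x (Or.inl ⟨x, hx, rfl⟩) y
  · rcases this with ⟨z, hz, hyz⟩ | ⟨z, hz, hm, hyz⟩
    · rw [Subtype.ext hyz]; exact hz
    · exfalso
      apply y.2
      rcases hyz with h | h | ⟨hm', h | h⟩ <;> rw [h] <;> simp [smooth_mem_dartsAt, *]
  · rintro y (⟨z, hz, rfl⟩ | ⟨z, hz, hm, rfl | rfl | ⟨hm', rfl | rfl⟩⟩)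
    · by_cases hm : P.edge z ∈ P.dartsAt d
      · exact Or.inr ⟨z, hz, hm, Or.inl rfl⟩
      · exact Or.inl ⟨_, h1 z hz, by simp [spliceEdge_of_notMem hm]⟩
    · exact Or.inl ⟨z, hz, by simp⟩
    · by_cases hm' : P.edge (P.smooth d (P.edge z)) ∈ P.dartsAt d
      · exact Or.inr ⟨z, hz, hm, by simp [hm']⟩
      · exact Or.inl ⟨_, h1 z hz, by simp [spliceEdge_of_mem hm hm']⟩
    · exact Or.inr ⟨z, hz, hm, by simp⟩
    · exact Or.inl ⟨_, h1 z hz, by simp [spliceEdge_of_mem_mem hm hm']⟩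
  · rintro y (⟨z, hz, rfl⟩ | ⟨z, hz, hm, rfl | rfl | ⟨hm', rfl | rfl⟩⟩)
    · exact Or.inl ⟨_, h2 z hz, by simp [smooth_of_notMem z.2]⟩
    · exact Or.inr ⟨z, hz, hm, by simp⟩
    · exact Or.inr ⟨z, hz, hm, by simp [smooth_smooth]⟩
    · exact Or.inr ⟨z, hz, hm, by simp [hm']⟩
    · exact Or.inr ⟨z, hz, hm, by simp [hm', smooth_smooth]⟩

/-- The result of a splice that does not disconnect the curve. -/
theorem SpliceConnected.exists_isSplice {d : P.Dart} (h : P.SpliceConnected d) :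
    ∃ Q, P.IsSplice d Q := by
  classical
  let α := {x // x ∉ P.dartsAt d}
  let e : Equiv.Perm α :=
    ⟨fun x => ⟨P.spliceEdge d x, spliceEdge_notMem x.2⟩,
      fun x => ⟨P.spliceEdge d x, spliceEdge_notMem x.2⟩,
      fun x => Subtype.ext (spliceEdge_spliceEdge x.2),
      fun x => Subtype.ext (spliceEdge_spliceEdge x.2)⟩
  let r : Equiv.Perm α := P.rot.subtypePerm fun x => by rw [rot_mem_dartsAt]
  have hr : ∀ x, ((r x : α) : P.Dart) = P.rot x := fun x => rfl
  have he : ∀ x, ((e x : α) : P.Dart) = P.spliceEdge d x := fun x => rfl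
  have r4 : ∀ x, r (r (r (r x))) = x := fun x => Subtype.ext (P.rot_four x)
  have r2 : ∀ x, r (r x) ≠ x := fun x hx => P.rot_two_ne x (congrArg Subtype.val hx)
  have e2 : ∀ x, e (e x) = x := fun x => Subtype.ext (spliceEdge_spliceEdge x.2)
  have e1 : ∀ x, e x ≠ x := fun x hx => spliceEdge_ne (congrArg Subtype.val hx)
  have hrange : Set.range (Subtype.val : α → P.Dart) = (P.dartsAt d)ᶜ := by
    ext y; simp
  refine ⟨⟨α, inferInstance, r, e, r4, r2, e2, e1, ?_, ?_⟩, ?_⟩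
  · refine (eqvGen_iff_closed (s := fun x => r (r x)) e2 r4).2 ?_
    intro S h1 h2 x hx y
    exact spliceConnected_oneComponent h h1 h2 hx y
  · rintro ⟨z⟩
    have : Nonempty P.Dart := ⟨d⟩
    have hE := numCycles_mul_two e2 e1
    have hV := numCycles_mul_four r4 r2
    have hE' := P.numCycles_edge_mul
    have hV' := P.numCycles_rot_mul
    have hfr := isFirstReturn_splice (r := r) (e := e) hrange hr he
    have hF := numCycles_eq_of_firstReturn (hfr.sameCycle_iff Subtype.val_injective) (by
      intro y
      obtain ⟨w, hw, hyw⟩ := h.exists_sameCycle z.2 y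
      exact ⟨⟨w, hw⟩, hyw⟩)
    have hF' := numCycles_swap_mul_of_not_sameCycle h.not_sameCycle_face
    have heul := P.euler
    have hcard : Nat.card α + 4 = Nat.card P.Dart := by
      have h1 := Set.ncard_add_ncard_compl (P.dartsAt d)
      rw [ncard_dartsAt] at h1
      have : Nat.card α = (P.dartsAt d)ᶜ.ncard := rfl
      omega
    -- The Euler characteristic is kept: one double point, two arcs and one region are lost.
    change _ + numCycles (r * e) = _
    omega
  · exact isSplice_iff.2 ⟨Subtype.val, Subtype.val_injective, hrange, hr, he⟩

namespace SpliceMap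

variable {d : P.Dart} {f : Q.Dart → P.Dart}

theorem notMem (h : P.SpliceMap d Q f) (x : Q.Dart) : f x ∉ P.dartsAt d := by
  have : f x ∈ Set.range f := ⟨x, rfl⟩
  rwa [h.range] at this

theorem exists_eq (h : P.SpliceMap d Q f) {y : P.Dart} (hy : y ∉ P.dartsAt d) : ∃ x, f x = y := by
  have : y ∈ Set.range f := by rwa [h.range]
  exact this

theorem mem_dartsAt_iff (h : P.SpliceMap d Q f) {c x : Q.Dart} :
    f x ∈ P.dartsAt (f c) ↔ x ∈ Q.dartsAt c := by
  simp only [mem_dartsAt, ← h.rot, h.inj.eq_iff]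

theorem card (h : P.SpliceMap d Q f) : Nat.card Q.Dart + 4 = Nat.card P.Dart := by
  have h1 := Set.ncard_add_ncard_compl (P.dartsAt d)
  rw [ncard_dartsAt, ← h.range] at h1
  have h2 : Nat.card Q.Dart = (Set.range f).ncard := by
    rw [← Set.image_univ, Set.ncard_image_of_injective _ h.inj, Set.ncard_univ]
  omega

/-- Between the darts that the splice joins, `P.pot (f c)` jumps by `P.inter (f c) d`, and `P.pot d`
jumps by one because the splice is connected. The combination therefore does not jump along the new
arcs. -/
theorem isPot (h : P.SpliceMap d Q f) (hd : P.SpliceConnected d) (c : Q.Dart) :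
    Q.IsPot c fun x => P.pot (f c) (f x) + P.inter (f c) d * P.pot d (f x) := by
  have hpc := isPot_pot (f c)
  have hpd := isPot_pot d
  have hdc : ∀ y ∈ P.dartsAt d, y ∉ P.dartsAt (f c) := fun y hy hyc => by
    rw [mem_dartsAt_comm, dartsAt_eq_of_mem hy] at hyc
    exact h.notMem c hyc
  have hinv : ∀ y ∈ P.dartsAt d, P.pot (f c) (P.smooth d y) + P.inter (f c) d * P.pot d (P.smooth d y) =
      P.pot (f c) y + P.inter (f c) d * P.pot d y := by
    rw [spliceConnected_iff_inter] at hd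
    have m0 := self_mem_dartsAt d
    have m1 : P.rot d ∈ P.dartsAt d := rot_mem_dartsAt.2 m0
    have a0 := hpd.at_mem _ m0
    have a1 := hpd.at_mem _ m1
    have b0 := hpc.off _ (hdc _ m0)
    have b1 := hpc.off _ (hdc _ m1)
    simp only [inter] at hd ⊢
    rintro y (hy | hy | hy | hy) <;> rw [hy] <;>
      simp only [smooth_zero, smooth_one, smooth_two, smooth_three, a0, a1, b0, b1] <;>
      revert hd <;> generalize P.pot (f c) d = x1 <;> generalize P.pot (f c) (P.rot d) = x2 <;>
      generalize P.pot d d = x3 <;> generalize P.pot d (P.rot d) = x4 <;>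
      revert x1 x2 x3 x4 <;> decide
  have hcross : ∀ y, P.pot (f c) (P.cross d y) + P.inter (f c) d * P.pot d (P.cross d y) =
      P.pot (f c) y + P.inter (f c) d * P.pot d y := by
    intro y
    by_cases hy : y ∈ P.dartsAt d
    · rw [cross_of_mem hy, hpc.edge, hpd.edge, hinv y hy]
    · rw [cross_of_notMem hy]
  refine ⟨fun x => ?_, fun x hx => ?_, fun x hx => ?_⟩
  · simp only [h.edge, spliceEdge, hcross, hpc.edge, hpd.edge]
  · simp only [h.rot, hpc.at_mem _ (h.mem_dartsAt_iff.2 hx), hpd.off _ (h.notMem x)]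
    ring
  · simp only [h.rot, hpc.off _ (fun hm => hx (h.mem_dartsAt_iff.1 hm)), hpd.off _ (h.notMem x)]

/-- For two different double points this is the formula of local complementation at the vertex of
`d`. -/
theorem inter_eq (h : P.SpliceMap d Q f) (hd : P.SpliceConnected d) (c y : Q.Dart) :
    Q.inter c y = P.inter (f c) (f y) + P.inter (f c) d * P.inter d (f y) := by
  rw [(h.isPot hd c).inter_eq y, h.rot]
  simp only [inter]
  ring

end SpliceMap

/-! ### Kinks -/

/-- The side of the 1-gon is one of the two loops at its corner. It meets no other double point,
which makes the corner an isolated vertex of the graph. -/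
theorem isPot_of_oneGon {z : P.Dart} (hz : P.edge z = P.rot z) [DecidableEq P.Dart] :
    P.IsPot z fun x => if x = z ∨ x = P.rot z then 1 else 0 := by
  have hz' : P.edge (P.rot z) = z := by rw [← hz, edge_edge]
  have hone : (1 : ZMod 2) + 1 = 0 := by decide
  refine ⟨fun x => ?_, ?_, ?_⟩
  · simp only [edge_eq_iff, hz, hz', or_comm]
  · intro x hx
    rcases hx with hx | hx | hx | hx <;> rw [hx] <;>
      simp [P.rot_two_ne, rot_ne, rot_three_ne, hone, (rot_ne _).symm]
  · intro x hx
    have hx' := hx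
    rw [← rot_mem_dartsAt, ← rot_mem_dartsAt] at hx'
    simp only [mem_dartsAt, not_or] at hx hx'
    simp [hx, hx']

theorem inter_of_oneGon {z y : P.Dart} (hz : P.edge z = P.rot z) (hy : y ∉ P.dartsAt z) :
    P.inter z y = 0 := by
  classical
  rw [(isPot_of_oneGon hz).inter_eq]
  have hy' := hy
  rw [← rot_mem_dartsAt] at hy'
  simp only [mem_dartsAt, not_or] at hy hy'
  simp [hy, hy']

theorem spliceConnected_of_oneGon {z : P.Dart} (hz : P.edge z = P.rot z) :
    P.SpliceConnected (P.rot z) := by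
  classical
  rw [spliceConnected_iff_inter,
    inter_eq_of_mem_left (rot_mem_dartsAt.2 (self_mem_dartsAt z)), (isPot_of_oneGon hz).inter_eq]
  simp [P.rot_two_ne, rot_ne]

theorem smooth_rot_two (d : P.Dart) : P.smooth (P.rot (P.rot d)) = P.smooth d := by
  funext x
  by_cases hx : x ∈ P.dartsAt d
  · rcases hx with hx | hx | hx | hx <;> rw [hx]
    · have := smooth_two (P.rot (P.rot d))
      simpa using this
    · have := smooth_three (P.rot (P.rot d))
      simpa using this
    · simp
    · simp
  · rw [smooth_of_notMem hx, smooth_of_notMem]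
    rwa [mem_dartsAt_comm, rot_mem_dartsAt, rot_mem_dartsAt, mem_dartsAt_comm]

theorem isSplice_rot_two {d : P.Dart} : P.IsSplice (P.rot (P.rot d)) Q ↔ P.IsSplice d Q := by
  have h1 : P.dartsAt (P.rot (P.rot d)) = P.dartsAt d :=
    dartsAt_eq_of_mem (by simp [mem_dartsAt])
  have h2 : P.spliceEdge (P.rot (P.rot d)) = P.spliceEdge d := by
    funext x
    have h3 : P.cross (P.rot (P.rot d)) = P.cross d := by
      funext y
      unfold cross
      rw [smooth_rot_two, h1]
    simp only [spliceEdge, h3]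
  simp only [IsSplice, h1, h2]

/-- With the 1-gon between `z` and `rot z`, the splice given by `z` would cut its side off as a
circle; the connected splice is the one given by `rot z`, or equally by `rot³ z`. -/
theorem riMinus_iff : P.RIMinus Q ↔ ∃ z, P.edge z = P.rot z ∧ P.IsSplice (P.rot z) Q := by
  classical
  constructor
  · rintro ⟨d, hd, ⟨z, hzd, hz⟩, hs⟩
    refine ⟨z, hz, ?_⟩
    rw [spliceConnected_iff_inter, inter_eq_of_mem_left (mem_dartsAt_comm.1 hzd),
      (isPot_of_oneGon hz).inter_eq] at hd
    rw [mem_dartsAt_comm] at hzd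
    rcases hzd with rfl | rfl | rfl | rfl
    · simp at hd
    · exact hs
    · simp [P.rot_two_ne, rot_ne, rot_three_ne] at hd
    · rwa [← isSplice_rot_two]
  · rintro ⟨z, hz, hs⟩
    refine ⟨_, spliceConnected_of_oneGon hz, ⟨z, ?_, hz⟩, hs⟩
    simp [mem_dartsAt]

/-- A kink can be removed. -/
theorem exists_riMinus {z : P.Dart} (hz : P.edge z = P.rot z) :
    ∃ Q, P.RIMinus Q ∧ P.IsSplice (P.rot z) Q := by
  obtain ⟨Q, hQ⟩ := (spliceConnected_of_oneGon hz).exists_isSplice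
  exact ⟨Q, riMinus_iff.2 ⟨z, hz, hQ⟩, hQ⟩

end KnotProjection

/-! ### Elimination of vertices -/

section Elimination

variable {V W : Type}

open Classical in
/-- Elimination of the vertex `v` from the graph with adjacency matrix `A` modulo 2: local
complementation at `v`, then `v` is isolated. -/
noncomputable def eliminate (A : V → V → ZMod 2) (v x y : V) : ZMod 2 :=
  if x = v ∨ y = v ∨ x = y then 0 else A x y + A x v * A v y

/-- At most `k` eliminations lead to the graph without edges. -/
inductive EliminatesIn : (V → V → ZMod 2) → ℕ → Prop
  | zero (A : V → V → ZMod 2) (k : ℕ) : (∀ x y, A x y = 0) → EliminatesIn A k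
  | step (A : V → V → ZMod 2) (v : V) (k : ℕ) : EliminatesIn (eliminate A v) k →
      EliminatesIn A (k + 1)

theorem EliminatesIn.succ {A : V → V → ZMod 2} {k : ℕ} (h : EliminatesIn A k) :
    EliminatesIn A (k + 1) := by
  induction h with
  | zero A k h => exact .zero A _ h
  | step A v k _ ih => exact .step A v _ ih

theorem EliminatesIn.mono {A : V → V → ZMod 2} {k l : ℕ} (h : EliminatesIn A k) (hkl : k ≤ l) :
    EliminatesIn A l := by
  induction hkl with
  | refl => exact h
  | step _ ih => exact ih.succ

theorem eliminate_of_isolated {A : V → V → ZMod 2} {v : V} (h0 : ∀ x, A x x = 0)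
    (h1 : ∀ x, A v x = 0) (h2 : ∀ x, A x v = 0) : eliminate A v = A := by
  funext x y
  unfold eliminate
  split_ifs with h
  · rcases h with rfl | rfl | rfl
    · exact (h1 _).symm
    · exact (h2 _).symm
    · exact (h0 _).symm
  · rw [h1, mul_zero, add_zero]

theorem eliminate_self (A : V → V → ZMod 2) (v x : V) : eliminate A v x x = 0 := by
  simp [eliminate]

theorem eliminate_isolated {A : V → V → ZMod 2} {v x : V} (h1 : ∀ y, A x y = 0)
    (h2 : ∀ y, A y x = 0) :
    (∀ y, eliminate A v x y = 0) ∧ (∀ y, eliminate A v y x = 0) := by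
  simp [eliminate, h1, h2]

theorem eliminate_comp {A : V → V → ZMod 2} {f : W → V} (hf : Function.Injective f) (w x y : W) :
    eliminate A (f w) (f x) (f y) = eliminate (fun x y => A (f x) (f y)) w x y := by
  have h : (f x = f w ∨ f y = f w ∨ f x = f y) ↔ (x = w ∨ y = w ∨ x = y) := by
    simp only [hf.eq_iff]
  by_cases h' : x = w ∨ y = w ∨ x = y
  · rw [eliminate, eliminate, if_pos (h.2 h'), if_pos h']
  · rw [eliminate, eliminate, if_neg (fun hh => h' (h.1 hh)), if_neg h']

/-- Elimination keeps the vertex as an isolated one, so that the vertex type does not change. Here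
isolated vertices are discarded: eliminating one of them has no effect, and such a step can be
dropped. -/
theorem EliminatesIn.comp {A : V → V → ZMod 2} {f : W → V} (hf : Function.Injective f)
    (h0 : ∀ x, A x x = 0)
    (hiso : ∀ v, v ∉ Set.range f → (∀ x, A v x = 0) ∧ ∀ x, A x v = 0) {k : ℕ}
    (h : EliminatesIn A k) : EliminatesIn (fun x y => A (f x) (f y)) k := by
  induction h with
  | zero A k h => exact .zero _ _ fun x y => h _ _
  | step A v k h ih =>
    have h3 := ih (eliminate_self A v) fun w hw =>
      eliminate_isolated (v := v) (hiso w hw).1 (hiso w hw).2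
    by_cases hv : v ∈ Set.range f
    · obtain ⟨w, rfl⟩ := hv
      simp_rw [eliminate_comp hf] at h3
      exact .step _ w _ h3
    · rw [eliminate_of_isolated h0 (hiso v hv).1 (hiso v hv).2] at h3
      exact h3.succ

theorem EliminatesIn.of_comp {A : V → V → ZMod 2} {f : W → V} (hf : Function.Injective f)
    (hiso : ∀ v, v ∉ Set.range f → (∀ x, A v x = 0) ∧ ∀ x, A x v = 0) {k : ℕ}
    (h : EliminatesIn (fun x y => A (f x) (f y)) k) : EliminatesIn A k := by
  generalize hB : (fun x y => A (f x) (f y)) = B at h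
  induction h generalizing A with
  | zero B k h =>
    refine .zero _ _ fun x y => ?_
    by_cases hx : x ∈ Set.range f
    · by_cases hy : y ∈ Set.range f
      · obtain ⟨x, rfl⟩ := hx
        obtain ⟨y, rfl⟩ := hy
        rw [← hB] at h
        exact h x y
      · exact (hiso y hy).2 x
    · exact (hiso x hx).1 y
  | step B w k h ih =>
    refine .step _ (f w) _ (ih (fun v hv => eliminate_isolated (hiso v hv).1 (hiso v hv).2) ?_)
    rw [← hB]
    funext x y
    rw [eliminate_comp hf]

theorem eliminatesIn_comp_iff {A : V → V → ZMod 2} {f : W → V} (hf : Function.Injective f)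
    (h0 : ∀ x, A x x = 0)
    (hiso : ∀ v, v ∉ Set.range f → (∀ x, A v x = 0) ∧ ∀ x, A x v = 0) {k : ℕ} :
    EliminatesIn (fun x y => A (f x) (f y)) k ↔ EliminatesIn A k :=
  ⟨.of_comp hf hiso, .comp hf h0 hiso⟩

theorem eliminatesIn_zero_iff {A : V → V → ZMod 2} : EliminatesIn A 0 ↔ ∀ x y, A x y = 0 := by
  refine ⟨fun h => ?_, fun h => .zero _ _ h⟩
  cases h with
  | zero _ _ h => exact h

theorem eliminatesIn_succ_iff {A : V → V → ZMod 2} {k : ℕ} : EliminatesIn A (k + 1) ↔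
    (∀ x y, A x y = 0) ∨ ∃ v, EliminatesIn (eliminate A v) k := by
  constructor
  · intro h
    cases h with
    | zero _ _ h => exact Or.inl h
    | step _ v _ h => exact Or.inr ⟨v, h⟩
  · rintro (h | ⟨v, h⟩)
    · exact .zero _ _ h
    · exact .step _ v _ h

end Elimination

/-! ### The interlacement graph and its relation to `u⁻`. -/

namespace KnotProjection

variable {P Q : KnotProjection}

/-- Two darts are related if they are at the same double point. -/
def crossSetoid (P : KnotProjection) : Setoid P.Dart where
  r x y := y ∈ P.dartsAt x
  iseqv := ⟨self_mem_dartsAt, fun h => mem_dartsAt_comm.1 h,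
    fun {x y z} h1 h2 => by rwa [dartsAt_eq_of_mem h1] at h2⟩

/-- The double points. -/
def Crossing (P : KnotProjection) : Type := Quotient P.crossSetoid

/-- The double point of a dart. -/
def crossing (P : KnotProjection) (x : P.Dart) : P.Crossing := Quotient.mk _ x

theorem crossing_surjective : Function.Surjective P.crossing := Quotient.mk_surjective

theorem crossing_eq_iff {x y : P.Dart} : P.crossing x = P.crossing y ↔ y ∈ P.dartsAt x :=
  ⟨fun h => Quotient.exact h, fun h => Quotient.sound h⟩

theorem crossing_rot (x : P.Dart) : P.crossing (P.rot x) = P.crossing x :=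
  crossing_eq_iff.2 (by rw [mem_dartsAt_comm, rot_mem_dartsAt]; exact self_mem_dartsAt x)

open Classical in
/-- The adjacency matrix modulo 2 of the interlacement graph. -/
noncomputable def adj (P : KnotProjection) (p q : P.Crossing) : ZMod 2 :=
  -- The diagonal is set to zero because `inter` depends there on the choice of the dart.
  if p = q then 0 else P.inter (Quotient.out p) (Quotient.out q)

theorem adj_self (p : P.Crossing) : P.adj p p = 0 := by simp [adj]

theorem adj_crossing {x y : P.Dart} (h : y ∉ P.dartsAt x) :
    P.adj (P.crossing x) (P.crossing y) = P.inter x y := by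
  have h1 : (Quotient.out (P.crossing x)) ∈ P.dartsAt x :=
    crossing_eq_iff.1 (Quotient.out_eq (P.crossing x)).symm
  have h2 : (Quotient.out (P.crossing y)) ∈ P.dartsAt y :=
    crossing_eq_iff.1 (Quotient.out_eq (P.crossing y)).symm
  rw [adj, if_neg (fun hc => h (crossing_eq_iff.1 hc)), inter_eq_of_mem_left h1,
    inter_eq_of_mem_right h h2]

theorem adj_comm (p q : P.Crossing) : P.adj p q = P.adj q p := by
  obtain ⟨x, rfl⟩ := crossing_surjective p
  obtain ⟨y, rfl⟩ := crossing_surjective q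
  by_cases h : y ∈ P.dartsAt x
  · rw [crossing_eq_iff.2 h]
  · rw [adj_crossing h, adj_crossing (fun h' => h (mem_dartsAt_comm.1 h')), inter_comm h]

/-- The graph of `Q` is the eliminated graph of `P` without the vertex of `d`, which the elimination
has isolated. -/
theorem SpliceMap.eliminatesIn_iff {d : P.Dart} {f : Q.Dart → P.Dart} (h : P.SpliceMap d Q f)
    (hd : P.SpliceConnected d) (k : ℕ) :
    EliminatesIn Q.adj k ↔ EliminatesIn (eliminate P.adj (P.crossing d)) k := by
  let g : Q.Crossing → P.Crossing := Quotient.map f fun x y hxy => h.mem_dartsAt_iff.2 hxy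
  have hg : ∀ x, g (Q.crossing x) = P.crossing (f x) := fun x => rfl
  have hinj : Function.Injective g := by
    intro p q hpq
    obtain ⟨x, rfl⟩ := crossing_surjective p
    obtain ⟨y, rfl⟩ := crossing_surjective q
    rw [hg, hg, crossing_eq_iff, h.mem_dartsAt_iff] at hpq
    exact crossing_eq_iff.2 hpq
  have hrange : ∀ p, p ∉ Set.range g → p = P.crossing d := by
    intro p hp
    obtain ⟨x, rfl⟩ := crossing_surjective p
    by_contra hne
    have : x ∉ P.dartsAt d := fun hx => hne (crossing_eq_iff.2 hx).symm
    obtain ⟨y, rfl⟩ := h.exists_eq this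
    exact hp ⟨Q.crossing y, rfl⟩
  have hadj : Q.adj = fun p q => eliminate P.adj (P.crossing d) (g p) (g q) := by
    funext p q
    obtain ⟨x, rfl⟩ := crossing_surjective p
    obtain ⟨y, rfl⟩ := crossing_surjective q
    have hne : ∀ x, P.crossing (f x) ≠ P.crossing d := fun x hx =>
      h.notMem x (crossing_eq_iff.1 hx.symm)
    have hm : ∀ x, d ∉ P.dartsAt (f x) := fun x hx => h.notMem x (mem_dartsAt_comm.1 hx)
    by_cases hxy : y ∈ Q.dartsAt x
    · rw [crossing_eq_iff.2 hxy, eliminate_self, adj_self]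
    · have hxy' : f y ∉ P.dartsAt (f x) := fun hh => hxy (h.mem_dartsAt_iff.1 hh)
      rw [hg, hg, eliminate, if_neg, adj_crossing hxy, adj_crossing hxy', adj_crossing (hm x),
        adj_crossing (h.notMem y), h.inter_eq hd]
      simp only [hne, false_or]
      exact fun hh => hxy' (crossing_eq_iff.1 hh)
  rw [hadj]
  refine eliminatesIn_comp_iff hinj (eliminate_self _ _) ?_
  intro p hp
  rw [hrange p hp]
  simp [eliminate]

theorem adj_crossing_of_oneGon {z : P.Dart} (hz : P.edge z = P.rot z) (p : P.Crossing) :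
    P.adj (P.crossing z) p = 0 := by
  obtain ⟨y, rfl⟩ := crossing_surjective p
  by_cases h : y ∈ P.dartsAt z
  · rw [crossing_eq_iff.2 h, adj_self]
  · rw [adj_crossing h, inter_of_oneGon hz h]

theorem RIMinus.eliminatesIn_iff (h : P.RIMinus Q) (k : ℕ) :
    EliminatesIn Q.adj k ↔ EliminatesIn P.adj k := by
  obtain ⟨z, hz, hs⟩ := riMinus_iff.1 h
  obtain ⟨f, hf⟩ := isSplice_iff.1 hs
  rw [hf.eliminatesIn_iff (spliceConnected_of_oneGon hz), crossing_rot,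
    eliminate_of_isolated adj_self (adj_crossing_of_oneGon hz)
      (fun x => by rw [adj_comm]; exact adj_crossing_of_oneGon hz x)]

theorem SMinus.eliminatesIn_succ (h : P.SMinus Q) {k : ℕ} (hk : EliminatesIn Q.adj k) :
    EliminatesIn P.adj (k + 1) := by
  obtain ⟨d, hd, -, hs⟩ := h
  obtain ⟨f, hf⟩ := isSplice_iff.1 hs
  exact .step _ _ _ ((hf.eliminatesIn_iff hd k).1 hk)

theorem Unknots.eliminatesIn {k : ℕ} (h : P.Unknots k) : EliminatesIn P.adj k := by
  induction h with
  | done P h =>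
    refine .zero _ _ fun p => ?_
    obtain ⟨x, rfl⟩ := crossing_surjective p
    exact (h.false x).elim
  | ri P Q k h _ ih => exact (h.eliminatesIn_iff k).1 ih
  | s P Q k h _ ih => exact h.eliminatesIn_succ ih

/-- A projection without interlaced double points has a kink. -/
theorem exists_oneGon_of_inter_eq_zero [Nonempty P.Dart]
    (h : ∀ c, ∀ y ∉ P.dartsAt c, P.inter c y = 0) : ∃ z, P.edge z = P.rot z := by
  -- Descent to an innermost loop, by induction on the number of darts of the loop `f = 1` at `c`.
  suffices H : ∀ n : ℕ, ∀ c f, P.IsPot c f → {x | f x = 1}.ncard = n → ∃ z, P.edge z = P.rot z by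
    obtain ⟨c⟩ := ‹Nonempty P.Dart›
    exact H _ c _ (isPot_pot c) rfl
  intro n
  induction n using Nat.strong_induction_on with | _ n ih => ?_
  intro c f hf hn
  have hone : (1 : ZMod 2) + 1 = 0 := by decide
  by_cases hsub : ∃ y, f y = 1 ∧ y ∉ P.dartsAt c
  · obtain ⟨y, hy1, hyc⟩ := hsub
    have hcy : c ∉ P.dartsAt y := fun hh => hyc (mem_dartsAt_comm.1 hh)
    have hpy := isPot_pot y
    have hyr : f (P.rot y) = 1 := by
      have := h c y hyc
      rw [hf.inter_eq, hy1] at this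
      rw [← (ZModTwo.add_eq_zero_iff _ _).1 this]
    have hyD : ∀ x ∈ P.dartsAt y, f x = 1 := by
      have h1 := hf.off _ hyc
      have h2 := hf.off (P.rot y) (by rwa [rot_mem_dartsAt])
      rintro x (rfl | rfl | rfl | rfl)
      · exact hy1
      · exact hyr
      · rw [h1, hy1]
      · rw [h2, hyr]
    -- As `y` is not interlaced with `c`, one of the loops at `y` avoids the double point of `c`. It
    -- is cut out by `f * g`, and it is smaller because it lacks the darts of `c` on the old loop.
    set g : P.Dart → ZMod 2 := fun x => P.pot y x + P.pot y c with hg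
    have hgc : ∀ x ∈ P.dartsAt c, g x = 0 := by
      have h1 := hpy.off _ hcy
      have h2 := hpy.off (P.rot c) (by rwa [rot_mem_dartsAt])
      have h3 := h y c hcy
      rw [inter] at h3
      have h3 := (ZModTwo.add_eq_zero_iff _ _).1 h3
      rintro x (rfl | rfl | rfl | rfl) <;> simp [hg, h1, h2, h3, ZModTwo.add_self]
    have hgp : P.IsPot y fun x => f x * g x := by
      refine ⟨fun x => by simp only [hg, hf.edge, hpy.edge], fun x hx => ?_, fun x hx => ?_⟩
      · have hx2 : P.rot (P.rot x) ∈ P.dartsAt y := by rwa [rot_mem_dartsAt, rot_mem_dartsAt]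
        simp only [hg, hyD _ hx, hyD _ hx2, hpy.at_mem x hx]
        ring
      · by_cases hxc : x ∈ P.dartsAt c
        · rw [hgc x hxc, hgc (P.rot (P.rot x)) (by rwa [rot_mem_dartsAt, rot_mem_dartsAt])]
          simp
        · simp only [hg, hf.off x hxc, hpy.off x hx]
    obtain ⟨u, huc, hu⟩ : ∃ u ∈ P.dartsAt c, f u = 1 := by
      have h1 := hf.at_mem c (self_mem_dartsAt c)
      rcases ZModTwo.eq_zero_or_one (f c) with h0 | h0
      · exact ⟨P.rot (P.rot c), by simp [mem_dartsAt], by rw [h1, h0, zero_add]⟩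
      · exact ⟨c, self_mem_dartsAt c, h0⟩
    refine ih _ ?_ y _ hgp rfl
    rw [← hn]
    refine Set.ncard_lt_ncard ⟨fun x hx => ?_, fun hss => ?_⟩ (Set.toFinite _)
    · change f x * g x = 1 at hx
      change f x = 1
      revert hx
      generalize f x = a; generalize g x = b; revert a b; decide
    · have : f u * g u = 1 := hss hu
      rw [hgc u huc, mul_zero] at this
      exact zero_ne_one this
  · push Not at hsub
    -- The loop meets no double point but that of `c`, where its two ends are neighbours; it is a
    -- single arc and the side of a 1-gon.
    obtain ⟨u, huc, hu, hu1⟩ : ∃ u ∈ P.dartsAt c, f u = 1 ∧ f (P.rot u) = 1 := by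
      have m0 := self_mem_dartsAt c
      have m1 := rot_mem_dartsAt.2 m0
      have m2 := rot_mem_dartsAt.2 m1
      have m3 := rot_mem_dartsAt.2 m2
      have h0 := hf.at_mem c m0
      have h1 := hf.at_mem (P.rot c) m1
      rcases ZModTwo.eq_zero_or_one (f c) with k0 | k0 <;>
        rcases ZModTwo.eq_zero_or_one (f (P.rot c)) with k1 | k1 <;> rw [k0] at h0 <;> rw [k1] at h1
      · exact ⟨_, m2, by simpa using h0, by simpa using h1⟩
      · exact ⟨_, m1, k1, by simpa using h0⟩
      · exact ⟨_, m3, by simpa using h1, by simpa using k0⟩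
      · exact ⟨_, m0, k0, k1⟩
    refine ⟨u, ?_⟩
    have h1 : f (P.edge u) = 1 := by rw [hf.edge, hu]
    have h2 := hsub _ h1
    rw [← dartsAt_eq_of_mem huc] at h2
    have mu := self_mem_dartsAt u
    rw [dartsAt_eq_of_mem huc] at mu
    have k2 := hf.at_mem u mu
    have k3 := hf.at_mem (P.rot u) (rot_mem_dartsAt.2 mu)
    rcases h2 with h2 | h2 | h2 | h2
    · exact absurd h2 (P.edge_ne u)
    · exact h2
    · rw [h2, k2, hu, hone] at h1
      exact absurd h1 zero_ne_one
    · rw [h2, k3, hu1, hone] at h1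
      exact absurd h1 zero_ne_one

theorem exists_spliceConnected (c : P.Dart) :
    ∃ d, P.crossing d = P.crossing c ∧ P.SpliceConnected d := by
  rcases ZModTwo.eq_zero_or_one (P.inter c c) with h | h
  · refine ⟨P.rot c, crossing_rot c, ?_⟩
    have hm := rot_mem_dartsAt.2 (self_mem_dartsAt c)
    rw [spliceConnected_iff_inter, inter_eq_of_mem_left hm, inter_rot_of_mem (self_mem_dartsAt c), h,
      zero_add]
  · exact ⟨c, rfl, spliceConnected_iff_inter.2 h⟩

/-- An elimination is carried out by the connected splice at that vertex. If it happens to remove a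
kink, no `S⁻` is spent, whence `j ≤ k`. When the graph has become edgeless, 1-gons can be removed
until nothing is left. -/
theorem eliminatesIn_iff_unknots {k : ℕ} : EliminatesIn P.adj k ↔ ∃ j ≤ k, P.Unknots j := by
  constructor
  · intro h
    induction hn : Nat.card P.Dart using Nat.strong_induction_on generalizing P k with | _ n ih => ?_
    have main : ∀ v k, EliminatesIn (eliminate P.adj v) k → ∃ j ≤ k + 1, P.Unknots j := by
      intro v k hk
      obtain ⟨c, rfl⟩ := crossing_surjective v
      obtain ⟨d, hdc, hd⟩ := exists_spliceConnected c
      obtain ⟨Q, hQ⟩ := hd.exists_isSplice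
      obtain ⟨f, hf⟩ := isSplice_iff.1 hQ
      rw [← hdc, ← hf.eliminatesIn_iff hd] at hk
      obtain ⟨j, hj, hu⟩ := ih (Nat.card Q.Dart) (by have := hf.card; omega) hk rfl
      by_cases h1 : P.HasOneGonAt d
      · exact ⟨j, by omega, .ri P Q j ⟨d, hd, h1, hQ⟩ hu⟩
      · exact ⟨j + 1, by omega, .s P Q j ⟨d, hd, h1, hQ⟩ hu⟩
    cases h with
    | step _ v k hk => exact main v k hk
    | zero _ _ h =>
      rcases isEmpty_or_nonempty P.Dart with hP | hP
      · exact ⟨0, Nat.zero_le _, .done P hP⟩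
      · obtain ⟨z, hz⟩ := exists_oneGon_of_inter_eq_zero (P := P) fun c y hy => by
          rw [← adj_crossing hy, h]
        obtain ⟨Q, hQ, hs⟩ := exists_riMinus hz
        obtain ⟨f, hf⟩ := isSplice_iff.1 hs
        obtain ⟨j, hj, hu⟩ := ih (Nat.card Q.Dart) (by have := hf.card; omega)
          ((hQ.eliminatesIn_iff k).2 (.zero _ _ h)) rfl
        exact ⟨j, hj, .ri P Q j hQ hu⟩
  · rintro ⟨j, hj, hu⟩
    exact hu.eliminatesIn.mono hj

theorem uMinus_eq_succ_iff {k : ℕ} :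
    P.uMinus = k + 1 ↔ EliminatesIn P.adj (k + 1) ∧ ¬ EliminatesIn P.adj k := by
  have hle : ∀ j, P.Unknots j → P.uMinus ≤ j := fun j hj => Nat.sInf_le hj
  constructor
  · intro h
    -- The infimum of the empty set is zero, so a positive value shows that some sequence exists.
    have hne : {k | P.Unknots k}.Nonempty := by
      by_contra hne
      rw [Set.not_nonempty_iff_eq_empty] at hne
      rw [uMinus, hne, Nat.sInf_empty] at h
      omega
    have hmem : P.Unknots (P.uMinus) := Nat.sInf_mem hne
    rw [h] at hmem
    refine ⟨hmem.eliminatesIn, fun hk => ?_⟩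
    obtain ⟨j, hj, hu⟩ := eliminatesIn_iff_unknots.1 hk
    have := hle j hu
    omega
  · rintro ⟨h1, h2⟩
    obtain ⟨j, hj, hu⟩ := eliminatesIn_iff_unknots.1 h1
    have hmem : P.Unknots (P.uMinus) := Nat.sInf_mem ⟨j, hu⟩
    have h3 := hle j hu
    by_contra hne
    exact h2 (eliminatesIn_iff_unknots.2 ⟨_, by omega, hmem⟩)

theorem Same.symm (h : P.Same Q) : Q.Same P := by
  obtain ⟨e, he, hr⟩ := h
  refine ⟨e.symm, fun x => ?_, ?_⟩
  · rw [Equiv.symm_apply_eq, he, Equiv.apply_symm_apply]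
  · rcases hr with hr | hr
    · exact Or.inl fun x => by rw [Equiv.symm_apply_eq, hr, Equiv.apply_symm_apply]
    · refine Or.inr fun x => ?_
      rw [Equiv.symm_apply_eq]
      have := hr (P.rot.symm (e.symm x))
      rw [Equiv.apply_symm_apply, Equiv.apply_symm_apply] at this
      rw [Equiv.eq_symm_apply] at this
      exact this

/-- A reflection inverts `rot`, but potentials involve only `rot²` and the sets of darts at the
double points, which are preserved; off the diagonal `inter` is the same for both neighbours of a
dart. -/
theorem Same.eliminatesIn (h : P.Same Q) {k : ℕ} (hk : EliminatesIn Q.adj k) :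
    EliminatesIn P.adj k := by
  obtain ⟨e, he, hr⟩ := h
  have hmem : ∀ x y, e y ∈ Q.dartsAt (e x) ↔ y ∈ P.dartsAt x := by
    intro x y
    rcases hr with hr | hr
    · simp only [mem_dartsAt, ← hr, e.injective.eq_iff]
    · have : ∀ z, Q.rot (e z) = e (P.rot (P.rot (P.rot z))) := fun z => by
        rw [← rot_symm_apply, ← Equiv.eq_symm_apply, ← hr, Equiv.apply_symm_apply]
      simp only [mem_dartsAt, this, e.injective.eq_iff, rot_four]
      tauto
  have hrr : ∀ x, e (P.rot (P.rot x)) = Q.rot (Q.rot (e x)) := by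
    intro x
    rcases hr with hr | hr
    · rw [hr, hr]
    · rw [hr, hr, rot_symm_apply, rot_symm_apply, rot_four]
  have hpot : ∀ c, P.IsPot c fun x => Q.pot (e c) (e x) := by
    intro c
    have hq := isPot_pot (e c)
    refine ⟨fun x => ?_, fun x hx => ?_, fun x hx => ?_⟩
    · simp only [he, hq.edge]
    · simp only [hrr, hq.at_mem _ ((hmem c x).2 hx)]
    · simp only [hrr, hq.off _ (fun hh => hx ((hmem c x).1 hh))]
  have hinter : ∀ c, ∀ y ∉ P.dartsAt c, P.inter c y = Q.inter (e c) (e y) := by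
    intro c y hy
    have hy' : e y ∉ Q.dartsAt (e c) := fun hh => hy ((hmem c y).1 hh)
    rw [(hpot c).inter_eq]
    rcases hr with hr | hr
    · rw [hr]; rfl
    · rw [hr, rot_symm_apply, (isPot_pot (e c)).off _ (by rwa [rot_mem_dartsAt])]; rfl
  let g : P.Crossing → Q.Crossing := Quotient.map e fun x y hxy => (hmem x y).2 hxy
  have hg : ∀ x, g (P.crossing x) = Q.crossing (e x) := fun x => rfl
  have hinj : Function.Injective g := by
    intro p q hpq
    obtain ⟨x, rfl⟩ := crossing_surjective p
    obtain ⟨y, rfl⟩ := crossing_surjective q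
    rw [hg, hg, crossing_eq_iff, hmem] at hpq
    exact crossing_eq_iff.2 hpq
  have hsurj : Function.Surjective g := by
    intro q
    obtain ⟨y, rfl⟩ := crossing_surjective q
    exact ⟨P.crossing (e.symm y), by rw [hg, Equiv.apply_symm_apply]⟩
  have hadj : P.adj = fun p q => Q.adj (g p) (g q) := by
    funext p q
    obtain ⟨x, rfl⟩ := crossing_surjective p
    obtain ⟨y, rfl⟩ := crossing_surjective q
    by_cases hxy : y ∈ P.dartsAt x
    · rw [crossing_eq_iff.2 hxy, adj_self, adj_self]
    · rw [hg, hg, adj_crossing hxy, adj_crossing (fun hh => hxy ((hmem x y).1 hh)), hinter x y hxy]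
  rw [hadj]
  exact hk.comp hinj adj_self fun q hq => absurd (hsurj q) hq

theorem RIEquiv.eliminatesIn_iff (h : RIEquiv P Q) (k : ℕ) :
    EliminatesIn P.adj k ↔ EliminatesIn Q.adj k := by
  induction h with
  | rel P Q h =>
    rcases h with h | h
    · exact ⟨h.symm.eliminatesIn, h.eliminatesIn⟩
    · exact (h.eliminatesIn_iff k).symm
  | refl => exact Iff.rfl
  | symm _ _ _ ih => exact ih.symm
  | trans _ _ _ _ _ ih1 ih2 => exact ih1.trans ih2

end KnotProjection

/-! ### Graphs that become edgeless by one or two eliminations. -/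

section Elimination

variable {V : Type} {A : V → V → ZMod 2}

/-- In the second case `v` and its neighbours form a clique, and all other vertices are isolated. -/
theorem EliminatesIn.exists_of_one (h : EliminatesIn A 1) :
    (∀ x y, A x y = 0) ∨ ∃ v, ∀ x y, x ≠ v → y ≠ v → x ≠ y → A x y = A x v * A v y := by
  rw [eliminatesIn_succ_iff] at h
  rcases h with h | ⟨v, h⟩
  · exact Or.inl h
  · refine Or.inr ⟨v, fun x y hx hy hxy => ?_⟩
    have := eliminatesIn_zero_iff.1 h x y
    rw [eliminate, if_neg (by simp [hx, hy, hxy])] at this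
    exact (ZModTwo.add_eq_zero_iff _ _).1 this

theorem eliminatesIn_one (v : V)
    (h : ∀ x y, x ≠ v → y ≠ v → x ≠ y → A x y + A x v * A v y = 0) : EliminatesIn A 1 := by
  refine .step _ v _ (.zero _ _ fun x y => ?_)
  unfold eliminate
  split_ifs with h1
  · rfl
  · simp only [not_or] at h1
    exact h x y h1.1 h1.2.1 h1.2.2

theorem eliminatesIn_two {v w : V} (hvw : v ≠ w) (h : ∀ x y, x ≠ v → y ≠ v → x ≠ w → y ≠ w → x ≠ y →
    A x y + A x v * A v y + (A x w + A x v * A v w) * (A w y + A w v * A v y) = 0) :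
    EliminatesIn A 2 := by
  refine .step _ v _ (eliminatesIn_one w fun x y hx hy hxy => ?_)
  by_cases hxv : x = v
  · simp [eliminate, hxv]
  · by_cases hyv : y = v
    · simp [eliminate, hyv]
    · simp only [eliminate, hxv, hyv, hx, hxy, hvw.symm, hy.symm, or_self, if_false]
      exact h x y hxv hyv hx hy hxy

theorem EliminatesIn.trans_of_one (h : EliminatesIn A 1) (hs : ∀ x y, A x y = A y x) {x y z : V}
    (hxy : x ≠ y) (h1 : A x z = 1) (h2 : A z y = 1) (h0 : ∀ x, A x x = 0) : A x y = 1 := by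
  have hne : ∀ x y, A x y = 1 → x ≠ y := by
    rintro x _ h rfl
    rw [h0] at h
    exact zero_ne_one h
  rcases h.exists_of_one with h | ⟨v, hv⟩
  · rw [h] at h1
    exact absurd h1 zero_ne_one
  · by_cases hz : z = v
    · subst hz
      rw [hv x y (hne _ _ h1) (hne _ _ h2).symm hxy, h1, h2, one_mul]
    · by_cases hx : x = v
      · subst hx
        have := hv z y hz hxy.symm (hne _ _ h2)
        rw [h2, hs z x, h1, one_mul] at this
        exact this.symm
      · by_cases hy : y = v
        · subst hy
          have := hv x z hx hz (hne _ _ h1)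
          rw [h1, hs y z, h2, mul_one] at this
          exact this.symm
        · have e1 := hv x z hx hz (hne _ _ h1)
          have e2 := hv z y hz hy (hne _ _ h2)
          rw [hv x y hx hy hxy]
          rw [h1] at e1
          rw [h2] at e2
          revert e1 e2
          generalize A x v = p; generalize A v z = q; generalize A z v = r; generalize A v y = s
          revert p q r s; decide

end Elimination

namespace KnotProjection

variable {P Q : KnotProjection}

/-! ### Twists -/

/-- The double points of `t 0, …, t (k - 1)` form a vertical twist, where `t i` is the upper right
corner of the double point number `i`, counted downwards. -/
structure IsTwist (P : KnotProjection) (k : ℕ) (t : ℕ → P.Dart) : Prop where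
  left : ∀ i, i + 1 < k → P.edge (P.rot (P.rot (t i))) = P.rot (t (i + 1))
  right : ∀ i, i + 1 < k → P.edge (P.rot (P.rot (P.rot (t i)))) = t (i + 1)
  distinct : ∀ i j, i < k → j < k → t i ∈ P.dartsAt (t j) → i = j

theorem IsPot.apply_rot_two {c : P.Dart} {f : P.Dart → ZMod 2} (hf : P.IsPot c f) [DecidableEq P.Crossing]
    (x : P.Dart) :
    f (P.rot (P.rot x)) = f x + if P.crossing x = P.crossing c then 1 else 0 := by
  split_ifs with h
  · exact hf.at_mem x (crossing_eq_iff.1 h.symm)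
  · rw [hf.off x (fun hh => h (crossing_eq_iff.2 hh).symm), add_zero]

/-- The two strands exchange sides at every double point of the twist, and both pass each of them
once, so they collect the same jumps. -/
theorem IsTwist.pot_transit {k : ℕ} {t : ℕ → P.Dart} (ht : P.IsTwist k t) {c : P.Dart}
    {f : P.Dart → ZMod 2} (hf : P.IsPot c f) [DecidableEq P.Crossing] (n : ℕ) (hn : n < k) :
    (Even n → f (t n) = f (t 0) + (∑ i ∈ Finset.range n, if P.crossing (t i) = P.crossing c then 1 else 0) ∧
      f (P.rot (t n)) = f (P.rot (t 0)) + ∑ i ∈ Finset.range n, if P.crossing (t i) = P.crossing c then 1 else 0) ∧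
    (Odd n → f (t n) = f (P.rot (t 0)) + (∑ i ∈ Finset.range n, if P.crossing (t i) = P.crossing c then 1 else 0) ∧
      f (P.rot (t n)) = f (t 0) + ∑ i ∈ Finset.range n, if P.crossing (t i) = P.crossing c then 1 else 0) := by
  induction n with
  | zero => simp
  | succ n ih =>
    have h1 := hf.apply_rot_two (t n)
    have h2 := hf.apply_rot_two (P.rot (t n))
    rw [crossing_rot] at h2
    rw [← hf.edge, ht.left n hn] at h1
    rw [← hf.edge, ht.right n hn] at h2
    obtain ⟨ih1, ih2⟩ := ih (by omega)
    rw [Finset.sum_range_succ]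
    constructor
    · intro he
      have ho : Odd n := by
        rcases Nat.even_or_odd n with h | h
        · exact absurd he (by simpa [Nat.even_add_one] using h)
        · exact h
      rw [h1, h2, (ih2 ho).1, (ih2 ho).2]
      exact ⟨by ring, by ring⟩
    · intro ho
      have he : Even n := by
        rcases Nat.even_or_odd n with h | h
        · exact h
        · exact absurd ho (by simpa [Nat.even_add_one] using h)
      rw [h1, h2, (ih1 he).1, (ih1 he).2]
      exact ⟨by ring, by ring⟩

/-- Equal jumps on both strands cancel in the sum. Consequently all double points of a twist are
interlaced with the same double points elsewhere. -/
theorem IsTwist.pot_sum {k : ℕ} {t : ℕ → P.Dart} (ht : P.IsTwist k t) {c : P.Dart}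
    {f : P.Dart → ZMod 2} (hf : P.IsPot c f) (n : ℕ) (hn : n < k) :
    f (t n) + f (P.rot (t n)) = f (t 0) + f (P.rot (t 0)) := by
  classical
  obtain ⟨h1, h2⟩ := ht.pot_transit hf n hn
  rcases Nat.even_or_odd n with h | h
  · rw [(h1 h).1, (h1 h).2]
    generalize f (t 0) = a; generalize f (P.rot (t 0)) = b
    generalize (∑ i ∈ Finset.range n, if P.crossing (t i) = P.crossing c then (1 : ZMod 2) else 0) = s
    revert a b s; decide
  · rw [(h2 h).1, (h2 h).2]
    generalize f (t 0) = a; generalize f (P.rot (t 0)) = b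
    generalize (∑ i ∈ Finset.range n, if P.crossing (t i) = P.crossing c then (1 : ZMod 2) else 0) = s
    revert a b s; decide

theorem IsTwist.sum_eq {k : ℕ} {t : ℕ → P.Dart} (ht : P.IsTwist k t) (c : P.Dart)
    [DecidableEq P.Crossing] [Decidable (∃ i < k, P.crossing (t i) = P.crossing c)] :
    (∑ i ∈ Finset.range k, if P.crossing (t i) = P.crossing c then 1 else 0 : ZMod 2) =
      if ∃ i < k, P.crossing (t i) = P.crossing c then 1 else 0 := by
  split_ifs with h
  · obtain ⟨i, hi, hic⟩ := h
    rw [Finset.sum_eq_single i, if_pos hic]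
    · intro j hj hji
      rw [if_neg]
      intro hjc
      exact hji (ht.distinct j i (Finset.mem_range.1 hj) hi
        (crossing_eq_iff.1 (hic.trans hjc.symm)))
    · intro hi'
      exact absurd (Finset.mem_range.2 hi) hi'
  · refine Finset.sum_eq_zero fun i hi => ?_
    rw [if_neg]
    exact fun hic => h ⟨i, Finset.mem_range.1 hi, hic⟩

open Classical in
/-- The number, modulo 2, of double points of the twist that are the one of `c`. -/
noncomputable def twistCount (P : KnotProjection) (k : ℕ) (t : ℕ → P.Dart) (c : P.Dart) : ZMod 2 :=
  if ∃ i < k, P.crossing (t i) = P.crossing c then 1 else 0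

/-- There are `k + 1` double points: for odd `k` each strand ends on the side on which it began, for
even `k` on the other side. -/
theorem IsTwist.pot_bottom {k : ℕ} {t : ℕ → P.Dart} (ht : P.IsTwist (k + 1) t) {c : P.Dart}
    {f : P.Dart → ZMod 2} (hf : P.IsPot c f) :
    (Odd k → f (P.rot (P.rot (P.rot (t k)))) = f (t 0) + P.twistCount (k + 1) t c ∧
      f (P.rot (P.rot (t k))) = f (P.rot (t 0)) + P.twistCount (k + 1) t c) ∧
    (Even k → f (P.rot (P.rot (P.rot (t k)))) = f (P.rot (t 0)) + P.twistCount (k + 1) t c ∧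
      f (P.rot (P.rot (t k))) = f (t 0) + P.twistCount (k + 1) t c) := by
  classical
  obtain ⟨h1, h2⟩ := ht.pot_transit hf k (Nat.lt_succ_self k)
  have h3 := ht.sum_eq c
  have h4 : P.twistCount (k + 1) t c =
    if ∃ i < k + 1, P.crossing (t i) = P.crossing c then 1 else 0 := by
    unfold twistCount
    congr
  rw [h4, ← h3, Finset.sum_range_succ, hf.apply_rot_two (P.rot (t k)), hf.apply_rot_two (t k),
    crossing_rot]
  constructor
  · intro h
    rw [(h2 h).1, (h2 h).2]
    exact ⟨by ring, by ring⟩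
  · intro h
    rw [(h1 h).1, (h1 h).2]
    exact ⟨by ring, by ring⟩

theorem IsTwist.inter_eq {k : ℕ} {t : ℕ → P.Dart} (ht : P.IsTwist k t) {c : P.Dart}
    {i : ℕ} (hi : i < k) : P.inter c (t i) = P.pot c (t 0) + P.pot c (P.rot (t 0)) :=
  ht.pot_sum (isPot_pot c) i hi

/-! ### Torus projections -/

/-- The sum of the potential over the two upper corners is the same at all double points. If it were
zero, the potential would be one function running around the closed twist with a single jump, at the
double point of `p`. So it is one, and every other double point is interlaced with `p`. -/
theorem IsTorus.adj_eq_one {k : ℕ} [NeZero k] (h : P.IsTorus k) {p q : P.Crossing} (hpq : p ≠ q) :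
    P.adj p q = 1 := by
  classical
  obtain ⟨e, hr, he⟩ := h
  have hcr : ∀ j c, P.crossing (e (j, c)) = P.crossing (e (j, 0)) := by
    intro j c
    have : ∀ c, P.crossing (e (j, c + 1)) = P.crossing (e (j, c)) := fun c => by
      rw [← hr, crossing_rot]
    have h1 := this 0
    have h2 := this 1
    have h3 := this 2
    fin_cases c
    · rfl
    · exact h1
    · exact h2.trans h1
    · exact h3.trans (h2.trans h1)
  have hex : ∀ p, ∃ j, p = P.crossing (e (j, 0)) := by
    intro p
    obtain ⟨x, rfl⟩ := crossing_surjective p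
    obtain ⟨⟨j, c⟩, rfl⟩ := e.surjective x
    exact ⟨j, hcr j c⟩
  obtain ⟨i, rfl⟩ := hex p
  obtain ⟨j, rfl⟩ := hex q
  have hinj : ∀ i j, P.crossing (e (i, 0)) = P.crossing (e (j, 0)) → i = j := by
    intro i j hij
    have := crossing_eq_iff.1 hij
    simp only [mem_dartsAt, hr, e.injective.eq_iff, Prod.mk.injEq] at this
    tauto
  rw [adj_crossing (fun hh => hpq (crossing_eq_iff.2 hh))]
  set c := e (i, 0) with hc
  have hf := isPot_pot c
  set f := P.pot c with hfdef
  have hr0 : ∀ j, P.rot (e (j, 0)) = e (j, 1) := fun j => hr j 0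
  have hNE : ∀ j, f (e (j + 1, 0)) = f (e (j, 1)) + if j = i then 1 else 0 := by
    intro j
    rw [← (he j).2, hf.edge]
    have h3 : e (j, SE) = P.rot (P.rot (e (j, 1))) := by rw [hr, hr]; rfl
    rw [h3, hf.apply_rot_two, hcr]
    congr 1
    by_cases hji : j = i
    · simp [hji, hc]
    · rw [if_neg hji, if_neg (fun hh => hji (hinj _ _ hh))]
  have hNW : ∀ j, f (e (j + 1, 1)) = f (e (j, 0)) + if j = i then 1 else 0 := by
    intro j
    have h2 := (he j).1
    change P.edge (e (j, SW)) = e (j + 1, 1) at h2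
    rw [← h2, hf.edge]
    have h3 : e (j, SW) = P.rot (P.rot (e (j, 0))) := by rw [hr, hr]; rfl
    rw [h3, hf.apply_rot_two]
    congr 1
    by_cases hji : j = i
    · simp [hji, hc]
    · rw [if_neg hji, if_neg (fun hh => hji (hinj _ _ hh))]
  have hD : ∀ j, f (e (j + 1, 0)) + f (e (j + 1, 1)) = f (e (j, 0)) + f (e (j, 1)) := by
    intro j
    rw [hNE, hNW]
    generalize f (e (j, 0)) = a; generalize f (e (j, 1)) = b
    generalize (if j = i then (1 : ZMod 2) else 0) = s
    revert a b s; decide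
  have hDn : ∀ n : ℕ, f (e ((n : ZMod k), 0)) + f (e ((n : ZMod k), 1)) =
      f (e (0, 0)) + f (e (0, 1)) := by
    intro n
    induction n with
    | zero => simp
    | succ n ih => rw [Nat.cast_succ, hD, ih]
  have hDc : ∀ j, f (e (j, 0)) + f (e (j, 1)) = f (e (0, 0)) + f (e (0, 1)) := by
    intro j
    have := hDn j.val
    rwa [ZMod.natCast_zmod_val] at this
  have hone : f (e (0, 0)) + f (e (0, 1)) = 1 := by
    rcases ZModTwo.eq_zero_or_one (f (e (0, 0)) + f (e (0, 1))) with h0 | h0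
    · exfalso
      have : Fintype (ZMod k) := ZMod.fintype k
      have hn : ∀ j, f (e (j + 1, 0)) = f (e (j, 0)) + if j = i then 1 else 0 := by
        intro j
        have := hDc j
        rw [h0, ZModTwo.add_eq_zero_iff] at this
        rw [hNE, this]
      have hsum : ∑ j : ZMod k, f (e (j + 1, 0)) = ∑ j : ZMod k, f (e (j, 0)) :=
        Equiv.sum_comp (Equiv.addRight (1 : ZMod k)) fun j => f (e (j, 0))
      simp_rw [hn] at hsum
      rw [Finset.sum_add_distrib, Finset.sum_ite_eq' Finset.univ i, if_pos (Finset.mem_univ i)] at hsum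
      revert hsum
      generalize (∑ j : ZMod k, f (e (j, 0))) = s
      revert s; decide
    · exact h0
  rw [inter, ← hfdef, hr0, hDc j, hone]

theorem torus_eliminatesIn {k : ℕ} (hk : 2 ≤ k) (h : P.IsTorus k) :
    EliminatesIn P.adj 1 ∧ ¬ EliminatesIn P.adj 0 := by
  have : NeZero k := ⟨by omega⟩
  have : Fact (1 < k) := ⟨hk⟩
  have hA := fun p q => h.adj_eq_one (p := p) (q := q)
  obtain ⟨e, hr, he⟩ := h
  constructor
  · refine eliminatesIn_one (P.crossing (e (0, 0))) fun x y hx hy hxy => ?_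
    rw [hA _ _ hxy, hA _ _ hx, hA _ _ hy.symm]
    decide
  · rw [eliminatesIn_zero_iff]
    intro h0
    have hne : P.crossing (e (0, 0)) ≠ P.crossing (e (1, 0)) := by
      intro hh
      have := crossing_eq_iff.1 hh
      simp [mem_dartsAt, hr] at this
    have := hA _ _ hne
    rw [h0] at this
    exact zero_ne_one this

/-! ### Graphs with few types of vertices -/

/-- `M r r` is the adjacency of two different vertices of type `r`. The condition on the matrix can
be decided, whatever the lengths of the twists. -/
theorem eliminatesIn_of_types {V T : Type} {A : V → V → ZMod 2} {ty : V → T} {M : T → T → ZMod 2}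
    (hM : ∀ x y, x ≠ y → A x y = M (ty x) (ty y)) {v w : V} (hvw : v ≠ w)
    (h : ∀ r s, M r s + M r (ty v) * M (ty v) s +
      (M r (ty w) + M r (ty v) * M (ty v) (ty w)) * (M (ty w) s + M (ty w) (ty v) * M (ty v) s) = 0) :
    EliminatesIn A 2 := by
  refine eliminatesIn_two hvw fun x y hxv hyv hxw hyw hxy => ?_
  rw [hM _ _ hxy, hM _ _ hxv, hM _ _ hyv.symm, hM _ _ hxw, hM _ _ hvw, hM _ _ hyw.symm,
    hM _ _ hvw.symm]
  exact h _ _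

theorem crossing_of_rot {V : Type} {e : V × Fin 4 ≃ P.Dart}
    (hr : ∀ v c, P.rot (e (v, c)) = e (v, c + 1)) (v : V) (c : Fin 4) :
    P.crossing (e (v, c)) = P.crossing (e (v, 0)) := by
  have : ∀ c, P.crossing (e (v, c + 1)) = P.crossing (e (v, c)) := fun c => by
    rw [← hr, crossing_rot]
  have h1 := this 0
  have h2 := this 1
  have h3 := this 2
  fin_cases c
  · rfl
  · exact h1
  · exact h2.trans h1
  · exact h3.trans (h2.trans h1)

theorem crossing_inj_of_rot {V : Type} {e : V × Fin 4 ≃ P.Dart}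
    (hr : ∀ v c, P.rot (e (v, c)) = e (v, c + 1)) {v w : V} {c d : Fin 4}
    (h : P.crossing (e (v, c)) = P.crossing (e (w, d))) : v = w := by
  rw [crossing_of_rot hr v c, crossing_of_rot hr w d] at h
  have := crossing_eq_iff.1 h
  simp only [mem_dartsAt, hr, e.injective.eq_iff, Prod.mk.injEq] at this
  tauto

/-- The crossings of a diagram whose crossings are numbered by `V`. -/
noncomputable def crossingEquiv {V : Type} (e : V × Fin 4 ≃ P.Dart)
    (hr : ∀ v c, P.rot (e (v, c)) = e (v, c + 1)) : V ≃ P.Crossing :=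
  Equiv.ofBijective (fun v => P.crossing (e (v, 0))) ⟨fun _ _ h => crossing_inj_of_rot hr h,
    fun p => by
      obtain ⟨x, rfl⟩ := crossing_surjective p
      obtain ⟨⟨v, c⟩, rfl⟩ := e.surjective x
      exact ⟨v, (crossing_of_rot hr v c).symm⟩⟩

theorem adj_crossingEquiv {V : Type} {e : V × Fin 4 ≃ P.Dart}
    (hr : ∀ v c, P.rot (e (v, c)) = e (v, c + 1)) {v w : V} (hvw : v ≠ w) (c d : Fin 4) :
    P.adj (crossingEquiv e hr v) (crossingEquiv e hr w) = P.inter (e (v, c)) (e (w, d)) := by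
  change P.adj (P.crossing (e (v, 0))) (P.crossing (e (w, 0))) = _
  rw [← crossing_of_rot hr v c, ← crossing_of_rot hr w d, adj_crossing]
  intro h
  exact hvw (crossing_inj_of_rot hr (crossing_eq_iff.2 h))

theorem isTwist_of_equiv {V : Type} {e : V × Fin 4 ≃ P.Dart}
    (hr : ∀ v c, P.rot (e (v, c)) = e (v, c + 1)) {k : ℕ} {g : ℕ → V}
    (hg : ∀ i j, i < k → j < k → g i = g j → i = j) (s : Fin 4)
    (h : ∀ i, i + 1 < k → P.edge (e (g i, s + 2)) = e (g (i + 1), s + 1) ∧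
      P.edge (e (g i, s + 3)) = e (g (i + 1), s)) : P.IsTwist k fun i => e (g i, s) := by
  refine ⟨fun i hi => ?_, fun i hi => ?_, fun i j hi hj hij => ?_⟩
  · rw [hr, hr, hr, ← (h i hi).1, add_assoc]; rfl
  · rw [hr, hr, hr, ← (h i hi).2, add_assoc, add_assoc]; rfl
  · exact (hg j i hj hi (crossing_inj_of_rot hr (crossing_eq_iff.2 hij))).symm

theorem twistCount_crossing {V : Type} {e : V × Fin 4 ≃ P.Dart}
    (hr : ∀ v c, P.rot (e (v, c)) = e (v, c + 1)) {k : ℕ} {g : ℕ → V} (s : Fin 4) (v : V)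
    [Decidable (∃ i < k, g i = v)] :
    P.twistCount k (fun i => e (g i, s)) (e (v, 0)) = if ∃ i < k, g i = v then 1 else 0 := by
  have h : (∃ i < k, P.crossing (e (g i, s)) = P.crossing (e (v, 0))) ↔ ∃ i < k, g i = v := by
    refine exists_congr fun i => and_congr_right fun _ => ⟨fun h => crossing_inj_of_rot hr h, ?_⟩
    rintro rfl
    exact crossing_of_rot hr _ _
  by_cases h' : ∃ i < k, g i = v
  · rw [if_pos h', twistCount, if_pos (h.2 h')]
  · rw [if_neg h', twistCount, if_neg (fun hh => h' (h.1 hh))]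

/-- The joining arcs identify the values at the ends of the two twists, and `pot_bottom` relates the
values within each twist. Three of the four joining arcs already determine the two sums. -/
theorem rational_pot {k l : ℕ} (hk : Odd k) (hl : Even l) {V H : ℕ → P.Dart}
    (hV : P.IsTwist (k + 1) V) (hH : P.IsTwist (l + 1) H) (h1 : P.edge (V 0) = H 0)
    (h2 : P.edge (P.rot (P.rot (P.rot (V k)))) = P.rot (H 0))
    (h3 : P.edge (P.rot (P.rot (P.rot (H l)))) = P.rot (V 0)) {c : P.Dart} {f : P.Dart → ZMod 2}
    (hf : P.IsPot c f) :
    f (V 0) + f (P.rot (V 0)) = P.twistCount (k + 1) V c + P.twistCount (l + 1) H c ∧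
      f (H 0) + f (P.rot (H 0)) = P.twistCount (k + 1) V c := by
  have e1 := (hV.pot_bottom hf).1 hk
  have e2 := (hH.pot_bottom hf).2 hl
  rw [← hf.edge, h2] at e1
  rw [← hf.edge, h3] at e2
  have e3 := hf.edge (V 0)
  rw [h1] at e3
  rw [e1.1, e2.1, e1.1, e3]
  generalize f (V 0) = a; generalize P.twistCount (k + 1) V c = b
  generalize P.twistCount (l + 1) H c = d
  revert a b d; decide

/-- The interlacement in a rational projection: `true` stands for the vertical twist. -/
def rationalMatrix : Bool → Bool → ZMod 2
  | false, false => 0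
  | _, _ => 1

theorem IsRational.adj_eq {k l : ℕ} (hk : Odd k) (hl : Even l) (h : P.IsRational (k + 1) (l + 1)) :
    ∃ E : Fin (k + 1) ⊕ Fin (l + 1) ≃ P.Crossing, ∀ v w, v ≠ w →
      P.adj (E v) (E w) = rationalMatrix v.isLeft w.isLeft := by
  classical
  obtain ⟨e, hr, hV, hH, hJ⟩ := h
  refine ⟨crossingEquiv e hr, ?_⟩
  have hval : ∀ {n i : ℕ}, i < n + 1 → ((Fin.ofNat (n + 1) i : Fin (n + 1)) : ℕ) = i :=
    fun hi => Nat.mod_eq_of_lt hi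
  have hofNat : ∀ {n : ℕ} (i : Fin (n + 1)), Fin.ofNat (n + 1) i = i := fun i =>
    Fin.ext (hval i.2)
  have tV : P.IsTwist (k + 1) fun i => e (.inl (Fin.ofNat (k + 1) i), 0) := by
    refine isTwist_of_equiv (g := fun i => .inl (Fin.ofNat (k + 1) i)) hr ?_ 0 ?_
    · intro i j hi hj hij
      have := congrArg Fin.val (Sum.inl.inj hij)
      rwa [hval hi, hval hj] at this
    · intro i hi
      exact hV _ _ (by rw [hval hi, hval (by omega)])
  -- A horizontal twist is a vertical one after a quarter turn, its upper left corners playing the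
  -- part of the upper right ones.
  have tH : P.IsTwist (l + 1) fun i => e (.inr (Fin.ofNat (l + 1) i), 1) := by
    refine isTwist_of_equiv (g := fun i => .inr (Fin.ofNat (l + 1) i)) hr ?_ 1 ?_
    · intro i j hi hj hij
      have := congrArg Fin.val (Sum.inr.inj hij)
      rwa [hval hi, hval hj] at this
    · intro i hi
      exact (hH _ _ (by rw [hval hi, hval (by omega)])).symm
  obtain ⟨j1, j2, j3, j4⟩ := hJ (Fin.ofNat _ 0) (Fin.ofNat _ k) (Fin.ofNat _ 0) (Fin.ofNat _ l)
    (hval (by omega)) (by rw [hval (by omega)]) (hval (by omega)) (by rw [hval (by omega)])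
  intro v w hvw
  have key := rational_pot hk hl tV tH (by exact j1) (by simp only [hr]; exact j2)
    (by simp only [hr]; exact j3) (isPot_pot (e (v, 0)))
  rw [twistCount_crossing (g := fun i => .inl (Fin.ofNat (k + 1) i)) hr 0 v,
    twistCount_crossing (g := fun i => .inr (Fin.ofNat (l + 1) i)) hr 1 v] at key
  have hvl : (∃ i < k + 1, (.inl (Fin.ofNat (k + 1) i) : Fin (k + 1) ⊕ Fin (l + 1)) = v) ↔
      v.isLeft = true := by
    constructor
    · rintro ⟨i, -, rfl⟩; rfl
    · intro h
      obtain ⟨i, rfl⟩ := Sum.isLeft_iff.1 h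
      exact ⟨i, i.2, by rw [hofNat]⟩
  have hvr : (∃ i < l + 1, (.inr (Fin.ofNat (l + 1) i) : Fin (k + 1) ⊕ Fin (l + 1)) = v) ↔
      ¬ v.isLeft = true := by
    constructor
    · rintro ⟨i, -, rfl⟩; simp
    · intro h
      rw [Sum.not_isLeft] at h
      obtain ⟨i, rfl⟩ := Sum.isRight_iff.1 h
      exact ⟨i, i.2, by rw [hofNat]⟩
  simp only [hvl, hvr] at key
  rcases w with j | j
  · rw [adj_crossingEquiv hr hvw 0 0]
    have := tV.inter_eq (c := e (v, 0)) j.2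
    simp only [hofNat] at this
    rw [this, key.1]
    cases v.isLeft <;> rfl
  · rw [adj_crossingEquiv hr hvw 0 1]
    have := tH.inter_eq (c := e (v, 0)) j.2
    simp only [hofNat] at this
    rw [this, key.2]
    cases v.isLeft <;> rfl

theorem rational_eliminatesIn {m n : ℕ} (hm : 1 ≤ m) (hn : 2 ≤ n)
    (h : P.IsRational (2 * m) (2 * n - 1)) : EliminatesIn P.adj 2 ∧ ¬ EliminatesIn P.adj 1 := by
  obtain ⟨m, rfl⟩ : ∃ m', m = m' + 1 := ⟨m - 1, by omega⟩
  obtain ⟨n, rfl⟩ : ∃ n', n = n' + 2 := ⟨n - 2, by omega⟩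
  have h' : P.IsRational (2 * m + 1 + 1) (2 * n + 2 + 1) := h
  obtain ⟨E, hE⟩ := h'.adj_eq (by simp) (by simp [parity_simps])
  have hM : ∀ x y, x ≠ y → P.adj x y = rationalMatrix (E.symm x).isLeft (E.symm y).isLeft := by
    intro x y hxy
    have := hE (E.symm x) (E.symm y) (fun hh => hxy (E.symm.injective hh))
    rwa [E.apply_symm_apply, E.apply_symm_apply] at this
  constructor
  · refine eliminatesIn_of_types hM (v := E (.inl 0)) (w := E (.inr 0)) (by simp) ?_
    simp only [E.symm_apply_apply, Sum.isLeft_inl, Sum.isLeft_inr]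
    decide
  · intro h1
    -- Two double points of the horizontal twist are not interlaced, but both are interlaced with
    -- one of the vertical twist.
    have := h1.trans_of_one adj_comm (x := E (.inr 0)) (y := E (.inr 1)) (z := E (.inl 0))
      (fun hh => by
        have := congrArg Fin.val (Sum.inr.inj (E.injective hh))
        simp at this)
      (hE _ _ (by simp)) (hE _ _ (by simp)) adj_self
    rw [hE _ _ (by
      intro hh
      have := congrArg Fin.val (Sum.inr.inj hh)
      simp at this)] at this
    exact zero_ne_one this

/-- The interlacement in a pretzel projection with one even column, which comes first. -/
def pretzelMatrix : Fin 3 → Fin 3 → ZMod 2 := ![![0, 1, 1], ![1, 1, 0], ![1, 0, 1]]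

theorem IsPretzel.adj_eq {k : Fin 3 → ℕ} (h0 : Odd (k 0)) (h1 : Even (k 1)) (h2 : Even (k 2))
    (h : P.IsPretzel fun i => k i + 1) :
    ∃ E : (Σ i : Fin 3, Fin (k i + 1)) ≃ P.Crossing, ∀ v w, v ≠ w →
      P.adj (E v) (E w) = pretzelMatrix v.1 w.1 := by
  classical
  obtain ⟨e, hr, hV, hN, hS⟩ := h
  refine ⟨crossingEquiv e hr, ?_⟩
  have hval : ∀ {n i : ℕ}, i < n + 1 → ((Fin.ofNat (n + 1) i : Fin (n + 1)) : ℕ) = i :=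
    fun hi => Nat.mod_eq_of_lt hi
  have hofNat : ∀ {n : ℕ} (i : Fin (n + 1)), Fin.ofNat (n + 1) i = i := fun i =>
    Fin.ext (hval i.2)
  let g : Fin 3 → ℕ → (Σ i : Fin 3, Fin (k i + 1)) := fun s i => ⟨s, Fin.ofNat (k s + 1) i⟩
  have t : ∀ s, P.IsTwist (k s + 1) fun i => e (g s i, 0) := by
    intro s
    refine isTwist_of_equiv (g := g s) hr ?_ 0 ?_
    · intro i j hi hj hij
      have := congrArg Fin.val (eq_of_heq (Sigma.mk.inj hij).2)
      rwa [hval hi, hval hj] at this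
    · intro i hi
      exact hV s _ _ (by rw [hval hi, hval (by omega)])
  intro v w hvw
  have hf := isPot_pot (e (v, 0))
  set f := P.pot (e (v, 0)) with hfdef
  have hcount : ∀ s, P.twistCount (k s + 1) (fun i => e (g s i, 0)) (e (v, 0)) =
      if v.1 = s then 1 else 0 := by
    intro s
    rw [twistCount_crossing (g := g s) hr 0 v]
    have : (∃ i < k s + 1, g s i = v) ↔ v.1 = s := by
      constructor
      · rintro ⟨i, -, rfl⟩; rfl
      · rintro rfl
        exact ⟨v.2, v.2.2, by simp only [g, hofNat]⟩
    simp only [this]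
  have top : ∀ s : Fin 3, f (P.rot (e (g (s + 1) 0, 0))) = f (e (g s 0, 0)) := by
    intro s
    rw [hr, ← hf.edge (e (g s 0, 0))]
    exact congrArg f (hN s _ _ (hval (by omega)) (hval (by omega))).symm
  have bot : ∀ s : Fin 3, f (P.rot (P.rot (e (g (s + 1) (k (s + 1)), 0)))) =
      f (P.rot (P.rot (P.rot (e (g s (k s), 0))))) := by
    intro s
    rw [hr, hr, hr, hr, hr, ← hf.edge (e (g s (k s), _))]
    exact congrArg f (hS s _ _ (by rw [hval (by omega)]) (by rw [hval (by omega)])).symm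
  have b0 := ((t 0).pot_bottom hf).1 h0
  have b1 := ((t 1).pot_bottom hf).2 h1
  have b2 := ((t 2).pot_bottom hf).2 h2
  rw [hcount] at b0 b1 b2
  have t0 := top 0
  have t1 := top 1
  have t2 := top 2
  have u0 := bot 0
  have u1 := bot 1
  have u2 := bot 2
  simp only [zero_add] at t0 u0
  change f (P.rot (e (g 2 0, 0))) = _ at t1
  change f (P.rot (e (g 0 0, 0))) = _ at t2
  change f (P.rot (P.rot (e (g 2 (k 2), 0)))) = _ at u1
  change f (P.rot (P.rot (e (g 0 (k 0), 0)))) = _ at u2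
  rw [b0.1, b1.2] at u0
  rw [b1.1, b2.2] at u1
  rw [b2.1, b0.2] at u2
  -- The upper arcs leave one unknown value for each column and the lower arcs relate these; a
  -- finite check over `ZMod 2` remains.
  have hw : ∀ s, f (e (g s 0, 0)) + f (P.rot (e (g s 0, 0))) = pretzelMatrix v.1 s := by
    intro s
    generalize v.1 = r at u0 u1 u2 ⊢
    rw [t0] at u1
    rw [t1, t2] at u2
    revert u0 u1 u2
    have : s = 0 ∨ s = 1 ∨ s = 2 := by revert s; decide
    rcases this with rfl | rfl | rfl <;> simp only [t0, t1, t2] <;>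
      generalize f (e (g 0 0, 0)) = x <;> generalize f (e (g 1 0, 0)) = y <;>
      generalize f (e (g 2 0, 0)) = z <;> revert x y z r <;> decide
  rw [adj_crossingEquiv hr hvw 0 0]
  have := (t w.1).inter_eq (c := e (v, 0)) w.2.2
  simp only [g, hofNat] at this
  exact this.trans (hw w.1)

theorem pretzel_eliminatesIn {p q r : ℕ} (hp : 1 ≤ p) (hq : 1 ≤ q) (hr : 1 ≤ r)
    (h : P.IsPretzel ![2 * p, 2 * q - 1, 2 * r - 1]) :
    EliminatesIn P.adj 2 ∧ ¬ EliminatesIn P.adj 1 := by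
  obtain ⟨p, rfl⟩ : ∃ p', p = p' + 1 := ⟨p - 1, by omega⟩
  obtain ⟨q, rfl⟩ : ∃ q', q = q' + 1 := ⟨q - 1, by omega⟩
  obtain ⟨r, rfl⟩ : ∃ r', r = r' + 1 := ⟨r - 1, by omega⟩
  have hk : ![2 * (p + 1), 2 * (q + 1) - 1, 2 * (r + 1) - 1] =
      fun i => ![2 * p + 1, 2 * q, 2 * r] i + 1 := by
    funext i
    fin_cases i <;> rfl
  rw [hk] at h
  obtain ⟨E, hE⟩ := h.adj_eq (by simp) (by simp) (by simp)
  have hM : ∀ x y, x ≠ y → P.adj x y = pretzelMatrix (E.symm x).1 (E.symm y).1 := by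
    intro x y hxy
    have := hE (E.symm x) (E.symm y) (fun hh => hxy (E.symm.injective hh))
    rwa [E.apply_symm_apply, E.apply_symm_apply] at this
  have hne : ∀ {i j : Fin 3} {x y}, i ≠ j → E ⟨i, x⟩ ≠ E ⟨j, y⟩ := fun hij hh =>
    hij (Sigma.mk.inj (E.injective hh)).1
  constructor
  · refine eliminatesIn_of_types hM (v := E ⟨1, 0⟩) (w := E ⟨0, 0⟩) (hne (by decide)) ?_
    simp only [E.symm_apply_apply]
    decide
  · intro h1
    -- Double points of the two odd columns are not interlaced with each other, but both are
    -- interlaced with one of the even column.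
    have := h1.trans_of_one adj_comm (x := E ⟨1, 0⟩) (y := E ⟨2, 0⟩) (z := E ⟨0, 0⟩)
      (hne (by decide)) (hE _ _ fun hh => hne (by decide) (congrArg E hh))
      (hE _ _ fun hh => hne (by decide) (congrArg E hh)) adj_self
    rw [hE _ _ fun hh => hne (by decide) (congrArg E hh)] at this
    exact zero_ne_one this

/-! ### Connected sums -/

theorem IsConnectedSum.symm {P₁ P₂ : KnotProjection} (h : IsConnectedSum P₁ P₂ Q) :
    IsConnectedSum P₂ P₁ Q := by
  rcases h with h | h | ⟨a, b, e, h1, h2, h3, h4, h5, h6⟩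
  · exact Or.inr (Or.inl h)
  · exact Or.inl h
  · refine Or.inr (Or.inr ⟨b, a, (Equiv.sumComm _ _).trans e, ?_, ?_, ?_, ?_, ?_, ?_⟩) <;>
      simp only [Equiv.trans_apply, Equiv.sumComm_apply, Sum.swap_inl, Sum.swap_inr]
    · exact h2
    · exact h1
    · rw [← h3, edge_edge]
    · rw [← h4, edge_edge]
    · exact h6
    · exact h5

/-- The curve runs through the second summand in one stretch, without meeting the double point of
`c`, so the potential keeps there the value that it has at the cut. -/
theorem IsConnectedSum.isPot_left {P₁ P₂ : KnotProjection} {a : P₁.Dart} {b : P₂.Dart}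
    {e : P₁.Dart ⊕ P₂.Dart ≃ Q.Dart} (h1 : ∀ x, Q.rot (e (.inl x)) = e (.inl (P₁.rot x)))
    (h2 : ∀ y, Q.rot (e (.inr y)) = e (.inr (P₂.rot y))) (h3 : Q.edge (e (.inl a)) = e (.inr b))
    (h4 : Q.edge (e (.inl (P₁.edge a))) = e (.inr (P₂.edge b)))
    (h5 : ∀ x, x ≠ a → x ≠ P₁.edge a → Q.edge (e (.inl x)) = e (.inl (P₁.edge x)))
    (h6 : ∀ y, y ≠ b → y ≠ P₂.edge b → Q.edge (e (.inr y)) = e (.inr (P₂.edge y))) (c : P₁.Dart) :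
    Q.IsPot (e (.inl c)) fun z => Sum.elim (P₁.pot c) (fun _ => P₁.pot c a) (e.symm z) := by
  have hp := isPot_pot c
  have hmem : ∀ x, e (.inl x) ∈ Q.dartsAt (e (.inl c)) ↔ x ∈ P₁.dartsAt c := fun x => by
    simp only [mem_dartsAt, h1, e.injective.eq_iff, Sum.inl.injEq]
  have hmem' : ∀ y, e (.inr y) ∉ Q.dartsAt (e (.inl c)) := fun x => by
    simp only [mem_dartsAt, h1, e.injective.eq_iff, reduceCtorEq, or_self, not_false_eq_true]
  have h3' : Q.edge (e (.inr b)) = e (.inl a) := by rw [← h3, edge_edge]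
  have h4' : Q.edge (e (.inr (P₂.edge b))) = e (.inl (P₁.edge a)) := by rw [← h4, edge_edge]
  refine ⟨fun z => ?_, fun z => ?_, fun z => ?_⟩ <;> obtain ⟨x | y, rfl⟩ := e.surjective z
  · by_cases hx : x = a
    · subst hx; simp [h3]
    · by_cases hx' : x = P₁.edge a
      · subst hx'; simp [h4, hp.edge]
      · simp [h5 x hx hx', hp.edge]
  · by_cases hy : y = b
    · subst hy; simp [h3']
    · by_cases hy' : y = P₂.edge b
      · subst hy'; simp [h4', hp.edge]
      · simp [h6 y hy hy']
  · intro hx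
    simp [h1, hp.at_mem x ((hmem x).1 hx)]
  · intro hy
    exact absurd hy (hmem' y)
  · intro hx
    simp [h1, hp.off x (fun hh => hx ((hmem x).2 hh))]
  · intro _
    simp [h2]

/-- The graph of a connected sum is the disjoint union of the graphs of the summands. -/
theorem IsConnectedSum.exists_adj {P₁ P₂ : KnotProjection} (h : IsConnectedSum P₁ P₂ Q)
    (hP₁ : ¬ EliminatesIn P₁.adj 0) (hP₂ : ¬ EliminatesIn P₂.adj 0) :
    ∃ E : P₁.Crossing ⊕ P₂.Crossing ≃ Q.Crossing,
      (∀ p q, Q.adj (E (.inl p)) (E (.inl q)) = P₁.adj p q) ∧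
      (∀ p q, Q.adj (E (.inr p)) (E (.inr q)) = P₂.adj p q) ∧
      ∀ p q, Q.adj (E (.inl p)) (E (.inr q)) = 0 := by
  have hempty : ∀ P : KnotProjection, P.IsSimpleClosedCurve → EliminatesIn P.adj 0 := fun P hP =>
    (Unknots.done P hP).eliminatesIn
  have hs := h.symm
  rcases h with h | h | ⟨a, b, e, h1, h2, h3, h4, h5, h6⟩
  · exact absurd (hempty _ h.1) hP₁
  · exact absurd (hempty _ h.1) hP₂
  have pot1 := IsConnectedSum.isPot_left h1 h2 h3 h4 h5 h6
  have h3' : Q.edge (e (.inr b)) = e (.inl a) := by rw [← h3, edge_edge]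
  have h4' : Q.edge (e (.inr (P₂.edge b))) = e (.inl (P₁.edge a)) := by rw [← h4, edge_edge]
  have pot2 := IsConnectedSum.isPot_left (e := (Equiv.sumComm _ _).trans e) h2 h1 h3' h4' h6 h5
  have m1 : ∀ x c, e (.inl x) ∈ Q.dartsAt (e (.inl c)) ↔ x ∈ P₁.dartsAt c := fun x c => by
    simp only [mem_dartsAt, h1, e.injective.eq_iff, Sum.inl.injEq]
  have m2 : ∀ x c, e (.inr x) ∈ Q.dartsAt (e (.inr c)) ↔ x ∈ P₂.dartsAt c := fun x c => by
    simp only [mem_dartsAt, h2, e.injective.eq_iff, Sum.inr.injEq]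
  have m3 : ∀ y c, e (.inr y) ∉ Q.dartsAt (e (.inl c)) := fun y c => by
    simp only [mem_dartsAt, h1, e.injective.eq_iff, reduceCtorEq, or_self, not_false_eq_true]
  let g₁ : P₁.Crossing → Q.Crossing := Quotient.map (fun x => e (.inl x)) fun x y hxy => (m1 y x).2 hxy
  let g₂ : P₂.Crossing → Q.Crossing := Quotient.map (fun x => e (.inr x)) fun x y hxy => (m2 y x).2 hxy
  have hg₁ : ∀ x, g₁ (P₁.crossing x) = Q.crossing (e (.inl x)) := fun x => rfl
  have hg₂ : ∀ x, g₂ (P₂.crossing x) = Q.crossing (e (.inr x)) := fun x => rfl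
  let E : P₁.Crossing ⊕ P₂.Crossing ≃ Q.Crossing := by
    refine Equiv.ofBijective (Sum.elim g₁ g₂) ⟨?_, ?_⟩
    · rintro (p | p) (q | q) hpq <;> obtain ⟨x, rfl⟩ := crossing_surjective p <;>
        obtain ⟨y, rfl⟩ := crossing_surjective q <;>
        simp only [Sum.elim_inl, Sum.elim_inr, hg₁, hg₂] at hpq
      · rw [crossing_eq_iff.2 ((m1 y x).1 (crossing_eq_iff.1 hpq))]
      · exact absurd (crossing_eq_iff.1 hpq) (m3 y x)
      · exact absurd (crossing_eq_iff.1 hpq.symm) (m3 x y)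
      · rw [crossing_eq_iff.2 ((m2 y x).1 (crossing_eq_iff.1 hpq))]
    · intro q
      obtain ⟨z, rfl⟩ := crossing_surjective q
      obtain ⟨x | y, rfl⟩ := e.surjective z
      · exact ⟨.inl (P₁.crossing x), rfl⟩
      · exact ⟨.inr (P₂.crossing y), rfl⟩
  refine ⟨E, fun p q => ?_, fun p q => ?_, fun p q => ?_⟩ <;>
    obtain ⟨x, rfl⟩ := crossing_surjective p <;> obtain ⟨y, rfl⟩ := crossing_surjective q
  · change Q.adj (Q.crossing (e (.inl x))) (Q.crossing (e (.inl y))) = _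
    by_cases hxy : y ∈ P₁.dartsAt x
    · rw [crossing_eq_iff.2 hxy, crossing_eq_iff.2 ((m1 y x).2 hxy), adj_self, adj_self]
    · rw [adj_crossing hxy, adj_crossing (fun hh => hxy ((m1 y x).1 hh)), (pot1 x).inter_eq]
      simp [h1, inter]
  · change Q.adj (Q.crossing (e (.inr x))) (Q.crossing (e (.inr y))) = _
    by_cases hxy : y ∈ P₂.dartsAt x
    · rw [crossing_eq_iff.2 hxy, crossing_eq_iff.2 ((m2 y x).2 hxy), adj_self, adj_self]
    · rw [adj_crossing hxy, adj_crossing (fun hh => hxy ((m2 y x).1 hh))]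
      have := (pot2 x).inter_eq (e (.inr y))
      simpa [h2, inter] using this
  · change Q.adj (Q.crossing (e (.inl x))) (Q.crossing (e (.inr y))) = _
    rw [adj_crossing (m3 y x), (pot1 x).inter_eq]
    simp [h2, ZModTwo.add_self]

/-- One elimination in each component of the graph suffices. A single one leaves the edges of the
other component untouched. -/
theorem connectedSum_eliminatesIn {P₁ P₂ : KnotProjection} (h : IsConnectedSum P₁ P₂ Q)
    (h₁ : EliminatesIn P₁.adj 1 ∧ ¬ EliminatesIn P₁.adj 0)
    (h₂ : EliminatesIn P₂.adj 1 ∧ ¬ EliminatesIn P₂.adj 0) :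
    EliminatesIn Q.adj 2 ∧ ¬ EliminatesIn Q.adj 1 := by
  obtain ⟨E, hE1, hE2, hE3⟩ := h.exists_adj h₁.2 h₂.2
  have hE4 : ∀ p q, Q.adj (E (.inr q)) (E (.inl p)) = 0 := fun p q => by rw [adj_comm, hE3]
  have n1 := h₁.2
  have n2 := h₂.2
  rw [eliminatesIn_zero_iff] at n1 n2
  constructor
  · obtain ⟨v, hv⟩ := h₁.1.exists_of_one.resolve_left n1
    obtain ⟨w, hw⟩ := h₂.1.exists_of_one.resolve_left n2
    refine eliminatesIn_two (v := E (.inl v)) (w := E (.inr w)) (by simp) fun x y => ?_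
    obtain ⟨p | p, rfl⟩ := E.surjective x <;> obtain ⟨q | q, rfl⟩ := E.surjective y <;>
      intro k1 k2 k3 k4 k5 <;> simp only [hE1, hE2, hE3, hE4] <;>
      simp only [ne_eq, E.injective.eq_iff, Sum.inl.injEq, Sum.inr.injEq] at k1 k2 k3 k4 k5
    · rw [hv p q k1 k2 k5]; ring_nf; exact (by decide : ∀ a b : ZMod 2, a * b * 2 = 0) _ _
    · ring
    · ring
    · rw [hw p q k3 k4 k5]; ring_nf; exact (by decide : ∀ a b : ZMod 2, a * b * 2 = 0) _ _
  · intro h1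
    push Not at n1 n2
    obtain ⟨p, q, hpq⟩ := n1
    obtain ⟨r, s, hrs⟩ := n2
    have hpq' : p ≠ q := by rintro rfl; exact hpq (adj_self p)
    have hrs' : r ≠ s := by rintro rfl; exact hrs (adj_self r)
    rcases h1.exists_of_one with h1 | ⟨v, hv⟩
    · exact hpq (by rw [← hE1, h1])
    · obtain ⟨v | v, rfl⟩ := E.surjective v
      · have := hv (E (.inr r)) (E (.inr s)) (by simp) (by simp) (by simpa using hrs')
        rw [hE2, hE4, zero_mul] at this
        exact hrs this
      · have := hv (E (.inl p)) (E (.inl q)) (by simp) (by simp) (by simpa using hpq')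
        rw [hE1, hE3, zero_mul] at this
        exact hpq this

/-! ### Projections without 1-gons, and what the removal of a kink does to arcs and regions. -/

variable {R : KnotProjection}

/-- No region is a 1-gon. -/
def NoOneGon (P : KnotProjection) : Prop := ∀ z, P.edge z ≠ P.rot z

/-- Such an arc would close up after passing the double point straight, and the other branch there
would not belong to the curve. -/
theorem edge_ne_rot_two (x : P.Dart) : P.edge x ≠ P.rot (P.rot x) := by
  intro h
  have h' : P.edge (P.rot (P.rot x)) = x := by rw [← h, edge_edge]
  have := closed_univ (S := {y | y = x ∨ y = P.rot (P.rot x)}) (x := x)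
    (by rintro y (rfl | rfl) <;> simp [h, h']) (by rintro y (rfl | rfl) <;> simp)
    (Or.inl rfl) (P.rot x)
  rcases this with h1 | h1
  · exact rot_ne x h1
  · exact rot_ne x (P.rot.injective h1.symm)

theorem NoOneGon.edge_notMem (h : P.NoOneGon) {d x : P.Dart} (hx : x ∈ P.dartsAt d) :
    P.edge x ∉ P.dartsAt d := by
  rw [← dartsAt_eq_of_mem hx]
  rintro (h1 | h1 | h1 | h1)
  · exact P.edge_ne x h1
  · exact h x h1
  · exact edge_ne_rot_two x h1
  · exact h (P.rot (P.rot (P.rot x))) (by rw [rot_four, ← h1, edge_edge])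

section kink

variable {z : P.Dart}

theorem smooth_rot_self (z : P.Dart) : P.smooth (P.rot z) z = P.rot (P.rot (P.rot z)) := by
  have := smooth_three (P.rot z)
  simp only [rot_four] at this
  exact this

theorem dartsAt_rot (z : P.Dart) : P.dartsAt (P.rot z) = P.dartsAt z :=
  dartsAt_eq_of_mem (rot_mem_dartsAt.2 (self_mem_dartsAt z))

/-- The new arc passes the spliced double point twice, before and after it runs along the side of
the 1-gon. -/
theorem kink_spliceEdge_two (hz : P.edge z = P.rot z) {x : P.Dart} (h : P.edge x = P.rot (P.rot z)) :
    P.spliceEdge (P.rot z) x = P.edge (P.rot (P.rot (P.rot z))) := by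
  have hz' : P.edge (P.rot z) = z := by rw [← hz, edge_edge]
  have h1 : P.smooth (P.rot z) (P.rot (P.rot z)) = P.rot z := smooth_one _
  rw [spliceEdge_of_mem_mem, h, h1, hz', smooth_rot_self z]
  · rw [h]; simp [mem_dartsAt]
  · rw [h, h1, hz']; simp [mem_dartsAt]

theorem kink_spliceEdge_three (hz : P.edge z = P.rot z) {x : P.Dart} (h : P.edge x = P.rot (P.rot (P.rot z))) :
    P.spliceEdge (P.rot z) x = P.edge (P.rot (P.rot z)) := by
  have h1 : P.smooth (P.rot z) (P.rot (P.rot (P.rot z))) = z := by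
    have := smooth_two (P.rot z)
    simp only [rot_four] at this
    exact this
  have h2 : P.smooth (P.rot z) (P.rot z) = P.rot (P.rot z) := smooth_zero _
  rw [spliceEdge_of_mem_mem, h, h1, hz, h2]
  · rw [h]; simp [mem_dartsAt]
  · rw [h, h1, hz]; simp [mem_dartsAt]

/-- Unlike in `isFirstReturn_splice`, no transposition occurs: the other regions lose only corners
at the kink, and the 1-gon is bounded by `rot z` alone, which is a dart of the kink. -/
theorem isFirstReturn_kink (hz : P.edge z = P.rot z) {f : Q.Dart → P.Dart} (hf : P.SpliceMap (P.rot z) Q f) :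
    IsFirstReturn f Q.face P.face := by
  have hz' : P.edge (P.rot z) = z := by rw [← hz, edge_edge]
  have hnr : ∀ y ∈ P.dartsAt z, y ∉ Set.range f := by
    intro y hy
    rw [hf.range, dartsAt_rot z]
    simpa
  intro x
  have hx := hf.notMem x
  rw [dartsAt_rot z] at hx
  rw [face_apply, hf.rot, hf.edge]
  by_cases h : P.edge (f x) ∈ P.dartsAt z
  · rcases h with h | h | h | h
    · rw [edge_eq_iff, hz] at h
      exact absurd (by simp [h, mem_dartsAt]) hx
    · rw [edge_eq_iff, hz'] at h
      exact absurd (by simp [h, mem_dartsAt]) hx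
    · rw [kink_spliceEdge_two hz h]
      refine ⟨1, ?_, fun i h0 h2 => ?_⟩
      · simp only [pow_succ', Perm.mul_apply, pow_zero, Perm.one_apply, face_apply, h]
      · interval_cases i
        simp only [pow_one, face_apply, h]
        exact hnr _ (by simp [mem_dartsAt])
    · rw [kink_spliceEdge_three hz h]
      refine ⟨2, ?_, fun i h0 h2 => ?_⟩
      · simp only [pow_succ', Perm.mul_apply, pow_zero, Perm.one_apply, face_apply, h, rot_four, hz]
      · interval_cases i
        · simp only [pow_one, face_apply, h, rot_four]
          exact hnr _ (by simp [mem_dartsAt])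
        · simp only [pow_succ', Perm.mul_apply, pow_zero, Perm.one_apply, face_apply, h, rot_four, hz]
          exact hnr _ (by simp [mem_dartsAt])
  · rw [spliceEdge_of_notMem (by rwa [dartsAt_rot z])]
    exact ⟨0, by simp [face_apply], fun i h0 h2 => by omega⟩

end kink

/-! ### Twists in a projection -/

/-- `P` consists of a twist `t` of `k` double points and of the double points of `Q`; the arcs
of `P` with no end at the twist are arcs of `Q`. -/
structure TwistMap (P Q : KnotProjection) (f : Q.Dart → P.Dart) (k : ℕ) (t : ℕ → P.Dart) :
    Prop where
  inj : Function.Injective f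
  rot : ∀ x, f (Q.rot x) = P.rot (f x)
  twist : P.IsTwist k t
  cover : ∀ y, y ∈ Set.range f ∨ ∃ i < k, y ∈ P.dartsAt (t i)
  disjoint : ∀ x, ∀ i < k, f x ∉ P.dartsAt (t i)
  edge : ∀ x y, P.edge (f x) = f y → Q.edge x = y

/-- The four ends of the twist are joined to darts of `Q`. In `Q` the two upper ends and the two
lower ones are joined, and the resulting two arcs are on the boundary of one region. -/
structure OpenTwist (P Q : KnotProjection) (f : Q.Dart → P.Dart) (k : ℕ) (t : ℕ → P.Dart)
    (u₁ u₂ u₃ u₄ : Q.Dart) : Prop extends TwistMap P Q f (k + 1) t where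
  nw : P.edge (P.rot (t 0)) = f u₁
  ne : P.edge (t 0) = f u₂
  sw : P.edge (P.rot (P.rot (t k))) = f u₃
  se : P.edge (P.rot (P.rot (P.rot (t k)))) = f u₄
  top : Q.edge u₁ = u₂
  bottom : Q.edge u₃ = u₄
  face : Q.face.SameCycle u₁ u₄

/-- The left ends of the twist are joined. -/
structure ClosedLeft (P Q : KnotProjection) (f : Q.Dart → P.Dart) (k : ℕ) (t : ℕ → P.Dart)
    (x y : Q.Dart) : Prop extends TwistMap P Q f (k + 1) t where
  left : P.edge (P.rot (t 0)) = P.rot (P.rot (t k))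
  ne : P.edge (t 0) = f x
  se : P.edge (P.rot (P.rot (P.rot (t k)))) = f y
  right : Q.edge x = y

/-- `P` is a closed twist. -/
structure ClosedTwist (P : KnotProjection) (k : ℕ) (t : ℕ → P.Dart) : Prop where
  twist : P.IsTwist (k + 1) t
  cover : ∀ y, ∃ i < k + 1, y ∈ P.dartsAt (t i)
  left : P.edge (P.rot (t 0)) = P.rot (P.rot (t k))
  right : P.edge (t 0) = P.rot (P.rot (P.rot (t k)))

theorem IsTwist.flip {k : ℕ} {t : ℕ → P.Dart} (h : P.IsTwist (k + 1) t) :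
    P.IsTwist (k + 1) fun i => P.rot (P.rot (t (k - i))) := by
  refine ⟨fun i hi => ?_, fun i hi => ?_, fun i j hi hj hij => ?_⟩
  · have := h.right (k - (i + 1)) (by omega)
    rw [edge_eq_iff, show k - (i + 1) + 1 = k - i by omega] at this
    rw [rot_four, this]
  · have := h.left (k - (i + 1)) (by omega)
    rw [edge_eq_iff, show k - (i + 1) + 1 = k - i by omega] at this
    rw [rot_four, this]
  · rw [rot_mem_dartsAt, rot_mem_dartsAt, mem_dartsAt_comm, rot_mem_dartsAt, rot_mem_dartsAt] at hij
    have := h.distinct _ _ (by omega) (by omega) hij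
    omega

theorem mem_dartsAt_rot_two {x y : P.Dart} :
    x ∈ P.dartsAt (P.rot (P.rot y)) ↔ x ∈ P.dartsAt y := by
  rw [mem_dartsAt_comm, rot_mem_dartsAt, rot_mem_dartsAt, mem_dartsAt_comm]

theorem TwistMap.flip {f : Q.Dart → P.Dart} {k : ℕ} {t : ℕ → P.Dart}
    (h : P.TwistMap Q f (k + 1) t) :
    P.TwistMap Q f (k + 1) fun i => P.rot (P.rot (t (k - i))) := by
  refine ⟨h.inj, h.rot, h.twist.flip, fun y => ?_, fun x i hi => ?_, h.edge⟩
  · rcases h.cover y with h1 | ⟨i, hi, h1⟩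
    · exact Or.inl h1
    · refine Or.inr ⟨k - i, by omega, ?_⟩
      rw [mem_dartsAt_rot_two, show k - (k - i) = i by omega]
      exact h1
  · rw [mem_dartsAt_rot_two]
    exact h.disjoint x _ (by omega)

/-- All other darts of the twist are joined to each other within the twist. -/
theorem TwistMap.edge_eq_of_notMem_range {f : Q.Dart → P.Dart} {k : ℕ} {t : ℕ → P.Dart}
    (h : P.TwistMap Q f (k + 1) t) {x : Q.Dart} (hx : P.edge (f x) ∉ Set.range f) :
    P.edge (f x) = t 0 ∨ P.edge (f x) = P.rot (t 0) ∨ P.edge (f x) = P.rot (P.rot (t k)) ∨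
      P.edge (f x) = P.rot (P.rot (P.rot (t k))) := by
  obtain ⟨i, hi, hm⟩ := (h.cover (P.edge (f x))).resolve_left hx
  have hno : ∀ {y w j}, P.edge (f x) = y → P.edge w = y → j < k + 1 → w ∉ P.dartsAt (t j) := by
    intro y w j h1 h2 hj
    rw [← h2, edge_inj] at h1
    rw [← h1]
    exact h.disjoint x j hj
  have m2 : ∀ j, P.rot (P.rot (t j)) ∈ P.dartsAt (t j) := fun j => by simp [mem_dartsAt]
  have m3 : ∀ j, P.rot (P.rot (P.rot (t j))) ∈ P.dartsAt (t j) := fun j => by simp [mem_dartsAt]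
  have m0 : ∀ j, t j ∈ P.dartsAt (t j) := fun j => by simp [mem_dartsAt]
  have m1 : ∀ j, P.rot (t j) ∈ P.dartsAt (t j) := fun j => by simp [mem_dartsAt]
  rcases hm with hm | hm | hm | hm
  · rcases Nat.eq_zero_or_pos i with rfl | hpos
    · exact Or.inl hm
    · obtain ⟨j, rfl⟩ : ∃ j, i = j + 1 := ⟨i - 1, by omega⟩
      exact absurd (m3 j) (hno hm (h.twist.right j hi) (by omega))
  · rcases Nat.eq_zero_or_pos i with rfl | hpos
    · exact Or.inr (Or.inl hm)
    · obtain ⟨j, rfl⟩ : ∃ j, i = j + 1 := ⟨i - 1, by omega⟩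
      exact absurd (m2 j) (hno hm (h.twist.left j hi) (by omega))
  · rcases Nat.lt_or_ge i k with hlt | hge
    · have := h.twist.left i (by omega)
      rw [edge_eq_iff] at this
      exact absurd (m1 (i + 1)) (hno hm this.symm (by omega))
    · obtain rfl : i = k := by omega
      exact Or.inr (Or.inr (Or.inl hm))
  · rcases Nat.lt_or_ge i k with hlt | hge
    · have := h.twist.right i (by omega)
      rw [edge_eq_iff] at this
      exact absurd (m0 (i + 1)) (hno hm this.symm (by omega))
    · obtain rfl : i = k := by omega
      exact Or.inr (Or.inr (Or.inr hm))

theorem ClosedLeft.edge_eq {f : Q.Dart → P.Dart} {k : ℕ} {t : ℕ → P.Dart} {x y : Q.Dart}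
    (h : P.ClosedLeft Q f k t x y) {z : Q.Dart} (hx : z ≠ x) (hy : z ≠ y) :
    P.edge (f z) = f (Q.edge z) := by
  by_cases hz : P.edge (f z) ∈ Set.range f
  · obtain ⟨w, hw⟩ := hz
    rw [h.edge z w hw.symm, hw]
  · have hl := h.left
    rcases h.toTwistMap.edge_eq_of_notMem_range hz with hm | hm | hm | hm <;>
      rw [edge_eq_iff] at hm
    · exact absurd (h.inj (hm.trans h.ne)) hx
    · refine absurd ?_ (h.disjoint z k (by omega))
      rw [hm, hl]
      simp [mem_dartsAt]
    · refine absurd ?_ (h.disjoint z 0 (by omega))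
      rw [hm, ← hl, edge_edge]
      simp [mem_dartsAt]
    · exact absurd (h.inj (hm.trans h.se)) hy

namespace OpenTwist

variable {f : Q.Dart → P.Dart} {k : ℕ} {t : ℕ → P.Dart} {u₁ u₂ u₃ u₄ : Q.Dart}

theorem flip (h : P.OpenTwist Q f k t u₁ u₂ u₃ u₄) :
    P.OpenTwist Q f k (fun i => P.rot (P.rot (t (k - i)))) u₄ u₃ u₂ u₁ where
  toTwistMap := h.toTwistMap.flip
  nw := by simpa using h.se
  ne := by simpa using h.sw
  sw := by simpa using h.ne
  se := by simpa using h.nw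
  top := by rw [← h.bottom, edge_edge]
  bottom := by rw [← h.top, edge_edge]
  face := h.face.symm

theorem eq_of_notMem_range (h : P.OpenTwist Q f k t u₁ u₂ u₃ u₄) {x : Q.Dart}
    (hx : P.edge (f x) ∉ Set.range f) : x = u₁ ∨ x = u₂ ∨ x = u₃ ∨ x = u₄ := by
  have hu : ∀ {y u}, P.edge (f x) = y → P.edge y = f u → x = u := fun h1 h2 => by
    rw [← h1, edge_edge] at h2
    exact h.inj h2
  rcases h.toTwistMap.edge_eq_of_notMem_range hx with hm | hm | hm | hm
  · exact Or.inr (Or.inl (hu hm h.ne))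
  · exact Or.inl (hu hm h.nw)
  · exact Or.inr (Or.inr (Or.inl (hu hm h.sw)))
  · exact Or.inr (Or.inr (Or.inr (hu hm h.se)))

theorem edge_eq (h : P.OpenTwist Q f k t u₁ u₂ u₃ u₄) {x : Q.Dart} (h1 : x ≠ u₁) (h2 : x ≠ u₂)
    (h3 : x ≠ u₃) (h4 : x ≠ u₄) : P.edge (f x) = f (Q.edge x) := by
  by_cases hx : P.edge (f x) ∈ Set.range f
  · obtain ⟨y, hy⟩ := hx
    rw [h.edge x y hy.symm, hy]
  · rcases h.eq_of_notMem_range hx with h5 | h5 | h5 | h5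
    · exact absurd h5 h1
    · exact absurd h5 h2
    · exact absurd h5 h3
    · exact absurd h5 h4

theorem ne_one_four (h : P.OpenTwist Q f k t u₁ u₂ u₃ u₄) : u₁ ≠ u₄ := by
  intro hu
  have := h.nw.trans ((congrArg f hu).trans h.se.symm)
  rw [edge_inj, rot_inj] at this
  have h0 := h.twist.distinct 0 k (by omega) (by omega) (by simp [this, mem_dartsAt])
  subst h0
  exact P.rot_two_ne _ this.symm

theorem ne_one_three (h : P.OpenTwist Q f k t u₁ u₂ u₃ u₄) : u₁ ≠ u₃ := by
  intro hu
  have := h.nw.trans ((congrArg f hu).trans h.sw.symm)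
  rw [edge_inj, rot_inj] at this
  have h0 := h.twist.distinct 0 k (by omega) (by omega) (by simp [this, mem_dartsAt])
  subst h0
  exact rot_ne _ this.symm

theorem ne_two_three (h : P.OpenTwist Q f k t u₁ u₂ u₃ u₄) : u₂ ≠ u₃ := fun hu =>
  h.ne_one_four (by rw [← edge_inj, h.top, hu, ← h.bottom, edge_edge])

theorem ne_two_four (h : P.OpenTwist Q f k t u₁ u₂ u₃ u₄) : u₂ ≠ u₄ := fun hu =>
  h.ne_one_three (by rw [← edge_inj, h.top, hu, ← h.bottom])

/-- If the upper arc of `Q` bounds a 1-gon, the twist becomes longer. -/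
theorem extend (h : P.OpenTwist Q f k t u₁ u₂ u₃ u₄) (hz : Q.edge u₁ = Q.rot u₁)
    {g : R.Dart → Q.Dart} (hg : Q.SpliceMap (Q.rot u₁) R g) :
    (∃ k t u₁ u₂ u₃ u₄, P.OpenTwist R (f ∘ g) k t u₁ u₂ u₃ u₄) ∨
      (∃ k t x y, P.ClosedLeft R (f ∘ g) k t x y) ∨ ∃ k t, P.ClosedTwist k t := by
  have h13 := h.ne_one_three
  have h14 := h.ne_one_four
  have h23 := h.ne_two_three
  have h24 := h.ne_two_four
  have hu₂ : u₂ = Q.rot u₁ := by rw [← h.top, hz]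
  have hD := dartsAt_rot u₁
  set n₃ := Q.rot (Q.rot u₁) with hn₃
  set n₄ := Q.rot n₃ with hn₄
  have hrn₄ : Q.rot n₄ = u₁ := Q.rot_four u₁
  have h₃1 : n₃ ≠ u₁ := Q.rot_two_ne u₁
  have h₃2 : n₃ ≠ u₂ := by rw [hu₂]; exact rot_ne _
  have h₄1 : n₄ ≠ u₁ := rot_three_ne u₁
  have h₄2 : n₄ ≠ u₂ := by rw [hu₂, hn₄, hn₃]; exact Q.rot_two_ne _
  have h₄3 : n₄ ≠ n₃ := rot_ne _
  have memD : ∀ x, x ∈ Q.dartsAt (Q.rot u₁) ↔ x = u₁ ∨ x = u₂ ∨ x = n₃ ∨ x = n₄ := by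
    intro x
    rw [hD, hu₂]; rfl
  have exists_of : ∀ x, x ≠ u₁ → x ≠ u₂ → x ≠ n₃ → x ≠ n₄ → ∃ y, g y = x := by
    intro x h1 h2 h3 h4
    exact hg.exists_eq (by rw [memD]; simp [h1, h2, h3, h4])
  -- The corner of the 1-gon becomes the new top of the twist. The arcs of `u₁` and `u₂` lead down
  -- to the old top, so these darts are its lower corners, and `n₃`, opposite to `u₁`, is the upper
  -- right one.
  let s : ℕ → P.Dart := fun i => Nat.casesOn i (f n₃) t
  have hs0 : s 0 = f n₃ := rfl
  have hs1 : ∀ i, s (i + 1) = t i := fun i => rfl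
  have hrs : P.rot (s 0) = f n₄ := by rw [hs0, ← h.rot]
  have hrrs : P.rot (P.rot (s 0)) = f u₁ := by rw [hrs, ← h.rot, hrn₄]
  have hrrrs : P.rot (P.rot (P.rot (s 0))) = f u₂ := by rw [hrrs, ← h.rot, hu₂]
  have hnw : P.edge (f u₁) = P.rot (t 0) := by rw [← h.nw, edge_edge]
  have hne : P.edge (f u₂) = t 0 := by rw [← h.ne, edge_edge]
  have hsw : P.edge (f u₃) = P.rot (P.rot (t k)) := by rw [← h.sw, edge_edge]
  have hse : P.edge (f u₄) = P.rot (P.rot (P.rot (t k))) := by rw [← h.se, edge_edge]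
  have htw : P.IsTwist (k + 2) s := by
    refine ⟨fun i hi => ?_, fun i hi => ?_, fun i j hi hj hij => ?_⟩
    · rcases i with _ | i
      · rw [hrrs, hnw, hs1]
      · exact h.twist.left i (by omega)
    · rcases i with _ | i
      · rw [hrrrs, hne, hs1]
      · exact h.twist.right i (by omega)
    · rcases i with _ | i <;> rcases j with _ | j
      · rfl
      · exact absurd hij (h.disjoint _ _ (by omega))
      · exact absurd (mem_dartsAt_comm.1 hij) (h.disjoint _ _ (by omega))
      · rw [h.twist.distinct i j (by omega) (by omega) hij]
  have hmap : P.TwistMap R (f ∘ g) (k + 2) s := by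
    refine ⟨h.inj.comp hg.inj, fun x => ?_, htw, fun y => ?_, fun x i hi => ?_, fun x y hxy => ?_⟩
    · simp only [Function.comp_apply, hg.rot, h.rot]
    · rcases h.cover y with ⟨x, rfl⟩ | ⟨i, hi, hy⟩
      · by_cases hx : x ∈ Q.dartsAt (Q.rot u₁)
        · refine Or.inr ⟨0, by omega, ?_⟩
          rw [mem_dartsAt, hs0, ← h.rot, ← h.rot, ← h.rot, hrn₄, ← hn₄, h.inj.eq_iff, h.inj.eq_iff,
            h.inj.eq_iff, h.inj.eq_iff, ← hu₂]
          have := (memD x).1 hx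
          tauto
        · obtain ⟨w, rfl⟩ := hg.exists_eq hx
          exact Or.inl ⟨w, rfl⟩
      · exact Or.inr ⟨i + 1, by omega, hy⟩
    · rcases i with _ | i
      · have h1 := hg.notMem x
        rw [memD] at h1
        rw [mem_dartsAt, hs0, ← h.rot, ← h.rot, ← h.rot, hrn₄, ← hn₄, Function.comp_apply,
          h.inj.eq_iff, h.inj.eq_iff, h.inj.eq_iff, h.inj.eq_iff, ← hu₂]
        tauto
      · exact h.disjoint _ i (by omega)
    · have h1 := h.edge _ _ hxy
      apply hg.inj
      rw [hg.edge, spliceEdge_of_notMem, h1]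
      rw [h1]
      exact hg.notMem y
  have hu₁n₃ : Q.face.SameCycle u₁ n₃ := by
    have := sameCycle_apply_self Q.face u₁
    rwa [face_apply, hz, ← hn₃] at this
  have hn₃n₄ : Q.face.SameCycle (Q.edge n₃) n₄ := by
    have := sameCycle_apply_self Q.face (Q.edge n₃)
    rwa [face_apply, edge_edge, ← hn₄] at this
  -- The ends of the twist cannot be joined crosswise: since `u₁` and `u₄` border one region, the
  -- arc of `n₃` would have the same region on both sides.
  have c44 : n₄ ≠ u₄ := fun hc => by
    apply not_sameCycle_face_edge n₃
    have := h.face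
    rw [← hc] at this
    exact hu₁n₃.symm.trans (this.trans hn₃n₄.symm)
  have c33 : n₃ ≠ u₃ := fun hc => by
    apply not_sameCycle_face_edge n₃
    have h1 := h.bottom
    rw [← hc] at h1
    rw [h1]
    exact hu₁n₃.symm.trans h.face
  have edge_ne_u : ∀ x, x ≠ u₁ → x ≠ u₂ → Q.edge x ≠ u₁ ∧ Q.edge x ≠ u₂ := by
    intro x h1 h2
    rw [Ne, Ne, edge_eq_iff, edge_eq_iff, h.top, ← h.top, edge_edge, h.top]
    exact ⟨h2, h1⟩
  have hall : Q.edge n₄ = n₃ → ∀ x, x = u₁ ∨ x = u₂ ∨ x = n₃ ∨ x = n₄ := by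
    intro h1 x
    rw [← memD]
    refine closed_univ (S := Q.dartsAt (Q.rot u₁)) ?_ ?_ (self_mem_dartsAt _) x
    · intro y hy
      rw [memD] at hy ⊢
      have h2 : Q.edge n₃ = n₄ := by rw [← h1, edge_edge]
      have h3 : Q.edge u₂ = u₁ := by rw [← h.top, edge_edge]
      rcases hy with rfl | rfl | rfl | rfl
      · exact Or.inr (Or.inl h.top)
      · exact Or.inl h3
      · exact Or.inr (Or.inr (Or.inr h2))
      · exact Or.inr (Or.inr (Or.inl h1))
    · intro y hy
      rwa [rot_mem_dartsAt, rot_mem_dartsAt]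
  -- The two equalities say that the left ends, respectively the right ends, of the lengthened twist
  -- are joined to each other.
  by_cases c43 : n₄ = u₃ <;> by_cases c34 : n₃ = u₄
  · refine Or.inr (Or.inr ⟨k + 1, s, htw, fun y => ?_, ?_, ?_⟩)
    · have hb : Q.edge n₄ = n₃ := by rw [c43, c34, h.bottom]
      rcases hmap.cover y with ⟨x, rfl⟩ | hy
      · exact absurd ((memD _).2 (hall hb (g x))) (hg.notMem x)
      · exact hy
    · rw [hrs, c43, hsw, hs1]
    · rw [hs0, c34, hse, hs1]
  · have hb : Q.edge n₄ = u₄ := by rw [c43, h.bottom]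
    have hm := edge_ne_u n₃ h₃1 h₃2
    have hm4 : Q.edge n₃ ≠ n₄ := by
      rw [Ne, edge_eq_iff, hb]; exact c34
    obtain ⟨x, hx⟩ := exists_of (Q.edge n₃) hm.1 hm.2 (Q.edge_ne _) hm4
    obtain ⟨y, hy⟩ := exists_of u₄ h14.symm h24.symm (Ne.symm c34) (Ne.symm c44)
    refine Or.inr (Or.inl ⟨k + 1, s, x, y, hmap, ?_, ?_, ?_, ?_⟩)
    · rw [hrs, c43, hsw, hs1]
    · rw [hs0, h.edge_eq h₃1 h₃2 c33 c34, Function.comp_apply, hx]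
    · rw [hs1, h.se, Function.comp_apply, hy]
    · apply hg.inj
      rw [hg.edge, hx, hy, kink_spliceEdge_two hz (by rw [edge_edge])]
      exact hb
  · have hb : Q.edge u₃ = n₃ := by rw [c34, h.bottom]
    have hm := edge_ne_u n₄ h₄1 h₄2
    have hm3 : Q.edge n₄ ≠ n₃ := by
      rw [Ne, edge_eq_iff, ← hb, edge_edge]; exact c43
    obtain ⟨x, hx⟩ := exists_of u₃ h13.symm h23.symm (Ne.symm c33) (Ne.symm c43)
    obtain ⟨y, hy⟩ := exists_of (Q.edge n₄) hm.1 hm.2 hm3 (Q.edge_ne _)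
    -- Here the right ends are joined; a half turn of the twist moves them to the left.
    refine Or.inr (Or.inl ⟨k + 1, _, x, y, hmap.flip, ?_, ?_, ?_, ?_⟩)
    · simp only [Nat.sub_zero, Nat.sub_self, rot_four, hs1]
      rw [← hse, edge_edge, ← c34, hs0]
    · simp only [Nat.sub_zero, hs1]
      rw [h.sw, Function.comp_apply, hx]
    · simp only [Nat.sub_self, rot_four]
      rw [hrs, h.edge_eq h₄1 h₄2 c43 c44, Function.comp_apply, hy]
    · apply hg.inj
      rw [hg.edge, hx, hy, kink_spliceEdge_two hz (by rw [hb])]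
  · have h43 : Q.edge n₄ ≠ n₃ := by
      intro h1
      rcases hall h1 u₃ with h2 | h2 | h2 | h2
      · exact h13 h2.symm
      · exact h23 h2.symm
      · exact c33 h2.symm
      · exact c43 h2.symm
    have hm := edge_ne_u n₃ h₃1 h₃2
    have hm' := edge_ne_u n₄ h₄1 h₄2
    have hm4 : Q.edge n₃ ≠ n₄ := by
      rw [Ne, edge_eq_iff]; exact h43.symm
    obtain ⟨v₁, hv₁⟩ := exists_of (Q.edge n₄) hm'.1 hm'.2 h43 (Q.edge_ne _)
    obtain ⟨v₂, hv₂⟩ := exists_of (Q.edge n₃) hm.1 hm.2 (Q.edge_ne _) hm4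
    obtain ⟨v₃, hv₃⟩ := exists_of u₃ h13.symm h23.symm (Ne.symm c33) (Ne.symm c43)
    obtain ⟨v₄, hv₄⟩ := exists_of u₄ h14.symm h24.symm (Ne.symm c34) (Ne.symm c44)
    refine Or.inl ⟨k + 1, s, v₁, v₂, v₃, v₄, hmap, ?_, ?_, ?_, ?_, ?_, ?_, ?_⟩
    · rw [hrs, h.edge_eq h₄1 h₄2 c43 c44, Function.comp_apply, hv₁]
    · rw [hs0, h.edge_eq h₃1 h₃2 c33 c34, Function.comp_apply, hv₂]
    · rw [hs1, h.sw, Function.comp_apply, hv₃]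
    · rw [hs1, h.se, Function.comp_apply, hv₄]
    · apply hg.inj
      rw [hg.edge, hv₁, hv₂, kink_spliceEdge_three hz (by rw [edge_edge])]
    · apply hg.inj
      rw [hg.edge, hv₃, hv₄, spliceEdge_of_notMem, h.bottom]
      rw [h.bottom, ← hv₄]
      exact hg.notMem v₄
    · rw [(isFirstReturn_kink hz hg).sameCycle_iff hg.inj, hv₁, hv₄]
      have := sameCycle_apply_self Q.face (Q.edge n₄)
      rw [face_apply, edge_edge, hrn₄] at this
      exact this.trans h.face

end OpenTwist

/-- The double point of a splice of type `S⁻` is a twist of length one. -/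
theorem SMinus.exists_openTwist (h : P.SMinus Q) (hP : P.NoOneGon) :
    ∃ f k t u₁ u₂ u₃ u₄, P.OpenTwist Q f k t u₁ u₂ u₃ u₄ := by
  classical
  obtain ⟨d, hd, -, hs⟩ := h
  obtain ⟨f, hf⟩ := isSplice_iff.1 hs
  have m0 := self_mem_dartsAt d
  have m1 := rot_mem_dartsAt.2 m0
  have m2 := rot_mem_dartsAt.2 m1
  have m3 := rot_mem_dartsAt.2 m2
  obtain ⟨u₁, h1⟩ := hf.exists_eq (hP.edge_notMem m1)
  obtain ⟨u₂, h2⟩ := hf.exists_eq (hP.edge_notMem m0)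
  obtain ⟨u₃, h3⟩ := hf.exists_eq (hP.edge_notMem m2)
  obtain ⟨u₄, h4⟩ := hf.exists_eq (hP.edge_notMem m3)
  have e1 : P.edge (f u₁) = P.rot d := by rw [h1, edge_edge]
  have e3 : P.edge (f u₃) = P.rot (P.rot d) := by rw [h3, edge_edge]
  have e4 : P.edge (f u₄) = P.rot (P.rot (P.rot d)) := by rw [h4, edge_edge]
  refine ⟨f, 0, fun _ => d, u₁, u₂, u₃, u₄, ⟨hf.inj, hf.rot, ⟨fun i hi => by omega,
    fun i hi => by omega, fun i j hi hj _ => by omega⟩, fun y => ?_, fun x i _ => hf.notMem x,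
    fun x y hxy => ?_⟩, h1.symm, h2.symm, h3.symm, h4.symm, ?_, ?_, ?_⟩
  · by_cases hy : y ∈ P.dartsAt d
    · exact Or.inr ⟨0, by omega, hy⟩
    · exact Or.inl (hf.exists_eq hy)
  · apply hf.inj
    rw [hf.edge, spliceEdge_of_notMem, hxy]
    rw [hxy]
    exact hf.notMem y
  · apply hf.inj
    rw [hf.edge, spliceEdge_of_mem, e1, smooth_one, h2]
    · rw [e1]; exact m1
    · rw [e1, smooth_one]; exact hP.edge_notMem m0
  · apply hf.inj
    rw [hf.edge, spliceEdge_of_mem, e3, smooth_two, h4]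
    · rw [e3]; exact m2
    · rw [e3, smooth_two]; exact hP.edge_notMem m3
  · have hfr := isFirstReturn_splice (r := Q.rot) (e := Q.edge) hf.range hf.rot hf.edge
    rw [face, hfr.sameCycle_iff hf.inj]
    have key := sameCycle_swap_mul hd.not_sameCycle_face
    have s1 := sameCycle_apply_self (swap d (P.rot (P.rot d)) * P.face) (f u₁)
    have s4 := sameCycle_apply_self (swap d (P.rot (P.rot d)) * P.face) (f u₄)
    have a1 : (swap d (P.rot (P.rot d)) * P.face) (f u₁) = d := by
      change (swap d (P.rot (P.rot d)) * P.rot) (P.edge (f u₁)) = d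
      rw [e1, swap_mul_rot_of_mem m1, smooth_one]
    have a4 : (swap d (P.rot (P.rot d)) * P.face) (f u₄) = P.rot (P.rot d) := by
      change (swap d (P.rot (P.rot d)) * P.rot) (P.edge (f u₄)) = _
      rw [e4, swap_mul_rot_of_mem m3, smooth_three]
    rw [a1] at s1
    rw [a4] at s4
    exact s1.trans (key.trans s4.symm)

/-- Kinks of `Q` are removed as long as the twist has four free ends. -/
theorem OpenTwist.reduce (hP : P.NoOneGon) (hQR : Relation.ReflTransGen RIMinus Q R)
    {f : Q.Dart → P.Dart} {k : ℕ} {t : ℕ → P.Dart} {u₁ u₂ u₃ u₄ : Q.Dart}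
    (h : P.OpenTwist Q f k t u₁ u₂ u₃ u₄) :
    (∃ f k t u₁ u₂ u₃ u₄, P.OpenTwist R f k t u₁ u₂ u₃ u₄) ∨
      (∃ Q' f k t x y, P.ClosedLeft Q' f k t x y ∧ Relation.ReflTransGen RIMinus Q' R) ∨
      ∃ k t, P.ClosedTwist k t := by
  induction hQR using Relation.ReflTransGen.head_induction_on generalizing k t with
  | refl => exact Or.inl ⟨f, k, t, u₁, u₂, u₃, u₄, h⟩
  | head hQ' hR ih =>
    rename_i Q Q'
    obtain ⟨z, hz, hs⟩ := riMinus_iff.1 hQ'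
    obtain ⟨g, hg⟩ := isSplice_iff.1 hs
    have main : ∀ {t : ℕ → P.Dart} {u₁ u₂ u₃ u₄}, P.OpenTwist Q f k t u₁ u₂ u₃ u₄ → z = u₁ →
        (∃ f k t u₁ u₂ u₃ u₄, P.OpenTwist R f k t u₁ u₂ u₃ u₄) ∨
        (∃ Q' f k t x y, P.ClosedLeft Q' f k t x y ∧ Relation.ReflTransGen RIMinus Q' R) ∨
        ∃ k t, P.ClosedTwist k t := by
      rintro t u₁ u₂ u₃ u₄ h rfl
      rcases h.extend hz hg with ⟨k, t, u₁, u₂, u₃, u₄, h'⟩ | ⟨k, t, x, y, h'⟩ | h'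
      · exact ih h'
      · exact Or.inr (Or.inl ⟨Q', _, k, t, x, y, h', hR⟩)
      · exact Or.inr (Or.inr h')
    -- A 1-gon of `Q` whose side is also an arc of `P` would be a 1-gon of `P`; so its side is one
    -- of the two arcs on which the twist is put.
    have hnot : P.edge (f z) ∉ Set.range f := by
      rintro ⟨y, hy⟩
      have := h.edge _ _ hy.symm
      rw [hz] at this
      exact hP (f z) (by rw [← hy, ← this, h.rot])
    rcases h.eq_of_notMem_range hnot with h1 | h1 | h1 | h1
    · exact main h h1
    · exfalso
      -- With the 1-gon on this side of the arc, `u₁` would be the whole boundary of its region,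
      -- which also contains `u₄`.
      have h2 : Q.face u₁ = u₁ := by
        rw [face_apply, h.top, ← h1, ← hz, h1, ← h.top, edge_edge]
      exact h.ne_one_four (h.face.eq_of_left h2)
    · exfalso
      have h2 : Q.face u₄ = u₄ := by
        rw [face_apply, ← h.bottom, edge_edge, ← h1, ← hz]
      exact h.ne_one_four (h.face.eq_of_right h2)
    · exact main h.flip h1

/-! ### Removing kinks -/

theorem exists_noOneGon (P : KnotProjection) :
    ∃ Q, Relation.ReflTransGen RIMinus P Q ∧ Q.NoOneGon := by
  induction hn : Nat.card P.Dart using Nat.strong_induction_on generalizing P with | _ n ih => ?_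
  by_cases h : P.NoOneGon
  · exact ⟨P, .refl, h⟩
  · simp only [NoOneGon, not_forall, not_not] at h
    obtain ⟨z, hz⟩ := h
    obtain ⟨Q, hQ, hs⟩ := exists_riMinus hz
    obtain ⟨g, hg⟩ := isSplice_iff.1 hs
    obtain ⟨R, hR, hR'⟩ := ih (Nat.card Q.Dart) (by have := hg.card; omega) Q rfl
    exact ⟨R, .head hQ hR, hR'⟩

theorem eliminatesIn_iff_of_reflTransGen (h : Relation.ReflTransGen RIMinus P Q) (k : ℕ) :
    EliminatesIn Q.adj k ↔ EliminatesIn P.adj k := by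
  induction h with
  | refl => rfl
  | tail _ h ih => rw [h.eliminatesIn_iff, ih]

theorem rIEquiv_of_reflTransGen (h : Relation.ReflTransGen RIMinus P Q) : RIEquiv P Q := by
  induction h with
  | refl => exact .refl _
  | tail _ h ih => exact .trans _ _ _ ih (.rel _ _ (Or.inr h))

theorem Unknots.exists_reflTransGen {k : ℕ} (h : P.Unknots k) (hk : k = 0) :
    ∃ R, Relation.ReflTransGen RIMinus P R ∧ R.IsSimpleClosedCurve := by
  induction h with
  | done P h => exact ⟨P, .refl, h⟩
  | ri P Q k h _ ih =>
    obtain ⟨R, hR, hR'⟩ := ih hk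
    exact ⟨R, .head h hR, hR'⟩
  | s P Q k _ _ _ => exact absurd hk (Nat.succ_ne_zero k)

/-- A projection with double points that is reduced to the simple closed curve by removing kinks has
a 1-gon off any given arc. -/
theorem exists_oneGon_ne (h : Relation.ReflTransGen RIMinus P R) (hR : R.IsSimpleClosedCurve)
    (x : P.Dart) : ∃ z, P.edge z = P.rot z ∧ z ≠ x ∧ z ≠ P.edge x := by
  induction h using Relation.ReflTransGen.head_induction_on with
  | refl => exact (hR.false x).elim
  | head h _ ih =>
    rename_i P Q _
    obtain ⟨z, hz, hs⟩ := riMinus_iff.1 h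
    obtain ⟨g, hg⟩ := isSplice_iff.1 hs
    by_cases hx : z ≠ x ∧ z ≠ P.edge x
    · exact ⟨z, hz, hx⟩
    have hz' : P.edge (P.rot z) = z := by rw [← hz, edge_edge]
    have hx : x ∈ ({z, P.rot z} : Set P.Dart) ∧ P.edge x ∈ ({z, P.rot z} : Set P.Dart) := by
      by_cases h1 : z = x
      · subst h1
        simp [hz]
      · have h2 : z = P.edge x := by tauto
        have h3 : x = P.rot z := by rw [← hz, h2, edge_edge]
        simp [h3, hz']
    have hne : ∀ y, y ≠ z → y ≠ P.rot z → y ≠ x ∧ y ≠ P.edge x := by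
      rintro y h1 h2
      constructor <;> rintro rfl
      · rcases hx.1 with h | h
        · exact h1 h
        · exact h2 h
      · rcases hx.2 with h | h
        · exact h1 h
        · exact h2 h
    -- The given arc is the side of the 1-gon. If the remaining two ends at its corner are joined as
    -- well, the curve is a figure eight and has a second 1-gon.
    by_cases h34 : P.edge (P.rot (P.rot z)) = P.rot (P.rot (P.rot z))
    · exact ⟨_, h34, hne _ (P.rot_two_ne z) (rot_ne _)⟩
    have hmem : P.edge (P.rot (P.rot z)) ∉ P.dartsAt (P.rot z) := by
      rw [dartsAt_rot]
      rintro (h1 | h1 | h1 | h1)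
      · rw [edge_eq_iff, hz, rot_inj] at h1
        exact rot_ne _ h1
      · rw [edge_eq_iff, hz'] at h1
        exact P.rot_two_ne _ h1
      · exact P.edge_ne _ h1
      · exact h34 h1
    -- `x'` lies on the arc of `Q` that carried the kink; a 1-gon of `Q` off this arc is still one
    -- of `P`.
    obtain ⟨x', hx'⟩ := hg.exists_eq hmem
    obtain ⟨w, hw, hw1, hw2⟩ := ih x'
    have hm : ∀ y ∈ P.dartsAt (P.rot z), g w ≠ y := fun y hy hh => hg.notMem w (hh ▸ hy)
    rw [dartsAt_rot] at hm
    have hgx : g (Q.edge x') = P.edge (P.rot (P.rot (P.rot z))) := by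
      rw [hg.edge, hx', kink_spliceEdge_two hz (by rw [edge_edge])]
    have hgw : P.edge (g w) ∉ P.dartsAt (P.rot z) := by
      rw [dartsAt_rot]
      rintro (h1 | h1 | h1 | h1) <;> rw [edge_eq_iff] at h1
      · rw [hz] at h1
        exact hm _ (by simp [mem_dartsAt]) h1
      · rw [hz'] at h1
        exact hm _ (by simp [mem_dartsAt]) h1
      · exact hw1 (hg.inj (by rw [h1, hx']))
      · exact hw2 (hg.inj (by rw [h1, hgx]))
    refine ⟨g w, ?_, hne _ (hm _ (by simp [mem_dartsAt])) (hm _ (by simp [mem_dartsAt]))⟩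
    rw [← hg.rot, ← hw, hg.edge, spliceEdge_of_notMem hgw]

theorem NoOneGon.exists_sMinus (hP : P.NoOneGon) {k : ℕ} (h : EliminatesIn P.adj (k + 1))
    (h' : ¬ EliminatesIn P.adj k) : ∃ Q, P.SMinus Q ∧ Q.Unknots k := by
  obtain ⟨j, hj, hu⟩ := eliminatesIn_iff_unknots.1 h
  have hjk : j = k + 1 := by
    by_contra hne
    exact h' (eliminatesIn_iff_unknots.2 ⟨j, by omega, hu⟩)
  subst hjk
  generalize hm : k + 1 = m at hu
  cases hu with
  | done _ => omega
  | ri _ Q _ hQ _ =>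
    obtain ⟨z, hz, -⟩ := riMinus_iff.1 hQ
    exact absurd hz (hP z)
  | s _ Q j hQ hu =>
    obtain rfl : k = j := by omega
    exact ⟨Q, hQ, hu⟩

/-! ### Labellings of the darts -/

/-- The corners of a double point, counted counterclockwise from the dart `x`. -/
def corner (x : P.Dart) : Fin 4 → P.Dart :=
  ![x, P.rot x, P.rot (P.rot x), P.rot (P.rot (P.rot x))]

theorem rot_corner (x : P.Dart) (c : Fin 4) : P.rot (corner x c) = corner x (c + 1) := by
  fin_cases c
  · rfl
  · rfl
  · rfl
  · exact P.rot_four x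

theorem corner_mem_dartsAt (x : P.Dart) (c : Fin 4) : corner x c ∈ P.dartsAt x := by
  fin_cases c <;> simp [corner, mem_dartsAt]

theorem exists_corner_eq {x y : P.Dart} (h : y ∈ P.dartsAt x) : ∃ c, corner x c = y := by
  rcases h with h | h | h | h
  · exact ⟨0, h.symm⟩
  · exact ⟨1, h.symm⟩
  · exact ⟨2, h.symm⟩
  · exact ⟨3, h.symm⟩

theorem corner_injective (x : P.Dart) : Function.Injective (corner x) := by
  intro c d h
  have r1 := rot_ne (P := P) x
  have r2 := P.rot_two_ne x
  have r3 := rot_three_ne (P := P) x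
  fin_cases c <;> fin_cases d <;> simp_all [corner, eq_comm]

theorem mem_dartsAt_of_corner_eq {x y : P.Dart} {c d : Fin 4} (h : corner x c = corner y d) :
    x ∈ P.dartsAt y := by
  have h1 := corner_mem_dartsAt x c
  rw [h] at h1
  have h2 := dartsAt_eq_of_mem (corner_mem_dartsAt y d)
  rw [dartsAt_eq_of_mem h1] at h2
  exact h2 ▸ self_mem_dartsAt x

/-- One chosen corner at every double point is turned into a numbering of all darts, as required by
`IsTorus`, `IsRational` and `IsPretzel`. -/
theorem exists_labelling {ι : Type*} (t : ι → P.Dart) (cover : ∀ y, ∃ i, y ∈ P.dartsAt (t i))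
    (distinct : ∀ i j, t i ∈ P.dartsAt (t j) → i = j) :
    ∃ e : ι × Fin 4 ≃ P.Dart, (∀ v c, P.rot (e (v, c)) = e (v, c + 1)) ∧
      ∀ v, e (v, NE) = t v ∧ e (v, NW) = P.rot (t v) ∧ e (v, SW) = P.rot (P.rot (t v)) ∧
        e (v, SE) = P.rot (P.rot (P.rot (t v))) := by
  have hb : Function.Bijective fun p : ι × Fin 4 => corner (t p.1) p.2 := by
    constructor
    · rintro ⟨v, c⟩ ⟨w, d⟩ h
      obtain rfl := distinct v w (mem_dartsAt_of_corner_eq h)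
      exact congrArg (Prod.mk v) (corner_injective _ h)
    · intro y
      obtain ⟨i, hi⟩ := cover y
      obtain ⟨c, hc⟩ := exists_corner_eq hi
      exact ⟨(i, c), hc⟩
  exact ⟨Equiv.ofBijective _ hb, fun v c => rot_corner _ c, fun v => ⟨rfl, rfl, rfl, rfl⟩⟩

/-! ### Cyclic twists -/

/-- `P` is a closed twist of `n` double points. -/
structure IsCyclicTwist (P : KnotProjection) (n : ℕ) (t : ℤ → P.Dart) : Prop where
  left : ∀ i, P.edge (P.rot (P.rot (t i))) = P.rot (t (i + 1))
  right : ∀ i, P.edge (P.rot (P.rot (P.rot (t i)))) = t (i + 1)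
  cover : ∀ y, ∃ i, y ∈ P.dartsAt (t i)
  distinct : ∀ i j, t i ∈ P.dartsAt (t j) → (n : ℤ) ∣ i - j
  periodic : ∀ i j, (n : ℤ) ∣ i - j → t i = t j

namespace IsCyclicTwist

variable {n : ℕ} {t : ℤ → P.Dart}

theorem shift (h : P.IsCyclicTwist n t) (a : ℤ) : P.IsCyclicTwist n fun i => t (i + a) where
  left i := by rw [h.left, add_right_comm]
  right i := by rw [h.right, add_right_comm]
  cover y := by
    obtain ⟨i, hi⟩ := h.cover y
    exact ⟨i - a, by simpa using hi⟩
  distinct i j hij := by simpa using h.distinct _ _ hij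
  periodic i j hij := h.periodic _ _ (by simpa using hij)

theorem flip (h : P.IsCyclicTwist n t) : P.IsCyclicTwist n fun i => P.rot (P.rot (t (-i))) where
  left i := by
    have := h.right (-(i + 1))
    rw [edge_eq_iff, show -(i + 1) + 1 = -i by ring] at this
    rw [rot_four, this]
  right i := by
    have := h.left (-(i + 1))
    rw [edge_eq_iff, show -(i + 1) + 1 = -i by ring] at this
    rw [rot_four, this]
  cover y := by
    obtain ⟨i, hi⟩ := h.cover y
    exact ⟨-i, by rw [mem_dartsAt_rot_two, neg_neg]; exact hi⟩
  distinct i j hij := by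
    rw [mem_dartsAt_rot_two, rot_mem_dartsAt, rot_mem_dartsAt] at hij
    have := h.distinct _ _ hij
    rwa [neg_sub_neg, ← dvd_neg, neg_sub] at this
  periodic i j hij := congrArg (fun x => P.rot (P.rot x))
    (h.periodic _ _ (by rwa [neg_sub_neg, ← dvd_neg, neg_sub]))

end IsCyclicTwist

theorem IsTorus.exists_isCyclicTwist {n : ℕ} (h : P.IsTorus n) : ∃ t, P.IsCyclicTwist n t := by
  obtain ⟨e, h1, h2⟩ := h
  have hr1 : ∀ j, P.rot (e (j, 0)) = e (j, 1) := fun j => h1 j 0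
  have hr2 : ∀ j, P.rot (e (j, 1)) = e (j, 2) := fun j => h1 j 1
  have hr3 : ∀ j, P.rot (e (j, 2)) = e (j, 3) := fun j => h1 j 2
  refine ⟨fun i => e ((i : ZMod n), 0), fun i => ?_, fun i => ?_, fun y => ?_, fun i j hij => ?_,
    fun i j hij => ?_⟩
  · rw [hr1, hr2, (h2 _).1, hr1]
    push_cast
    rfl
  · rw [hr1, hr2, hr3, (h2 _).2]
    push_cast
    rfl
  · obtain ⟨⟨j, c⟩, rfl⟩ := e.surjective y
    obtain ⟨i, rfl⟩ := ZMod.intCast_surjective j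
    refine ⟨i, ?_⟩
    fin_cases c <;> simp [mem_dartsAt, hr1, hr2, hr3]
  · simp only [mem_dartsAt, hr1, hr2, hr3, e.injective.eq_iff, Prod.mk.injEq] at hij
    rw [← ZMod.intCast_zmod_eq_zero_iff_dvd]
    push_cast
    rw [sub_eq_zero]
    tauto
  · have : (i : ZMod n) = j := by
      rw [← sub_eq_zero]
      exact_mod_cast (ZMod.intCast_zmod_eq_zero_iff_dvd _ _).2 hij
    simp only [this]

theorem val_add_one_or {k : ℕ} (j : ZMod (k + 1)) :
    (j.val + 1 < k + 1 ∧ (j + 1).val = j.val + 1) ∨ (j.val = k ∧ j + 1 = 0) := by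
  have h1 := ZMod.val_lt j
  rcases Nat.lt_or_ge (j.val + 1) (k + 1) with hj | hj
  · have : Fact (1 < k + 1) := ⟨by omega⟩
    refine Or.inl ⟨hj, ?_⟩
    rw [ZMod.val_add_of_lt] <;> rw [ZMod.val_one]
    exact hj
  · have hj' : j.val = k := by omega
    refine Or.inr ⟨hj', ?_⟩
    rw [← ZMod.natCast_zmod_val j, hj']
    exact_mod_cast ZMod.natCast_self (k + 1)

theorem ClosedTwist.isTorus {k : ℕ} {t : ℕ → P.Dart} (h : P.ClosedTwist k t) :
    P.IsTorus (k + 1) := by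
  obtain ⟨e, he, hv⟩ := exists_labelling (fun i : ZMod (k + 1) => t i.val)
    (fun y => by
      obtain ⟨i, hi, hy⟩ := h.cover y
      exact ⟨i, by rwa [ZMod.val_cast_of_lt hi]⟩)
    fun i j hij => ZMod.val_injective _
      (h.twist.distinct _ _ (ZMod.val_lt i) (ZMod.val_lt j) hij)
  refine ⟨e, he, fun j => ?_⟩
  rw [(hv j).2.2.1, (hv j).2.2.2, (hv (j + 1)).2.1, (hv (j + 1)).1]
  rcases val_add_one_or j with ⟨hj, hj'⟩ | ⟨hj, hj0⟩
  · rw [hj']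
    exact ⟨h.twist.left _ hj, h.twist.right _ hj⟩
  · rw [hj0, hj, ZMod.val_zero, ← h.right, ← h.left, edge_edge, edge_edge]
    exact ⟨rfl, rfl⟩

/-- The two strands of a twist with evenly many double points do not change sides. -/
theorem IsTorus.odd {n : ℕ} (h : P.IsTorus n) : Odd n := by
  by_contra hn
  have hd : 2 ∣ n := (Nat.not_odd_iff_even.1 hn).two_dvd
  obtain ⟨e, h1, h2⟩ := h
  let φ : ZMod n →+* ZMod 2 := ZMod.castHom hd (ZMod 2)
  -- The number of the double point plus that of the corner, modulo 2, is kept along arcs and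
  -- straight through double points, but it differs on the two strands.
  let χ : P.Dart → ZMod 2 := fun x => φ (e.symm x).1 + ((e.symm x).2.val : ZMod 2)
  have hχ : ∀ j c, χ (e (j, c)) = φ j + (c.val : ZMod 2) := fun j c => by simp [χ]
  have hr : ∀ x, χ (P.rot (P.rot x)) = χ x := by
    intro x
    obtain ⟨⟨j, c⟩, rfl⟩ := e.surjective x
    rw [h1, h1, hχ, hχ]
    congr 1
    fin_cases c <;> decide
  have hW : ∀ j, χ (P.edge (e (j, SW))) = χ (e (j, SW)) := by
    intro j
    rw [(h2 j).1, hχ, hχ, map_add, map_one, add_assoc]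
    congr 1
  have hE : ∀ j, χ (P.edge (e (j, SE))) = χ (e (j, SE)) := by
    intro j
    rw [(h2 j).2, hχ, hχ, map_add, map_one, add_assoc]
    congr 1
  have he : ∀ x, χ (P.edge x) = χ x := by
    intro x
    obtain ⟨⟨j, c⟩, rfl⟩ := e.surjective x
    fin_cases c
    · have := (h2 (j - 1)).2
      rw [sub_add_cancel] at this
      change χ (P.edge (e (j, NE))) = χ (e (j, NE))
      rw [← this, edge_edge, hE]
    · have := (h2 (j - 1)).1
      rw [sub_add_cancel] at this
      change χ (P.edge (e (j, NW))) = χ (e (j, NW))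
      rw [← this, edge_edge, hW]
    · exact hW j
    · exact hE j
  have := eq_of_invariant he hr (e (0, 0)) (e (0, 1))
  rw [hχ, hχ] at this
  simp at this

theorem ClosedTwist.mem_torusProjections {k : ℕ} {t : ℕ → P.Dart} (h : P.ClosedTwist k t)
    (hP : P.NoOneGon) : P ∈ torusProjections := by
  obtain ⟨m, hm⟩ := h.isTorus.odd
  refine ⟨m + 1, ?_, ?_⟩
  -- A closed twist of a single double point has a 1-gon.
  · rcases Nat.eq_zero_or_pos m with rfl | hm'
    · obtain rfl : k = 0 := by omega
      exact absurd h.left (hP _)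
    · omega
  · rw [show 2 * (m + 1) - 1 = k + 1 by omega]
    exact h.isTorus

/-- A projection without 1-gons and with `u⁻ = 1` is a torus projection. -/
theorem NoOneGon.mem_torusProjections (hP : P.NoOneGon) (h1 : EliminatesIn P.adj 1)
    (h0 : ¬ EliminatesIn P.adj 0) : P ∈ torusProjections := by
  obtain ⟨Q, hQ, hu⟩ := hP.exists_sMinus h1 h0
  obtain ⟨R, hR, hR'⟩ := hu.exists_reflTransGen rfl
  obtain ⟨f, k, t, u₁, u₂, u₃, u₄, h⟩ := hQ.exists_openTwist hP
  rcases h.reduce hP hR with ⟨f, k, t, u₁, u₂, u₃, u₄, h⟩ | ⟨Q', f, k, t, x, y, h, hQ'⟩ | ⟨k, t, h⟩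
  · exact (hR'.false u₁).elim
  · exfalso
    -- The twist sits on the arc of `x` only, so a 1-gon of `Q'` off this arc would survive in `P`.
    obtain ⟨z, hz, hzx, hzy⟩ := exists_oneGon_ne hQ' hR' x
    rw [h.right] at hzy
    apply hP (f z)
    rw [h.edge_eq hzx hzy, hz, h.rot]
  · exact h.mem_torusProjections hP

/-- One of the two strands of a twist: it runs through the upper right corner of the first double
point if `p` is even, and through the upper left one if `p` is odd. -/
def strand (P : KnotProjection) (k : ℕ) (t : ℕ → P.Dart) (p : ℕ) : Set P.Dart :=
  {x | ∃ j < k, (Even (j + p) ∧ (x = t j ∨ x = P.rot (P.rot (t j)))) ∨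
    (Odd (j + p) ∧ (x = P.rot (t j) ∨ x = P.rot (P.rot (P.rot (t j)))))}

section strand

variable {k p : ℕ} {t : ℕ → P.Dart}

theorem exists_mem_dartsAt_of_mem_strand {x : P.Dart} (hx : x ∈ P.strand k t p) :
    ∃ j < k, x ∈ P.dartsAt (t j) := by
  obtain ⟨j, hj, ⟨-, rfl | rfl⟩ | ⟨-, rfl | rfl⟩⟩ := hx <;> exact ⟨j, hj, by simp [mem_dartsAt]⟩

theorem rot_two_mem_strand {x : P.Dart} (hx : x ∈ P.strand k t p) :
    P.rot (P.rot x) ∈ P.strand k t p := by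
  obtain ⟨j, hj, ⟨h, rfl | rfl⟩ | ⟨h, rfl | rfl⟩⟩ := hx
  · exact ⟨j, hj, Or.inl ⟨h, Or.inr rfl⟩⟩
  · exact ⟨j, hj, Or.inl ⟨h, Or.inl (P.rot_four _)⟩⟩
  · exact ⟨j, hj, Or.inr ⟨h, Or.inr rfl⟩⟩
  · exact ⟨j, hj, Or.inr ⟨h, Or.inl (P.rot_four _)⟩⟩

/-- A strand is left only at the ends of the twist. -/
theorem IsTwist.edge_mem_strand (ht : P.IsTwist k t) {x : P.Dart} (hx : x ∈ P.strand k t p) :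
    P.edge x ∈ P.strand k t p ∨ (Even p ∧ x = t 0) ∨ (Odd p ∧ x = P.rot (t 0)) ∨
      (Odd (k + p) ∧ x = P.rot (P.rot (t (k - 1)))) ∨
      (Even (k + p) ∧ x = P.rot (P.rot (P.rot (t (k - 1))))) := by
  obtain ⟨j, hj, ⟨h, rfl | rfl⟩ | ⟨h, rfl | rfl⟩⟩ := hx
  · rcases j with _ | j
    · rw [zero_add] at h
      exact Or.inr (Or.inl ⟨h, rfl⟩)
    · refine Or.inl ⟨j, by omega, Or.inr ⟨?_, Or.inr ?_⟩⟩
      · grind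
      · rw [edge_eq_iff, ht.right j hj]
  · rcases Nat.lt_or_ge (j + 1) k with hj' | hj'
    · refine Or.inl ⟨j + 1, hj', Or.inr ⟨?_, Or.inl (ht.left j hj')⟩⟩
      grind
    · obtain rfl : k = j + 1 := by omega
      refine Or.inr (Or.inr (Or.inr (Or.inl ⟨?_, rfl⟩)))
      grind
  · rcases j with _ | j
    · rw [zero_add] at h
      exact Or.inr (Or.inr (Or.inl ⟨h, rfl⟩))
    · refine Or.inl ⟨j, by omega, Or.inl ⟨?_, Or.inr ?_⟩⟩
      · grind
      · rw [edge_eq_iff, ht.left j hj]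
  · rcases Nat.lt_or_ge (j + 1) k with hj' | hj'
    · refine Or.inl ⟨j + 1, hj', Or.inl ⟨?_, Or.inl (ht.right j hj')⟩⟩
      grind
    · obtain rfl : k = j + 1 := by omega
      refine Or.inr (Or.inr (Or.inr (Or.inr ⟨?_, rfl⟩)))
      grind

theorem IsTwist.rot_notMem_strand (ht : P.IsTwist k t) (hk : 0 < k) :
    P.rot (t 0) ∉ P.strand k t 0 := by
  intro hx
  obtain ⟨j, hj, hjx⟩ := exists_mem_dartsAt_of_mem_strand hx
  rw [rot_mem_dartsAt] at hjx
  obtain rfl := ht.distinct 0 j hk hj hjx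
  obtain ⟨j, hj, h⟩ := hx
  have hj0 : t 0 ∈ P.dartsAt (t j) := by
    rw [← rot_mem_dartsAt, mem_dartsAt]
    tauto
  obtain rfl := ht.distinct 0 j hk hj hj0
  rcases h with ⟨-, h | h⟩ | ⟨h, -⟩
  · exact rot_ne _ h
  · exact rot_ne _ (P.rot.injective h.symm)
  · simp at h

end strand

/-! ### Rational projections -/

/-- A vertical twist of `a` double points with upper right corners `V i` and a horizontal one of `b`
double points with upper left corners `H i`, joined as in the projection `C(a, b)`. -/
structure RationalTwists (P : KnotProjection) (a b : ℕ) (V H : ℕ → P.Dart) : Prop where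
  pos : 0 < a
  vert : P.IsTwist a V
  horiz : P.IsTwist b H
  cover : ∀ y, (∃ i < a, y ∈ P.dartsAt (V i)) ∨ ∃ i < b, y ∈ P.dartsAt (H i)
  disjoint : ∀ i j, i < a → j < b → H j ∉ P.dartsAt (V i)
  top_left : P.edge (V 0) = H 0
  bottom_left : P.edge (P.rot (P.rot (P.rot (V (a - 1))))) = P.rot (H 0)
  top_right : P.edge (P.rot (P.rot (P.rot (H (b - 1))))) = P.rot (V 0)
  bottom_right : P.edge (P.rot (P.rot (H (b - 1)))) = P.rot (P.rot (V (a - 1)))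

namespace RationalTwists

variable {a b : ℕ} {V H : ℕ → P.Dart}

theorem isRational (h : P.RationalTwists a b V H) : P.IsRational a b := by
  have h3 : ∀ x y, P.rot (P.rot (P.rot x)) ∈ P.dartsAt y ↔ x ∈ P.dartsAt y := fun x y => by
    simp only [rot_mem_dartsAt]
  have h3' : ∀ x y, x ∈ P.dartsAt (P.rot (P.rot (P.rot y))) ↔ x ∈ P.dartsAt y := fun x y => by
    rw [mem_dartsAt_comm, h3, mem_dartsAt_comm]
  obtain ⟨e, he, hv⟩ := exists_labelling (Sum.elim (fun i : Fin a => V i)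
      fun i : Fin b => P.rot (P.rot (P.rot (H i))))
    (fun y => by
      rcases h.cover y with ⟨i, hi, hy⟩ | ⟨i, hi, hy⟩
      · exact ⟨.inl ⟨i, hi⟩, hy⟩
      · exact ⟨.inr ⟨i, hi⟩, (h3' _ _).2 hy⟩)
    (by
      rintro (i | i) (j | j) hij <;> simp only [Sum.elim_inl, Sum.elim_inr, h3, h3'] at hij
      · rw [Fin.ext (h.vert.distinct i j i.2 j.2 hij)]
      · exact absurd (mem_dartsAt_comm.1 hij) (h.disjoint _ _ i.2 j.2)
      · exact absurd hij (h.disjoint _ _ j.2 i.2)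
      · rw [Fin.ext (h.horiz.distinct i j i.2 j.2 hij)])
  have v0 := fun i => (hv i).1
  have v1 := fun i => (hv i).2.1
  have v2 := fun i => (hv i).2.2.1
  have v3 := fun i => (hv i).2.2.2
  refine ⟨e, he, fun i j hij => ?_, fun i j hij => ?_, fun top bottom left right h1 h2 h3 h4 => ?_⟩
  · simp only [v0, v1, v2, v3, Sum.elim_inl, hij]
    exact ⟨h.vert.left i (by omega), h.vert.right i (by omega)⟩
  · simp only [v0, v1, v2, v3, Sum.elim_inr, hij, rot_four]
    exact ⟨h.horiz.right i (by omega), h.horiz.left i (by omega)⟩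
  · simp only [v0, v1, v2, v3, Sum.elim_inl, Sum.elim_inr, rot_four, h1, h3,
      show (bottom : ℕ) = a - 1 by omega, show (right : ℕ) = b - 1 by omega]
    exact ⟨h.top_left, h.bottom_left, h.top_right, h.bottom_right⟩

/-- If both twists have oddly many double points, there are two components. -/
theorem even (h : P.RationalTwists a b V H) (hb : Odd b) : Even a := by
  by_contra ha
  rw [Nat.not_even_iff_odd] at ha
  have hapos := h.pos
  have hbpos := hb.pos
  -- With both lengths odd, the strand through `V 0` and the strand through `H 0` close up to a
  -- curve that misses `rot (V 0)`.
  have hmem : P.rot (V 0) ∈ P.strand a V 0 ∪ P.strand b H 0 := by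
    refine closed_univ ?_ ?_ (x := V 0) (Or.inl ⟨0, h.pos, Or.inl ⟨by simp, Or.inl rfl⟩⟩) _
    · rintro x (hx | hx)
      · rcases h.vert.edge_mem_strand hx with h1 | ⟨-, rfl⟩ | ⟨h1, -⟩ | ⟨-, rfl⟩ | ⟨h1, -⟩
        · exact Or.inl h1
        · exact Or.inr ⟨0, hbpos, Or.inl ⟨by simp, Or.inl h.top_left⟩⟩
        · simp at h1
        · refine Or.inr ⟨b - 1, by omega, Or.inl ⟨by grind, Or.inr ?_⟩⟩
          rw [← h.bottom_right, edge_edge]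
        · exact absurd ha (by simpa using h1)
      · rcases h.horiz.edge_mem_strand hx with h1 | ⟨-, rfl⟩ | ⟨h1, -⟩ | ⟨-, rfl⟩ | ⟨h1, -⟩
        · exact Or.inr h1
        · exact Or.inl ⟨0, h.pos, Or.inl ⟨by simp, Or.inl (by rw [← h.top_left, edge_edge])⟩⟩
        · simp at h1
        · exact Or.inl ⟨a - 1, by omega, Or.inl ⟨by grind, Or.inr h.bottom_right⟩⟩
        · exact absurd hb (by simpa using h1)
    · rintro x (hx | hx)
      · exact Or.inl (rot_two_mem_strand hx)
      · exact Or.inr (rot_two_mem_strand hx)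
  rcases hmem with hm | hm
  · exact h.vert.rot_notMem_strand h.pos hm
  · obtain ⟨j, hj, hm⟩ := exists_mem_dartsAt_of_mem_strand hm
    rw [rot_mem_dartsAt, mem_dartsAt_comm] at hm
    exact h.disjoint 0 j h.pos hj hm

theorem mem_rationalProjections (h : P.RationalTwists a b V H) (hb : Odd b) (hb' : 3 ≤ b) :
    P ∈ rationalProjections := by
  obtain ⟨m, hm⟩ := h.even hb
  obtain ⟨n, hn⟩ := hb
  have := h.pos
  refine ⟨m, n + 1, by omega, by omega, ?_⟩
  rw [show 2 * m = a by omega, show 2 * (n + 1) - 1 = b by omega]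
  exact h.isRational

end RationalTwists

/-! ### Pretzel projections -/

/-- Three vertical twists with upper right corners `T i j`, joined as in a pretzel projection. -/
structure PretzelTwists (P : KnotProjection) (a : Fin 3 → ℕ) (T : Fin 3 → ℕ → P.Dart) : Prop where
  pos : ∀ i, 0 < a i
  twist : ∀ i, P.IsTwist (a i) (T i)
  cover : ∀ y, ∃ i, ∃ j < a i, y ∈ P.dartsAt (T i j)
  disjoint : ∀ i i' j j', j < a i → j' < a i' → T i j ∈ P.dartsAt (T i' j') → i = i'
  top : ∀ i, P.edge (T i 0) = P.rot (T (i + 1) 0)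
  bottom : ∀ i, P.edge (P.rot (P.rot (P.rot (T i (a i - 1))))) =
    P.rot (P.rot (T (i + 1) (a (i + 1) - 1)))

namespace PretzelTwists

variable {a : Fin 3 → ℕ} {T : Fin 3 → ℕ → P.Dart}

theorem rotate (h : P.PretzelTwists a T) (m : Fin 3) :
    P.PretzelTwists (fun i => a (i + m)) fun i => T (i + m) where
  pos i := h.pos _
  twist i := h.twist _
  cover y := by
    obtain ⟨i, j, hj, hy⟩ := h.cover y
    exact ⟨i - m, j, by simpa using hj, by simpa using hy⟩
  disjoint i i' j j' hj hj' hij := by simpa using h.disjoint _ _ j j' hj hj' hij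
  top i := by rw [h.top, add_right_comm]
  bottom i := by rw [h.bottom, add_right_comm]

theorem isPretzel (h : P.PretzelTwists a T) : P.IsPretzel a := by
  obtain ⟨e, he, hv⟩ := exists_labelling (fun v : Σ i : Fin 3, Fin (a i) => T v.1 v.2)
    (fun y => by
      obtain ⟨i, j, hj, hy⟩ := h.cover y
      exact ⟨⟨i, j, hj⟩, hy⟩)
    (by
      rintro ⟨i, j⟩ ⟨i', j'⟩ hij
      obtain rfl := h.disjoint _ _ _ _ j.2 j'.2 hij
      rw [Fin.ext ((h.twist i).distinct _ _ j.2 j'.2 hij)])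
  have v0 := fun i => (hv i).1
  have v1 := fun i => (hv i).2.1
  have v2 := fun i => (hv i).2.2.1
  have v3 := fun i => (hv i).2.2.2
  refine ⟨e, he, fun i j k hjk => ?_, fun i j k hj hk => ?_, fun i j k hj hk => ?_⟩
  · simp only [v0, v1, v2, v3, hjk]
    exact ⟨(h.twist i).left _ (by omega), (h.twist i).right _ (by omega)⟩
  · simp only [v0, v1, hj, hk]
    exact h.top i
  · simp only [v2, v3, show (j : ℕ) = a i - 1 by omega, show (k : ℕ) = a (i + 1) - 1 by omega]
    exact h.bottom i

/-- Two neighbouring twists with evenly many double points give rise to a component of the curve. -/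
theorem not_even_and_even (h : P.PretzelTwists a T) (i : Fin 3) :
    ¬ (Even (a i) ∧ Even (a (i + 1))) := by
  rintro ⟨h0, h1⟩
  have p0 := h.pos i
  have p1 := h.pos (i + 1)
  -- With both lengths even, the strand of twist `i` that begins and ends on the right and the
  -- strand of twist `i + 1` that begins and ends on the left form a closed curve, which misses the
  -- third twist.
  have hmem : T (i + 2) 0 ∈ P.strand (a i) (T i) 0 ∪ P.strand (a (i + 1)) (T (i + 1)) 1 := by
    refine closed_univ ?_ ?_ (x := T i 0) (Or.inl ⟨0, p0, Or.inl ⟨by simp, Or.inl rfl⟩⟩) _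
    · rintro x (hx | hx)
      · rcases (h.twist i).edge_mem_strand hx with h2 | ⟨-, rfl⟩ | ⟨h2, -⟩ | ⟨h2, -⟩ | ⟨-, rfl⟩
        · exact Or.inl h2
        · exact Or.inr ⟨0, p1, Or.inr ⟨by simp, Or.inl (h.top i)⟩⟩
        · simp at h2
        · exact absurd h0 (by simpa using h2)
        · exact Or.inr ⟨a (i + 1) - 1, by omega, Or.inl ⟨by grind, Or.inr (h.bottom i)⟩⟩
      · rcases (h.twist (i + 1)).edge_mem_strand hx with h2 | ⟨h2, -⟩ | ⟨-, rfl⟩ | ⟨-, rfl⟩ | ⟨h2, -⟩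
        · exact Or.inr h2
        · simp at h2
        · exact Or.inl ⟨0, p0, Or.inl ⟨by simp, Or.inl (by rw [← h.top, edge_edge])⟩⟩
        · refine Or.inl ⟨a i - 1, by omega, Or.inr ⟨by grind, Or.inr ?_⟩⟩
          rw [← h.bottom, edge_edge]
        · exact absurd h1 (by simpa [Nat.even_add_one] using h2)
    · rintro x (hx | hx)
      · exact Or.inl (rot_two_mem_strand hx)
      · exact Or.inr (rot_two_mem_strand hx)
  rcases hmem with hm | hm <;> obtain ⟨j, hj, hm⟩ := exists_mem_dartsAt_of_mem_strand hm <;>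
    have := h.disjoint _ _ _ _ (h.pos _) hj hm <;> clear * - this <;> revert i <;> decide

theorem mem_pretzelProjections (h : P.PretzelTwists a T) {i : Fin 3} (h0 : Even (a i))
    (h1 : Odd (a (i + 1))) (h2 : Odd (a (i + 2))) : P ∈ pretzelProjections := by
  obtain ⟨p, hp⟩ := h0
  obtain ⟨q, hq⟩ := h1
  obtain ⟨r, hr⟩ := h2
  have := h.pos i
  refine ⟨p, q + 1, r + 1, by omega, by omega, by omega, ?_⟩
  have key := (h.rotate i).isPretzel
  convert key using 1
  funext j
  fin_cases j
  · simp; omega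
  · simp [add_comm 1 i]; omega
  · simp [add_comm 2 i]; omega

end PretzelTwists

/-! ### A twist put into a torus projection -/

namespace IsCyclicTwist

variable {n : ℕ} {s : ℤ → R.Dart}

theorem rot_ne (h : R.IsCyclicTwist n s) (i j : ℤ) : R.rot (s i) ≠ s j := fun hij => by
  have := h.periodic i j (h.distinct _ _ (by rw [← rot_mem_dartsAt, hij]; exact self_mem_dartsAt _))
  rw [← this] at hij
  exact KnotProjection.rot_ne _ hij

theorem rot_two_ne (h : R.IsCyclicTwist n s) (i j : ℤ) : R.rot (R.rot (s i)) ≠ s j := fun hij => by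
  have := h.periodic i j (h.distinct _ _ (by
    rw [← rot_mem_dartsAt, ← rot_mem_dartsAt, hij]; exact self_mem_dartsAt _))
  rw [← this] at hij
  exact R.rot_two_ne _ hij

theorem dvd_of_eq (h : R.IsCyclicTwist n s) {i j : ℤ} (hij : s i = s j) : (n : ℤ) ∣ i - j :=
  h.distinct _ _ (by rw [hij]; exact self_mem_dartsAt _)

/-- The boundary of the region on the left of a closed twist. -/
theorem of_sameCycle_rot_two (h : R.IsCyclicTwist n s) {i : ℤ} {x : R.Dart}
    (hx : R.face.SameCycle (R.rot (R.rot (s i))) x) : ∃ j, x = R.rot (R.rot (s j)) := by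
  have := R.finite
  refine hx.mem_of_closed (S := {x | ∃ j, x = R.rot (R.rot (s j))}) ?_ ⟨i, rfl⟩
  rintro _ ⟨j, rfl⟩
  exact ⟨j + 1, by rw [face_apply, h.left]⟩

/-- The boundary of the region between two consecutive double points of a closed twist. -/
theorem of_sameCycle_rot_three (h : R.IsCyclicTwist n s) {i : ℤ} {x : R.Dart}
    (hx : R.face.SameCycle (R.rot (R.rot (R.rot (s i)))) x) :
    x = R.rot (R.rot (R.rot (s i))) ∨ x = R.rot (s (i + 1)) := by
  have := R.finite
  refine hx.mem_of_closed (S := {x | x = R.rot (R.rot (R.rot (s i))) ∨ x = R.rot (s (i + 1))}) ?_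
    (Or.inl rfl)
  rintro _ (rfl | rfl)
  · exact Or.inr (by rw [face_apply, h.right])
  · exact Or.inl (by rw [face_apply, ← h.left, edge_edge])

/-- Two arcs on the boundary of one region of a closed twist, in a suitable position. -/
theorem exists_position (h : R.IsCyclicTwist n s) (hn : 0 < n) {u v : R.Dart} (huv : u ≠ v)
    (hf : R.face.SameCycle u v) : ∃ s, R.IsCyclicTwist n s ∧
      ((u = R.rot (R.rot (s 0)) ∧ ∃ A : ℕ, 0 < A ∧ A < n ∧ v = R.rot (R.rot (s A))) ∨
        (u = R.rot (R.rot (R.rot (s 0))) ∧ v = R.rot (s 1))) := by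
  -- A shift brings `u` to the double point number zero, and a half turn makes it a lower corner.
  obtain ⟨s, hs, hu⟩ : ∃ s, R.IsCyclicTwist n s ∧
      (u = R.rot (R.rot (s 0)) ∨ u = R.rot (R.rot (R.rot (s 0)))) := by
    obtain ⟨i, hi⟩ := h.cover u
    have h' := h.shift i
    rcases hi with hi | hi | hi | hi
    · exact ⟨_, h'.flip, Or.inl (by simp [hi])⟩
    · exact ⟨_, h'.flip, Or.inr (by simp [hi])⟩
    · exact ⟨_, h', Or.inl (by simp [hi])⟩
    · exact ⟨_, h', Or.inr (by simp [hi])⟩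
  refine ⟨s, hs, ?_⟩
  rcases hu with rfl | rfl
  · obtain ⟨j, rfl⟩ := hs.of_sameCycle_rot_two hf
    have h1 : 0 ≤ j % n := Int.emod_nonneg _ (by omega)
    have h2 : j % n < n := Int.emod_lt_of_pos _ (by omega)
    have h3 : s (j % n) = s j := hs.periodic _ _ (by
      rw [← dvd_neg, neg_sub]
      exact Int.dvd_self_sub_emod)
    refine Or.inl ⟨rfl, (j % n).toNat, ?_, by omega, by rw [Int.toNat_of_nonneg h1, h3]⟩
    by_contra h0
    apply huv
    rw [← h3, show j % n = 0 by omega]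
  · rcases hs.of_sameCycle_rot_three hf with rfl | rfl
    · exact absurd rfl huv
    · exact Or.inr ⟨rfl, rfl⟩

end IsCyclicTwist

theorem TwistMap.mem_dartsAt_iff {f : R.Dart → P.Dart} {k : ℕ} {t : ℕ → P.Dart}
    (h : P.TwistMap R f k t) {x y : R.Dart} : f x ∈ P.dartsAt (f y) ↔ x ∈ R.dartsAt y := by
  simp only [mem_dartsAt, ← h.rot, h.inj.eq_iff]

namespace OpenTwist

variable {f : R.Dart → P.Dart} {k n : ℕ} {t : ℕ → P.Dart} {u₁ u₂ u₃ u₄ : R.Dart} {s : ℤ → R.Dart}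

/-- A stretch of the closed twist stays a twist in `P` if the new twist is not put on any of its
inner arcs; `b ≤ n` keeps its double points distinct. -/
theorem isTwist_of_isCyclicTwist (h : P.OpenTwist R f k t u₁ u₂ u₃ u₄) (hs : R.IsCyclicTwist n s)
    (c : ℤ) {b : ℕ} (hb : b ≤ n)
    (h2 : ∀ i : ℕ, i + 1 < b → ∀ u ∈ ({u₁, u₂, u₃, u₄} : Set R.Dart), R.rot (R.rot (s (c + i))) ≠ u)
    (h3 : ∀ i : ℕ, i + 1 < b → ∀ u ∈ ({u₁, u₂, u₃, u₄} : Set R.Dart),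
      R.rot (R.rot (R.rot (s (c + i)))) ≠ u) :
    P.IsTwist b fun i => f (s (c + i)) := by
  refine ⟨fun i hi => ?_, fun i hi => ?_, fun i j hi hj hij => ?_⟩
  · rw [← h.rot, ← h.rot, h.edge_eq (h2 i hi _ (by simp)) (h2 i hi _ (by simp))
      (h2 i hi _ (by simp)) (h2 i hi _ (by simp)), hs.left, h.rot]
    push_cast
    rw [add_assoc]
  · rw [← h.rot, ← h.rot, ← h.rot, h.edge_eq (h3 i hi _ (by simp)) (h3 i hi _ (by simp))
      (h3 i hi _ (by simp)) (h3 i hi _ (by simp)), hs.right]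
    push_cast
    rw [add_assoc]
  · rw [h.mem_dartsAt_iff] at hij
    have := hs.distinct _ _ hij
    rw [add_sub_add_left_eq_sub] at this
    obtain ⟨q, hq⟩ := this
    have hq0 : q = 0 := by
      by_contra hq0
      rcases lt_or_gt_of_ne hq0 with h1 | h1 <;> nlinarith
    subst hq0
    omega

/-- The new twist is put on the two sides of the 2-gon between the double points 0 and 1. This cuts
the closed twist open there, and its `n` double points, beginning with number 1, become the
horizontal twist. -/
theorem rationalTwists (h : P.OpenTwist R f k t u₁ u₂ u₃ u₄) (hs : R.IsCyclicTwist n s)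
    (hn : 0 < n) (h1 : u₁ = R.rot (R.rot (R.rot (s 0)))) (h4 : u₄ = R.rot (s 1)) :
    P.RationalTwists (k + 1) n t fun i => f (s (1 + i)) := by
  have hu₂ : u₂ = s 1 := by rw [← h.top, h1, hs.right, zero_add]
  have hu₃ : u₃ = R.rot (R.rot (s 0)) := by
    rw [← R.edge_edge u₃, h.bottom, h4, edge_eq_iff, hs.left, zero_add]
  have hlast : s (1 + ((n - 1 : ℕ) : ℤ)) = s 0 := hs.periodic _ _ (by
    push_cast [Nat.cast_sub (show 1 ≤ n from hn)]
    simp)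
  have hnd : ∀ i : ℕ, i + 1 < n → s (1 + i) ≠ s 0 := fun i hi he => by
    have := Int.le_of_dvd (by omega) (hs.dvd_of_eq he)
    omega
  refine ⟨by omega, h.twist, h.isTwist_of_isCyclicTwist hs 1 le_rfl (fun i hi u hu => ?_)
    (fun i hi u hu => ?_), fun y => ?_, fun i j hi hj => h.disjoint _ i hi, ?_, ?_, ?_, ?_⟩
  · rcases hu with rfl | rfl | rfl | rfl
    · rw [h1, Ne, rot_inj, rot_inj]; exact (hs.rot_ne _ _).symm
    · rw [hu₂]; exact hs.rot_two_ne _ _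
    · rw [hu₃, Ne, rot_inj, rot_inj]; exact hnd i hi
    · rw [h4, Ne, rot_inj]; exact hs.rot_ne _ _
  · rcases hu with rfl | rfl | rfl | rfl
    · rw [h1, Ne, rot_inj, rot_inj, rot_inj]; exact hnd i hi
    · rw [hu₂, ← rot_symm_apply, Ne, Equiv.symm_apply_eq]; exact (hs.rot_ne _ _).symm
    · rw [hu₃, Ne, rot_inj, rot_inj]; exact hs.rot_ne _ _
    · rw [h4, Ne, rot_inj]; exact hs.rot_two_ne _ _
  · rcases h.cover y with ⟨x, rfl⟩ | hy
    · obtain ⟨m, hm⟩ := hs.cover x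
      have h5 : 0 ≤ (m - 1) % n := Int.emod_nonneg _ (by omega)
      have h6 : (m - 1) % n < n := Int.emod_lt_of_pos _ (by omega)
      refine Or.inr ⟨((m - 1) % n).toNat, by omega, ?_⟩
      rw [h.mem_dartsAt_iff, Int.toNat_of_nonneg h5, hs.periodic (1 + (m - 1) % n) m]
      · exact hm
      · rw [← dvd_neg, neg_sub, ← sub_sub]
        exact Int.dvd_self_sub_emod
    · exact Or.inl hy
  · rw [h.ne, hu₂]; simp
  · rw [Nat.add_sub_cancel, h.se, h4, h.rot]; simp
  · rw [hlast, ← h.rot, ← h.rot, ← h.rot, ← h1, edge_eq_iff, h.nw]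
  · rw [hlast, ← h.rot, ← h.rot, ← hu₃, edge_eq_iff, Nat.add_sub_cancel, h.sw]

/-- The new twist is put on two arcs that border the region on the left of the closed twist. They
separate it into the double points `1, …, A` and the remaining `n - A`, which are read backwards
after a half turn so that all columns run downwards. -/
theorem pretzelTwists (h : P.OpenTwist R f k t u₁ u₂ u₃ u₄) (hs : R.IsCyclicTwist n s) {A : ℕ}
    (hA : 0 < A) (hAn : A < n) (h1 : u₁ = R.rot (R.rot (s 0))) (h4 : u₄ = R.rot (R.rot (s A))) :
    P.PretzelTwists ![k + 1, A, n - A] ![t, fun m => f (s (1 + m)),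
      fun m => f (R.rot (R.rot (s (-(0 + m)))))] := by
  have hu₂ : u₂ = R.rot (s 1) := by rw [← h.top, h1, hs.left, zero_add]
  have hu₃ : u₃ = R.rot (s (A + 1)) := by rw [← R.edge_edge u₃, h.bottom, h4, hs.left]
  have hnd : ∀ i j : ℤ, 0 < i - j → i - j < n → s i ≠ s j := fun i j h1 h2 he => by
    have := Int.le_of_dvd h1 (hs.dvd_of_eq he)
    omega
  have hlast : s (-(0 + ((n - A - 1 : ℕ) : ℤ))) = s (A + 1) := hs.periodic _ _ ⟨-1, by omega⟩
  have tw1 : P.IsTwist A fun m => f (s (1 + m)) := by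
    refine h.isTwist_of_isCyclicTwist hs 1 hAn.le (fun i hi u hu => ?_) (fun i hi u hu => ?_) <;>
      rcases hu with rfl | rfl | rfl | rfl
    · rw [h1, Ne, rot_inj, rot_inj]; exact hnd _ _ (by omega) (by omega)
    · rw [hu₂, Ne, rot_inj]; exact hs.rot_ne _ _
    · rw [hu₃, Ne, rot_inj]; exact hs.rot_ne _ _
    · rw [h4, Ne, rot_inj, rot_inj]; exact (hnd _ _ (by omega) (by omega)).symm
    · rw [h1, Ne, rot_inj, rot_inj]; exact hs.rot_ne _ _
    · rw [hu₂, Ne, rot_inj]; exact hs.rot_two_ne _ _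
    · rw [hu₃, Ne, rot_inj]; exact hs.rot_two_ne _ _
    · rw [h4, Ne, rot_inj, rot_inj]; exact hs.rot_ne _ _
  have tw2 : P.IsTwist (n - A) fun m => f (R.rot (R.rot (s (-(0 + m))))) := by
    refine h.isTwist_of_isCyclicTwist hs.flip 0 (by omega) (fun i hi u hu => ?_)
      (fun i hi u hu => ?_) <;> rcases hu with rfl | rfl | rfl | rfl <;> rw [rot_four]
    · rw [h1]; exact (hs.rot_two_ne _ _).symm
    · rw [hu₂]; exact (hs.rot_ne _ _).symm
    · rw [hu₃]; exact (hs.rot_ne _ _).symm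
    · rw [h4]; exact (hs.rot_two_ne _ _).symm
    · rw [h1, Ne, rot_inj]; exact (hs.rot_ne _ _).symm
    · rw [hu₂, Ne, rot_inj]; exact (hnd _ _ (by omega) (by omega)).symm
    · rw [hu₃, Ne, rot_inj]; exact (hnd _ _ (by omega) (by omega)).symm
    · rw [h4, Ne, rot_inj]; exact (hs.rot_ne _ _).symm
  have d12 : ∀ i j : ℕ, i < A → j < n - A → s (1 + i) ∉ R.dartsAt (s (-(0 + j))) := by
    intro i j hi hj hij
    have := Int.le_of_dvd (by omega) (hs.distinct _ _ hij)
    omega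
  refine ⟨fun i => ?_, fun i => ?_, fun y => ?_, fun i i' j j' => ?_, fun i => ?_, fun i => ?_⟩
  · fin_cases i <;> simp <;> omega
  · fin_cases i
    · exact h.twist
    · exact tw1
    · exact tw2
  · rcases h.cover y with ⟨x, rfl⟩ | ⟨j, hj, hy⟩
    · obtain ⟨m, hm⟩ := hs.cover x
      have h5 : 0 ≤ (m - 1) % n := Int.emod_nonneg _ (by omega)
      have h6 : (m - 1) % n < n := Int.emod_lt_of_pos _ (by omega)
      have h7 : s (1 + (m - 1) % n) = s m := hs.periodic _ _ (by
        rw [← dvd_neg, neg_sub, ← sub_sub]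
        exact Int.dvd_self_sub_emod)
      rcases lt_or_ge ((m - 1) % n) A with hlt | hge
      · refine ⟨1, ((m - 1) % n).toNat, by simp; omega, ?_⟩
        change f x ∈ P.dartsAt (f (s (1 + _)))
        rw [h.mem_dartsAt_iff, Int.toNat_of_nonneg h5, h7]
        exact hm
      · refine ⟨2, (n - 1 - (m - 1) % n).toNat, by simp; omega, ?_⟩
        change f x ∈ P.dartsAt (f (R.rot (R.rot (s (-(0 + _))))))
        rw [h.mem_dartsAt_iff, mem_dartsAt_rot_two, Int.toNat_of_nonneg (by omega),
          hs.periodic (-(0 + (n - 1 - (m - 1) % n))) (1 + (m - 1) % n) ⟨-1, by ring⟩, h7]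
        exact hm
    · exact ⟨0, j, hj, hy⟩
  · have hd : ∀ x, ∀ i < k + 1, t i ∉ P.dartsAt (f x) := fun x i hi hh =>
      h.disjoint x i hi (mem_dartsAt_comm.1 hh)
    fin_cases i <;> fin_cases i' <;> intro hj hj' hij <;> first | rfl | exfalso
    · exact hd _ j hj hij
    · exact hd _ j hj hij
    · exact h.disjoint _ j' hj' hij
    · change f (s (1 + _)) ∈ P.dartsAt (f (R.rot (R.rot (s (-(0 + _)))))) at hij
      rw [h.mem_dartsAt_iff, mem_dartsAt_rot_two] at hij
      exact d12 j j' hj hj' hij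
    · exact h.disjoint _ j' hj' hij
    · change f (R.rot (R.rot (s (-(0 + _))))) ∈ P.dartsAt (f (s (1 + _))) at hij
      rw [h.mem_dartsAt_iff, mem_dartsAt_comm, mem_dartsAt_rot_two] at hij
      exact d12 j' j hj' hj hij
  · fin_cases i
    · change P.edge (t 0) = P.rot (f (s (1 + (0 : ℕ))))
      rw [h.ne, hu₂, h.rot]; simp
    · change P.edge (f (s (1 + (0 : ℕ)))) = P.rot (f (R.rot (R.rot (s (-(0 + (0 : ℕ)))))))
      rw [← h.rot]
      simp only [Nat.cast_zero, add_zero, neg_zero]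
      have e1 : R.edge (s 1) = R.rot (R.rot (R.rot (s 0))) := by
        rw [edge_eq_iff, hs.right, zero_add]
      rw [h.edge_eq, e1]
      · rw [h1]; exact (hs.rot_two_ne _ _).symm
      · rw [hu₂]; exact (hs.rot_ne _ _).symm
      · rw [hu₃]; exact (hs.rot_ne _ _).symm
      · rw [h4]; exact (hs.rot_two_ne _ _).symm
    · change P.edge (f (R.rot (R.rot (s (-(0 + (0 : ℕ))))))) = P.rot (t 0)
      simp only [Nat.cast_zero, add_zero, neg_zero]
      rw [← h1, edge_eq_iff, h.nw]
  · fin_cases i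
    · change P.edge (P.rot (P.rot (P.rot (t (k + 1 - 1))))) =
        P.rot (P.rot (f (s (1 + ((A - 1 : ℕ) : ℤ)))))
      rw [Nat.add_sub_cancel, h.se, h4, h.rot, h.rot, show 1 + ((A - 1 : ℕ) : ℤ) = A by omega]
    · change P.edge (P.rot (P.rot (P.rot (f (s (1 + ((A - 1 : ℕ) : ℤ))))))) =
        P.rot (P.rot (f (R.rot (R.rot (s (-(0 + ((n - A - 1 : ℕ) : ℤ))))))))
      rw [hlast, ← h.rot, ← h.rot, ← h.rot, ← h.rot, ← h.rot, rot_four,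
        show 1 + ((A - 1 : ℕ) : ℤ) = A by omega, h.edge_eq, hs.right]
      · rw [h1, Ne, rot_inj, rot_inj]; exact hs.rot_ne _ _
      · rw [hu₂, Ne, rot_inj]; exact hs.rot_two_ne _ _
      · rw [hu₃, Ne, rot_inj]; exact hs.rot_two_ne _ _
      · rw [h4, Ne, rot_inj, rot_inj]; exact hs.rot_ne _ _
    · change P.edge (P.rot (P.rot (P.rot (f (R.rot (R.rot (s (-(0 + ((n - A - 1 : ℕ) : ℤ))))))))))
        = P.rot (P.rot (t (k + 1 - 1)))
      rw [hlast, ← h.rot, ← h.rot, ← h.rot, rot_four, ← hu₃, edge_eq_iff, Nat.add_sub_cancel, h.sw]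

/-- A twist put into a torus projection yields a rational or a pretzel projection. -/
theorem mem_rational_or_pretzel (h : P.OpenTwist R f k t u₁ u₂ u₃ u₄) (hR : R ∈ torusProjections) :
    P ∈ rationalProjections ∪ pretzelProjections := by
  obtain ⟨l, hl, hR⟩ := hR
  have hodd := hR.odd
  obtain ⟨s, hs⟩ := hR.exists_isCyclicTwist
  set n := 2 * l - 1 with hn
  obtain ⟨s, hs, ⟨h1, A, hA, hAn, h4⟩ | ⟨h1, h4⟩⟩ :=
    hs.exists_position (by omega) h.ne_one_four h.face
  · right
    have hp := h.pretzelTwists hs hA hAn h1 h4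
    -- As `n` is odd, exactly one of `A` and `n - A` is even. The new twist is a neighbour of both
    -- columns and must then be odd.
    have n0 := hp.not_even_and_even 0
    have n2 := hp.not_even_and_even 2
    change ¬ (Even (k + 1) ∧ Even A) at n0
    change ¬ (Even (n - A) ∧ Even (k + 1)) at n2
    rcases Nat.even_or_odd A with ha | ha
    · have ho : Odd (k + 1) := Nat.not_even_iff_odd.1 fun hh => n0 ⟨hh, ha⟩
      exact hp.mem_pretzelProjections (i := 1) ha (Nat.Odd.sub_even hAn.le hodd ha) ho
    · have he : Even (n - A) := Nat.Odd.sub_odd hodd ha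
      have ho : Odd (k + 1) := Nat.not_even_iff_odd.1 fun hh => n2 ⟨he, hh⟩
      exact hp.mem_pretzelProjections (i := 2) he ho ha
  · left
    exact (h.rationalTwists hs (by omega) h1 h4).mem_rationalProjections hodd (by omega)

end OpenTwist

/-! ### Torus projections -/

/-- How the corners of the double points of a closed twist are joined. -/
def torusEdge (n : ℕ) (p : ZMod n × Fin 4) : ZMod n × Fin 4 :=
  ![(p.1 - 1, SE), (p.1 - 1, SW), (p.1 + 1, NW), (p.1 + 1, NE)] p.2

theorem torusEdge_torusEdge (n : ℕ) (p : ZMod n × Fin 4) : torusEdge n (torusEdge n p) = p := by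
  obtain ⟨j, c⟩ := p
  fin_cases c
  · exact Prod.ext (sub_add_cancel j 1) rfl
  · exact Prod.ext (sub_add_cancel j 1) rfl
  · exact Prod.ext (add_sub_cancel_right j 1) rfl
  · exact Prod.ext (add_sub_cancel_right j 1) rfl

theorem torusEdge_ne (n : ℕ) (p : ZMod n × Fin 4) : torusEdge n p ≠ p := by
  obtain ⟨j, c⟩ := p
  intro h
  have h2 := congrArg Prod.snd h
  fin_cases c
  · exact absurd (show SE = NE from h2) (by decide)
  · exact absurd (show SW = NW from h2) (by decide)
  · exact absurd (show NW = SW from h2) (by decide)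
  · exact absurd (show NE = SE from h2) (by decide)

/-- The arcs of a closed twist. -/
def torusEdgePerm (n : ℕ) : Equiv.Perm (ZMod n × Fin 4) :=
  ⟨torusEdge n, torusEdge n, torusEdge_torusEdge n, torusEdge_torusEdge n⟩

/-- The rotation of the corners of crossings. -/
def cornerRot (ι : Type) : Equiv.Perm (ι × Fin 4) :=
  Equiv.prodCongr (Equiv.refl ι) (Equiv.addRight 1)

theorem cornerRot_two {ι : Type} (v : ι) (c : Fin 4) :
    cornerRot ι (cornerRot ι (v, c)) = (v, c + 2) :=
  congrArg (Prod.mk v) ((by decide : ∀ c : Fin 4, c + 1 + 1 = c + 2) c)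

theorem cornerRot_four {ι : Type} (x : ι × Fin 4) :
    cornerRot ι (cornerRot ι (cornerRot ι (cornerRot ι x))) = x := by
  obtain ⟨v, c⟩ := x
  rw [cornerRot_two, cornerRot_two]
  exact congrArg (Prod.mk v) ((by decide : ∀ c : Fin 4, c + 2 + 2 = c) c)

theorem cornerRot_two_ne {ι : Type} (x : ι × Fin 4) : cornerRot ι (cornerRot ι x) ≠ x := by
  obtain ⟨v, c⟩ := x
  rw [cornerRot_two]
  intro h
  exact (by decide : ∀ c : Fin 4, c + 2 ≠ c) c (congrArg Prod.snd h)

/-- The boundaries of the regions of a closed twist. -/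
def torusFace (n : ℕ) : Equiv.Perm (ZMod n × Fin 4) := cornerRot _ * torusEdgePerm n

/-- The region of a closed twist that lies between a corner and the next one. -/
def torusRegion (n : ℕ) (p : ZMod n × Fin 4) : ZMod n ⊕ Bool :=
  ![.inr false, .inl (p.1 - 1), .inr true, .inl p.1] p.2

theorem torusFace_eq (n : ℕ) (j : ZMod n) :
    torusFace n (j, NE) = (j - 1, NE) ∧
    torusFace n (j, NW) = (j - 1, SE) ∧
    torusFace n (j, SW) = (j + 1, SW) ∧
    torusFace n (j, SE) = (j + 1, NW) :=
  ⟨congrArg (Prod.mk _) (by decide : SE + 1 = NE), congrArg (Prod.mk _) (by decide : SW + 1 = SE),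
    congrArg (Prod.mk _) (by decide : NW + 1 = SW), congrArg (Prod.mk _) (by decide : NE + 1 = NW)⟩

/-- `torusRegion` does not change along a boundary, and every corner reaches a standard one: `(m,
SE)` in a 2-gon, `(0, SW)` and `(0, NE)` in the two regions beside the closed twist. -/
theorem torusFace_sameCycle_iff (n : ℕ) [NeZero n] (p q : ZMod n × Fin 4) :
    (torusFace n).SameCycle p q ↔ torusRegion n p = torusRegion n q := by
  set φ := torusFace n with hφ
  have hinv : ∀ p, torusRegion n (φ p) = torusRegion n p := by
    rintro ⟨j, c⟩
    obtain ⟨h0, h1, h2, h3⟩ := torusFace_eq n j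
    fin_cases c
    · exact (congrArg _ h0).trans rfl
    · exact (congrArg _ h1).trans rfl
    · exact (congrArg _ h2).trans rfl
    · refine (congrArg _ h3).trans ?_
      simp [torusRegion]
  have hE : ∀ j : ℕ, φ.SameCycle ((j : ZMod n), NE) (0, NE) := by
    intro j
    induction j with
    | zero => simpa using SameCycle.refl _ _
    | succ j ih =>
      have := sameCycle_apply_self φ (((j + 1 : ℕ) : ZMod n), NE)
      rw [hφ, (torusFace_eq n _).1, ← hφ] at this
      push_cast at this ⊢
      rw [add_sub_cancel_right] at this
      exact this.trans ih
  have hW : ∀ j : ℕ, φ.SameCycle ((j : ZMod n), SW) (0, SW) := by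
    intro j
    induction j with
    | zero => simpa using SameCycle.refl _ _
    | succ j ih =>
      have := sameCycle_apply_self φ ((j : ZMod n), SW)
      rw [hφ, (torusFace_eq n _).2.2.1, ← hφ] at this
      push_cast
      exact this.symm.trans ih
  have hE' : ∀ j, φ.SameCycle (j, NE) (0, NE) := fun j => by
    have := hE j.val
    rwa [ZMod.natCast_zmod_val] at this
  have hW' : ∀ j, φ.SameCycle (j, SW) (0, SW) := fun j => by
    have := hW j.val
    rwa [ZMod.natCast_zmod_val] at this
  have hN : ∀ j, φ.SameCycle (j, NW) (j - 1, SE) := fun j => by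
    have := sameCycle_apply_self φ (j, NW)
    rwa [hφ, (torusFace_eq n _).2.1, ← hφ] at this
  constructor
  · intro h
    have hfin : Finite (ZMod n × Fin 4) := inferInstance
    exact (h.mem_of_closed (S := {q | torusRegion n p = torusRegion n q})
      (fun q hq => hq.trans (hinv q).symm) rfl)
  · obtain ⟨j, c⟩ := p
    obtain ⟨i, d⟩ := q
    intro h
    have key : ∀ (j : ZMod n) c, φ.SameCycle (j, c)
        (Sum.elim (fun m => (m, SE)) (fun b => bif b then (0, SW) else (0, NE))
          (torusRegion n (j, c))) := by
      intro j c
      fin_cases c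
      · exact hE' j
      · exact hN j
      · exact hW' j
      · exact SameCycle.refl _ _
    have := key j c
    rw [h] at this
    exact this.trans (key i d).symm

theorem numCycles_torusFace (n : ℕ) [NeZero n] :
    numCycles (torusFace n) = n + 2 := by
  set φ := torusFace n with hφ
  let g : Quotient (SameCycle.setoid φ) → ZMod n ⊕ Bool :=
    Quotient.lift (torusRegion n) fun p q h => (torusFace_sameCycle_iff n p q).1 h
  have hg : Function.Bijective g := by
    constructor
    · rintro ⟨p⟩ ⟨q⟩ h
      exact Quotient.sound ((torusFace_sameCycle_iff n p q).2 h)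
    · rintro (j | b)
      · exact ⟨Quotient.mk _ (j, SE), rfl⟩
      · cases b
        · exact ⟨Quotient.mk _ (0, NE), rfl⟩
        · exact ⟨Quotient.mk _ (0, SW), rfl⟩
  rw [numCycles, Nat.card_congr (Equiv.ofBijective g hg), Nat.card_sum, Nat.card_zmod]
  simp

/-- The `(2, n)`-torus projection for odd `n`. -/
def torus (n : ℕ) [NeZero n] (hn : Odd n) : KnotProjection where
  Dart := ZMod n × Fin 4
  finite := inferInstance
  rot := cornerRot _
  edge := torusEdgePerm n
  rot_four := cornerRot_four
  rot_two_ne := cornerRot_two_ne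
  edge_edge := torusEdge_torusEdge n
  edge_ne := torusEdge_ne n
  one_component := by
    refine (eqvGen_iff_closed (torusEdge_torusEdge n) (s := fun x => cornerRot _ (cornerRot _ x))
      cornerRot_four).2 ?_
    intro S he hr
    have r0 : ∀ j : ZMod n, (j, NE) ∈ S → (j, SW) ∈ S := fun j h => by
      have := hr _ h
      rwa [cornerRot_two, (by decide : NE + 2 = SW)] at this
    have r1 : ∀ j : ZMod n, (j, NW) ∈ S → (j, SE) ∈ S := fun j h => by
      have := hr _ h
      rwa [cornerRot_two, (by decide : NW + 2 = SE)] at this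
    have r2 : ∀ j : ZMod n, (j, SW) ∈ S → (j, NE) ∈ S := fun j h => by
      have := hr _ h
      rwa [cornerRot_two, (by decide : SW + 2 = NE)] at this
    have r3 : ∀ j : ZMod n, (j, SE) ∈ S → (j, NW) ∈ S := fun j h => by
      have := hr _ h
      rwa [cornerRot_two, (by decide : SE + 2 = NW)] at this
    have e2 : ∀ j : ZMod n, (j, SW) ∈ S → (j + 1, NW) ∈ S := fun j h => he _ h
    have e3 : ∀ j : ZMod n, (j, SE) ∈ S → (j + 1, NE) ∈ S := fun j h => he _ h
    -- Past two double points the curve is again at an upper right corner, two further on; since 2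
    -- is invertible modulo the odd number `n`, it reaches all of them.
    have step : ∀ j : ZMod n, (j, NE) ∈ S → (j + 2, NE) ∈ S := fun j h => by
      have := e3 _ (r1 _ (e2 _ (r0 _ h)))
      rwa [add_assoc, one_add_one_eq_two] at this
    have steps : ∀ (m : ℕ) (j : ZMod n), (j, NE) ∈ S → (j + 2 * m, NE) ∈ S := by
      intro m
      induction m with
      | zero => intro j h; simpa using h
      | succ m ih =>
        intro j h
        have := step _ (ih j h)
        push_cast
        rwa [mul_add, mul_one, ← add_assoc]
    have all : ∀ i j : ZMod n, (i, NE) ∈ S → (j, NE) ∈ S := by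
      intro i j h
      obtain ⟨l, hl⟩ := hn
      have h2 : (2 : ZMod n) * ((l + 1 : ℕ) : ZMod n) = 1 := by
        have : ((2 * (l + 1) : ℕ) : ZMod n) = ((n + 1 : ℕ) : ZMod n) := by
          congr 1
          omega
        push_cast at this ⊢
        rw [this, ZMod.natCast_self, zero_add]
      have := steps ((l + 1) * (j - i).val) i h
      push_cast at this h2
      rwa [ZMod.natCast_zmod_val, ← mul_assoc, h2, one_mul, add_sub_cancel] at this
    have full : ∀ i : ZMod n, (i, NE) ∈ S → ∀ y, y ∈ S := by
      rintro i h ⟨j, c⟩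
      have hj := fun j => all i j h
      have hw : (j, NW) ∈ S := by
        have := e2 _ (r0 _ (hj (j - 1)))
        rwa [sub_add_cancel] at this
      fin_cases c
      · exact hj j
      · exact hw
      · exact r0 _ (hj j)
      · exact r1 _ hw
    rintro ⟨j, c⟩ h
    fin_cases c
    · exact full j h
    · exact full _ (e3 _ (r1 _ h))
    · exact full _ (r2 _ h)
    · exact full _ (e3 _ h)
  spherical := by
    intro _
    have h1 := numCycles_mul_four (r := cornerRot (ZMod n)) cornerRot_four cornerRot_two_ne
    have h2 := numCycles_mul_two (e := torusEdgePerm n) (torusEdge_torusEdge n) (torusEdge_ne n)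
    have h3 : numCycles ((torusEdgePerm n).trans (cornerRot _)) = n + 2 := numCycles_torusFace n
    rw [Nat.card_prod, Nat.card_zmod, Nat.card_fin] at h1 h2
    omega

theorem torus_isTorus (n : ℕ) [NeZero n] (hn : Odd n) : (torus n hn).IsTorus n :=
  ⟨Equiv.refl _, fun _ _ => rfl, fun _ => ⟨rfl, rfl⟩⟩

/-! ### A twist with its left ends joined -/

namespace ClosedLeft

variable {f : Q.Dart → P.Dart} {k : ℕ} {t : ℕ → P.Dart} {x y : Q.Dart}

/-- If the number of double points of the twist is even, there are two components. -/
theorem odd (h : P.ClosedLeft Q f k t x y) : Odd (k + 1) := by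
  by_contra hk
  rw [Nat.not_odd_iff_even] at hk
  have hmem : f x ∈ P.strand (k + 1) t 1 := by
    refine closed_univ (fun z hz => ?_) (fun z hz => rot_two_mem_strand hz)
      (x := P.rot (t 0)) ⟨0, by omega, Or.inr ⟨by simp, Or.inl rfl⟩⟩ _
    have hin : P.rot (P.rot (t k)) ∈ P.strand (k + 1) t 1 :=
      ⟨k, by omega, Or.inl ⟨hk, Or.inr rfl⟩⟩
    rcases h.twist.edge_mem_strand hz with h2 | ⟨h2, -⟩ | ⟨-, rfl⟩ | ⟨-, rfl⟩ | ⟨h2, -⟩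
    · exact h2
    · simp at h2
    · rw [h.left]
      exact hin
    · rw [Nat.add_sub_cancel, ← h.left, edge_edge]
      exact ⟨0, by omega, Or.inr ⟨by simp, Or.inl rfl⟩⟩
    · exact absurd hk (by simpa [Nat.even_add_one] using h2)
  obtain ⟨j, hj, hm⟩ := exists_mem_dartsAt_of_mem_strand hmem
  exact h.disjoint x j hj hm

/-- The projection is a connected sum with a torus projection. -/
theorem isConnectedSum (h : P.ClosedLeft Q f k t x y) :
    IsConnectedSum Q (torus (k + 1) h.odd) P := by
  let g : ZMod (k + 1) × Fin 4 → P.Dart := fun p => corner (t p.1.val) p.2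
  have hv : ∀ i : ZMod (k + 1), i.val < k + 1 := ZMod.val_lt
  have hfg : ∀ z p, f z ≠ g p := fun z p hz => by
    have := h.disjoint z p.1.val (hv _)
    rw [hz] at this
    exact this (corner_mem_dartsAt _ _)
  have hb : Function.Bijective (Sum.elim f g) := by
    constructor
    · rintro (z | ⟨i, c⟩) (w | ⟨j, d⟩) hzw
      · rw [h.inj hzw]
      · exact absurd hzw (hfg _ _)
      · exact absurd hzw.symm (hfg _ _)
      · obtain rfl := ZMod.val_injective _
          (h.twist.distinct _ _ (hv i) (hv j) (mem_dartsAt_of_corner_eq hzw))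
        exact congrArg (fun c => Sum.inr (i, c)) (corner_injective _ hzw)
    · intro z
      rcases h.cover z with ⟨w, rfl⟩ | ⟨i, hi, hz⟩
      · exact ⟨.inl w, rfl⟩
      · obtain ⟨c, hc⟩ := exists_corner_eq hz
        refine ⟨.inr ((i : ZMod (k + 1)), c), ?_⟩
        change corner (t (i : ZMod (k + 1)).val) c = z
        rw [ZMod.val_cast_of_lt hi, hc]
  have hlast : (0 - 1 : ZMod (k + 1)).val = k := by
    rcases val_add_one_or (0 - 1 : ZMod (k + 1)) with ⟨-, h1⟩ | ⟨h1, -⟩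
    · rw [sub_add_cancel, ZMod.val_zero] at h1
      omega
    · exact h1
  have hleft : ∀ j, P.edge (g (j, SW)) = g (j + 1, NW) := by
    intro j
    change P.edge (P.rot (P.rot (t j.val))) = P.rot (t (j + 1).val)
    rcases val_add_one_or j with ⟨hj, hj'⟩ | ⟨hj, hj0⟩
    · rw [hj', h.twist.left _ hj]
    · rw [hj, hj0, ZMod.val_zero, ← h.left, edge_edge]
  have hright : ∀ j, j + 1 ≠ 0 → P.edge (g (j, SE)) = g (j + 1, NE) := by
    intro j hj0
    change P.edge (P.rot (P.rot (P.rot (t j.val)))) = t (j + 1).val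
    rcases val_add_one_or j with ⟨hj, hj'⟩ | ⟨hj, hj0'⟩
    · rw [hj', h.twist.right _ hj]
    · exact absurd hj0' hj0
  -- The closed twist is cut at its arc between `(0, NE)` and `(0 - 1, SE)`, which are the free
  -- right ends of the twist in `P`.
  refine Or.inr (Or.inr ⟨x, (0, NE), Equiv.ofBijective _ hb, fun z => (h.rot z).symm,
    fun p => rot_corner _ _, ?_, ?_, fun z h1 h2 => h.edge_eq h1 (h.right ▸ h2), ?_⟩)
  · change P.edge (f x) = t (0 : ZMod (k + 1)).val
    rw [ZMod.val_zero, ← h.ne, edge_edge]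
  · change P.edge (f (Q.edge x)) = P.rot (P.rot (P.rot (t (0 - 1 : ZMod (k + 1)).val)))
    rw [hlast, h.right, ← h.se, edge_edge]
  · rintro ⟨j, c⟩ h1 h2
    change P.edge (g (j, c)) = g (torusEdge _ (j, c))
    fin_cases c
    · change P.edge (g (j, NE)) = g (j - 1, SE)
      rw [edge_eq_iff, hright (j - 1), sub_add_cancel]
      rw [sub_add_cancel]
      rintro rfl
      exact h1 rfl
    · change P.edge (g (j, NW)) = g (j - 1, SW)
      rw [edge_eq_iff, hleft (j - 1), sub_add_cancel]
    · exact hleft j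
    · refine hright j fun hj => h2 ?_
      change (j, SE) = (0 - 1, SE)
      rw [← hj, add_sub_cancel_right]

theorem mem_connectedSums (h : P.ClosedLeft Q f k t x y) (hP : P.NoOneGon)
    (hQ : Q ∈ riClass torusProjections) :
    P ∈ connectedSums (riClass torusProjections) (riClass torusProjections) := by
  refine ⟨Q, hQ, torus (k + 1) h.odd, ⟨_, ?_, .refl _⟩, h.isConnectedSum⟩
  obtain ⟨m, hm⟩ := h.odd
  refine ⟨m + 1, ?_, ?_⟩
  · rcases Nat.eq_zero_or_pos m with rfl | hm'
    · obtain rfl : k = 0 := by omega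
      exact absurd h.left (hP _)
    · omega
  · rw [show 2 * (m + 1) - 1 = k + 1 by omega]
    exact torus_isTorus _ _

end ClosedLeft

/-- A projection without 1-gons and with `u⁻ = 2` is a rational or a pretzel projection, or a
connected sum. -/
theorem NoOneGon.mem_of_two (hP : P.NoOneGon) (h2 : EliminatesIn P.adj 2)
    (h1 : ¬ EliminatesIn P.adj 1) :
    P ∈ rationalProjections ∪ pretzelProjections ∪
      connectedSums (riClass torusProjections) (riClass torusProjections) := by
  obtain ⟨Q, hQ, hu⟩ := hP.exists_sMinus h2 h1
  obtain ⟨R, hQR, hR⟩ := exists_noOneGon Q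
  -- One elimination has been spent, so the graphs of `Q` and `R` need exactly one more.
  have hRT : R ∈ torusProjections := by
    refine hR.mem_torusProjections ?_ fun h => ?_
    · rw [eliminatesIn_iff_of_reflTransGen hQR]
      exact hu.eliminatesIn
    · rw [eliminatesIn_iff_of_reflTransGen hQR] at h
      exact h1 (hQ.eliminatesIn_succ h)
  obtain ⟨f, k, t, u₁, u₂, u₃, u₄, h⟩ := hQ.exists_openTwist hP
  rcases h.reduce hP hQR with ⟨f, k, t, u₁, u₂, u₃, u₄, h⟩ | ⟨Q', f, k, t, x, y, h, hQ'⟩ | ⟨k, t, h⟩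
  · exact Or.inl (h.mem_rational_or_pretzel hRT)
  · exact Or.inr (h.mem_connectedSums hP ⟨R, hRT, rIEquiv_of_reflTransGen hQ'⟩)
  · obtain ⟨l, hl, hT⟩ := h.mem_torusProjections hP
    exact absurd (torus_eliminatesIn (by omega) hT).1 h1

/-! ### Adding kinks -/

open Classical in
/-- The arcs after a kink is put on the arc of `x`. The kink has its 1-gon at `.inr 0`. -/
noncomputable def kinkEdge (P : KnotProjection) (x : P.Dart) : P.Dart ⊕ Fin 4 → P.Dart ⊕ Fin 4 :=
  Sum.elim (fun y => if y = x then .inr 3 else if y = P.edge x then .inr 2 else .inl (P.edge y))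
    -- The dart `x` also decides on which side of the arc the 1-gon lies; `edge x` gives the other
    -- kink on the same arc.
    ![.inr 1, .inr 0, .inl (P.edge x), .inl x]

section kinkEdge

variable (x : P.Dart)

theorem kinkEdge_self : P.kinkEdge x (.inl x) = .inr 3 := if_pos rfl

theorem kinkEdge_edge : P.kinkEdge x (.inl (P.edge x)) = .inr 2 := by
  simp [kinkEdge, P.edge_ne x]

theorem kinkEdge_inl {x y : P.Dart} (h1 : y ≠ x) (h2 : y ≠ P.edge x) :
    P.kinkEdge x (.inl y) = .inl (P.edge y) := by
  simp [kinkEdge, h1, h2]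

theorem kinkEdge_kinkEdge (y : P.Dart ⊕ Fin 4) : P.kinkEdge x (P.kinkEdge x y) = y := by
  rcases y with y | c
  · by_cases h1 : y = x
    · subst h1
      rw [kinkEdge_self]; rfl
    · by_cases h2 : y = P.edge x
      · subst h2
        rw [kinkEdge_edge]; rfl
      · rw [kinkEdge_inl h1 h2, kinkEdge_inl, edge_edge]
        · rwa [Ne, edge_eq_iff]
        · rwa [Ne, edge_inj]
  · fin_cases c
    · rfl
    · rfl
    · exact kinkEdge_edge x
    · exact kinkEdge_self x

theorem kinkEdge_ne (y : P.Dart ⊕ Fin 4) : P.kinkEdge x y ≠ y := by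
  rcases y with y | c
  · by_cases h1 : y = x
    · subst h1
      rw [kinkEdge_self]; exact Sum.inr_ne_inl
    · by_cases h2 : y = P.edge x
      · subst h2
        rw [kinkEdge_edge]; exact Sum.inr_ne_inl
      · rw [kinkEdge_inl h1 h2]
        exact fun h => P.edge_ne y (Sum.inl.inj h)
  · fin_cases c
    · exact fun h => absurd (Sum.inr.inj h) (by decide)
    · exact fun h => absurd (Sum.inr.inj h) (by decide)
    · exact Sum.inl_ne_inr
    · exact Sum.inl_ne_inr

/-- The arcs after a kink is put on the arc of `x`. -/
noncomputable def kinkEdgePerm : Equiv.Perm (P.Dart ⊕ Fin 4) :=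
  ⟨P.kinkEdge x, P.kinkEdge x, kinkEdge_kinkEdge x, kinkEdge_kinkEdge x⟩

/-- The rotation about the double points, with one more double point. -/
def kinkRot (P : KnotProjection) : Equiv.Perm (P.Dart ⊕ Fin 4) :=
  Equiv.sumCongr P.rot (Equiv.addRight 1)

theorem kinkRot_inl (y : P.Dart) : P.kinkRot (.inl y) = .inl (P.rot y) := rfl

theorem kinkRot_inr (c : Fin 4) : P.kinkRot (.inr c) = .inr (c + 1) := rfl

theorem kinkRot_two (c : Fin 4) : P.kinkRot (P.kinkRot (.inr c)) = .inr (c + 2) :=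
  congrArg Sum.inr ((by decide : ∀ c : Fin 4, c + 1 + 1 = c + 2) c)

theorem kinkRot_four (y : P.Dart ⊕ Fin 4) :
    P.kinkRot (P.kinkRot (P.kinkRot (P.kinkRot y))) = y := by
  rcases y with y | c
  · simp only [kinkRot_inl, rot_four]
  · rw [kinkRot_two, kinkRot_two]
    exact congrArg Sum.inr ((by decide : ∀ c : Fin 4, c + 2 + 2 = c) c)

theorem kinkRot_two_ne (y : P.Dart ⊕ Fin 4) : P.kinkRot (P.kinkRot y) ≠ y := by
  rcases y with y | c
  · exact fun h => P.rot_two_ne y (Sum.inl.inj h)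
  · rw [kinkRot_two]
    exact fun h => (by decide : ∀ c : Fin 4, c + 2 ≠ c) c (Sum.inr.inj h)

/-- The boundaries of the regions after a kink is put on the arc of `x`. -/
noncomputable def kinkFace : Equiv.Perm (P.Dart ⊕ Fin 4) := P.kinkRot * kinkEdgePerm x

theorem kinkFace_apply (y : P.Dart ⊕ Fin 4) : kinkFace x y = P.kinkRot (P.kinkEdge x y) := rfl

theorem kinkFace_inr : kinkFace x (.inr 0) = .inr 2 ∧ kinkFace x (.inr 1) = .inr 1 ∧
    kinkFace x (.inr 2) = .inl (P.face (x)) ∧ kinkFace x (.inr 3) = .inl (P.face (P.edge x)) :=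
  ⟨congrArg Sum.inr (by decide : (1 : Fin 4) + 1 = 2),
    congrArg Sum.inr (by decide : (0 : Fin 4) + 1 = 1), rfl, by
    rw [face_apply, edge_edge]; rfl⟩

theorem isFirstReturn_kinkFace : IsFirstReturn Sum.inl P.face (kinkFace x) := by
  obtain ⟨h0, -, h2, h3⟩ := kinkFace_inr x
  intro y
  by_cases h1 : y = x
  · subst h1
    have hy : kinkFace y (.inl y) = .inr 0 := by
      rw [kinkFace_apply, kinkEdge_self, kinkRot_inr]
      exact congrArg Sum.inr (by decide : (3 : Fin 4) + 1 = 0)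
    refine ⟨2, ?_, fun i hi hi' => ?_⟩
    · simp only [pow_succ', Perm.mul_apply, pow_zero, Perm.one_apply, hy, h0, h2]
    · interval_cases i
      · simp [hy]
      · simp [pow_succ', hy, h0]
  · by_cases h4 : y = P.edge x
    · subst h4
      have hy : kinkFace x (.inl (P.edge x)) = .inr 3 := by
        rw [kinkFace_apply, kinkEdge_edge, kinkRot_inr]
        exact congrArg Sum.inr (by decide : (2 : Fin 4) + 1 = 3)
      refine ⟨1, ?_, fun i hi hi' => ?_⟩
      · simp only [pow_succ', Perm.mul_apply, pow_zero, Perm.one_apply, hy, h3]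
      · interval_cases i
        simp [hy]
    · refine ⟨0, ?_, fun i hi hi' => by omega⟩
      simp only [zero_add, pow_one, kinkFace_apply, kinkEdge_inl h1 h4, kinkRot_inl, face_apply]

/-- The new region is the 1-gon, bounded by `.inr 1` alone; every other boundary contains an old
dart. -/
theorem numCycles_kinkFace : numCycles (kinkFace x) = numCycles P.face + 1 := by
  have := P.finite
  obtain ⟨h0, h1, h2, h3⟩ := kinkFace_inr x
  refine numCycles_eq_succ_of_firstReturn
    ((isFirstReturn_kinkFace x).sameCycle_iff Sum.inl_injective) (.inr 1)
    (fun y hy => Sum.inr_ne_inl (hy.eq_of_left h1)) fun y => ?_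
  have s0 := sameCycle_apply_self (kinkFace x) (.inr 0)
  have s2 := sameCycle_apply_self (kinkFace x) (.inr 2)
  have s3 := sameCycle_apply_self (kinkFace x) (.inr 3)
  rw [h0] at s0
  rw [h2] at s2
  rw [h3] at s3
  rcases y with y | c
  · exact Or.inr ⟨y, SameCycle.refl _ _⟩
  · fin_cases c
    · exact Or.inr ⟨_, s0.trans s2⟩
    · exact Or.inl (SameCycle.refl _ _)
    · exact Or.inr ⟨_, s2⟩
    · exact Or.inr ⟨_, s3⟩

/-- The projection with a kink put on the arc of `x`. -/
noncomputable def addKink (P : KnotProjection) (x : P.Dart) : KnotProjection where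
  Dart := P.Dart ⊕ Fin 4
  finite := by have := P.finite; infer_instance
  rot := P.kinkRot
  edge := kinkEdgePerm x
  rot_four := kinkRot_four
  rot_two_ne := kinkRot_two_ne
  edge_edge := kinkEdge_kinkEdge x
  edge_ne := kinkEdge_ne x
  one_component := by
    refine (eqvGen_iff_closed (kinkEdge_kinkEdge x) (s := fun y => P.kinkRot (P.kinkRot y))
      kinkRot_four).2 ?_
    intro S he hr
    have r0 : .inr 0 ∈ S → .inr 2 ∈ S := fun h => by
      have := hr _ h
      rwa [kinkRot_two, (by decide : (0 : Fin 4) + 2 = 2)] at this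
    have r1 : .inr 1 ∈ S → .inr 3 ∈ S := fun h => by
      have := hr _ h
      rwa [kinkRot_two, (by decide : (1 : Fin 4) + 2 = 3)] at this
    have r2 : .inr 2 ∈ S → .inr 0 ∈ S := fun h => by
      have := hr _ h
      rwa [kinkRot_two, (by decide : (2 : Fin 4) + 2 = 0)] at this
    have r3 : .inr 3 ∈ S → .inr 1 ∈ S := fun h => by
      have := hr _ h
      rwa [kinkRot_two, (by decide : (3 : Fin 4) + 2 = 1)] at this
    have e0 : .inr 0 ∈ S → .inr 1 ∈ S := fun h => he _ h
    have e1 : .inr 1 ∈ S → .inr 0 ∈ S := fun h => he _ h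
    have e2 : .inr 2 ∈ S → .inl (P.edge x) ∈ S := fun h => he _ h
    have e3 : .inr 3 ∈ S → .inl x ∈ S := fun h => he _ h
    have ex : .inl x ∈ S → .inr 3 ∈ S := fun h => kinkEdge_self x ▸ he _ h
    have ex' : .inl (P.edge x) ∈ S → .inr 2 ∈ S := fun h => kinkEdge_edge x ▸ he _ h
    have full : ∀ y, .inl y ∈ S → ∀ w, w ∈ S := by
      intro y hy
      have hl : ∀ y, .inl y ∈ S := by
        refine closed_univ (S := {y | .inl y ∈ S}) (fun w hw => ?_) (fun w hw => hr _ hw) hy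
        by_cases h1 : w = x
        · subst h1
          exact e2 (r0 (e1 (r3 (ex hw))))
        · by_cases h2 : w = P.edge x
          · subst h2
            rw [Set.mem_ofPred_eq, edge_edge]
            exact e3 (r1 (e0 (r2 (ex' hw))))
          · have hw' := he _ hw
            rw [kinkEdge_inl h1 h2] at hw'
            exact hw'
      rintro (w | c)
      · exact hl w
      · fin_cases c
        · exact r2 (ex' (hl _))
        · exact r3 (ex (hl _))
        · exact ex' (hl _)
        · exact ex (hl _)
    rintro (y | c) hy
    · exact full y hy
    · fin_cases c
      · exact full _ (e2 (r0 hy))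
      · exact full _ (e3 (r1 hy))
      · exact full _ (e2 hy)
      · exact full _ (e3 hy)
  spherical := by
    intro _
    have := P.finite
    have : Nonempty P.Dart := ⟨x⟩
    have h1 := numCycles_mul_four (r := P.kinkRot) kinkRot_four kinkRot_two_ne
    have h2 := numCycles_mul_two (e := kinkEdgePerm x) (kinkEdge_kinkEdge x) (kinkEdge_ne x)
    have h3 : numCycles ((kinkEdgePerm x).trans P.kinkRot) = numCycles P.face + 1 :=
      numCycles_kinkFace x
    have h4 := P.numCycles_rot_mul
    have h5 := P.numCycles_edge_mul
    have h6 := P.euler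
    rw [Nat.card_sum, Nat.card_fin] at h1 h2
    omega

theorem addKink_rIMinus : (P.addKink x).RIMinus P := by
  let z : (P.addKink x).Dart := .inr 0
  have hz : (P.addKink x).edge z = (P.addKink x).rot z := rfl
  have hz2 : (P.addKink x).rot ((P.addKink x).rot z) = .inr 2 := rfl
  have hz3 : (P.addKink x).rot ((P.addKink x).rot ((P.addKink x).rot z)) = .inr 3 := rfl
  let f : P.Dart → (P.addKink x).Dart := Sum.inl
  have hc : ∀ c : Fin 4, c = 0 ∨ c = 1 ∨ c = 2 ∨ c = 3 := by decide
  have hD : ∀ y, y ∈ (P.addKink x).dartsAt z ↔ ∃ c : Fin 4, y = .inr c := by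
    intro y
    rw [mem_dartsAt, hz3, hz2]
    constructor
    · rintro (h | h | h | h)
      · exact ⟨0, h⟩
      · exact ⟨1, h⟩
      · exact ⟨2, h⟩
      · exact ⟨3, h⟩
    · rintro ⟨c, rfl⟩
      rcases hc c with rfl | rfl | rfl | rfl
      · exact Or.inl rfl
      · exact Or.inr (Or.inl rfl)
      · exact Or.inr (Or.inr (Or.inl rfl))
      · exact Or.inr (Or.inr (Or.inr rfl))
  have hfD : ∀ y, f y ∉ (P.addKink x).dartsAt z := fun y hy => by
    obtain ⟨c, hc⟩ := (hD _).1 hy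
    exact Sum.inl_ne_inr hc
  refine riMinus_iff.2 ⟨z, hz, f, Sum.inl_injective, ?_, fun y => rfl, fun y => ?_⟩
  · rw [dartsAt_rot]
    ext y
    rw [Set.mem_compl_iff]
    refine ⟨?_, fun hy => ?_⟩
    · rintro ⟨w, rfl⟩
      exact hfD w
    · obtain ⟨w, rfl⟩ | ⟨c, rfl⟩ : (∃ w : P.Dart, y = .inl w) ∨ ∃ c : Fin 4, y = .inr c := by
        rcases y with w | c
        · exact Or.inl ⟨w, rfl⟩
        · exact Or.inr ⟨c, rfl⟩
      · exact ⟨w, rfl⟩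
      · exact absurd ((hD _).2 ⟨c, rfl⟩) hy
  · by_cases h1 : y = x
    · have h3 : (P.addKink x).edge (f y) = .inr 3 := h1 ▸ kinkEdge_self y
      rw [kink_spliceEdge_three hz (h3.trans hz3.symm), hz2, h1]
      rfl
    · by_cases h2 : y = P.edge x
      · have h3 : (P.addKink x).edge (f y) = .inr 2 := h2 ▸ kinkEdge_edge x
        rw [kink_spliceEdge_two hz (h3.trans hz2.symm), hz3, h2, edge_edge]
        rfl
      · have h3 : (P.addKink x).edge (f y) = f (P.edge y) := kinkEdge_inl h1 h2
        rw [spliceEdge_of_notMem, h3]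
        rw [h3, dartsAt_rot]
        exact hfD _

end kinkEdge

/-- A kink on an arc of a connected sum is a kink on an arc of a summand. -/
theorem IsConnectedSum.addKink {P₁ P₂ : KnotProjection} {z : P.Dart} (hz : P.edge z = P.rot z)
    {g : Q.Dart → P.Dart} (hg : P.SpliceMap (P.rot z) Q g) {a : P₁.Dart} {b : P₂.Dart}
    {e : P₁.Dart ⊕ P₂.Dart ≃ Q.Dart}
    (h1 : ∀ x, Q.rot (e (.inl x)) = e (.inl (P₁.rot x)))
    (h2 : ∀ y, Q.rot (e (.inr y)) = e (.inr (P₂.rot y)))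
    (h3 : Q.edge (e (.inl a)) = e (.inr b))
    (h4 : Q.edge (e (.inl (P₁.edge a))) = e (.inr (P₂.edge b)))
    (h5 : ∀ x, x ≠ a → x ≠ P₁.edge a → Q.edge (e (.inl x)) = e (.inl (P₁.edge x)))
    (h6 : ∀ y, y ≠ b → y ≠ P₂.edge b → Q.edge (e (.inr y)) = e (.inr (P₂.edge y)))
    {x : P₁.Dart} (hx : P.edge (P.rot (P.rot (P.rot z))) = g (e (.inl x))) :
    IsConnectedSum (P₁.addKink x) P₂ P := by
  have hz' : P.edge (P.rot z) = z := by rw [← hz, edge_edge]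
  have hw1 : P.edge (P.rot (P.rot z)) = g (Q.edge (e (.inl x))) := by
    rw [hg.edge, kink_spliceEdge_three hz (by rw [← hx, edge_edge])]
  have hgw0 : P.edge (g (e (.inl x))) = P.rot (P.rot (P.rot z)) := by rw [← hx, edge_edge]
  have hgw1 : P.edge (g (Q.edge (e (.inl x)))) = P.rot (P.rot z) := by rw [← hw1, edge_edge]
  have hgD : ∀ q, ∀ y ∈ P.dartsAt z, g q ≠ y := fun q y hy hh =>
    hg.notMem q (by rw [dartsAt_rot, hh]; exact hy)
  have hoff : ∀ q, q ≠ e (.inl x) → q ≠ Q.edge (e (.inl x)) → P.edge (g q) = g (Q.edge q) := by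
    intro q hq0 hq1
    rw [hg.edge, spliceEdge_of_notMem]
    rw [dartsAt_rot]
    rintro (h | h | h | h) <;> rw [edge_eq_iff] at h
    · rw [hz] at h
      exact hgD _ _ (by simp [mem_dartsAt]) h
    · rw [hz'] at h
      exact hgD _ _ (by simp [mem_dartsAt]) h
    · exact hq1 (hg.inj (h.trans hw1))
    · exact hq0 (hg.inj (h.trans hx))
  let F : (P₁.Dart ⊕ Fin 4) ⊕ P₂.Dart → P.Dart :=
    Sum.elim (Sum.elim (fun y => g (e (.inl y))) (corner z)) fun y => g (e (.inr y))
  have hF : Function.Bijective F := by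
    constructor
    · rintro ((y | c) | y) ((w | d) | w) hyw
      · rw [Sum.inl.inj (e.injective (hg.inj hyw))]
      · exact absurd hyw (hgD _ _ (corner_mem_dartsAt _ _))
      · exact absurd (e.injective (hg.inj hyw)) Sum.inl_ne_inr
      · exact absurd hyw.symm (hgD _ _ (corner_mem_dartsAt _ _))
      · rw [corner_injective z hyw]
      · exact absurd hyw.symm (hgD _ _ (corner_mem_dartsAt _ _))
      · exact absurd (e.injective (hg.inj hyw)) Sum.inr_ne_inl
      · exact absurd hyw (hgD _ _ (corner_mem_dartsAt _ _))
      · rw [Sum.inr.inj (e.injective (hg.inj hyw))]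
    · intro y
      by_cases hy : y ∈ P.dartsAt z
      · obtain ⟨c, hc⟩ := exists_corner_eq hy
        exact ⟨.inl (.inr c), hc⟩
      · obtain ⟨q, rfl⟩ := hg.exists_eq (y := y) (by rwa [dartsAt_rot])
        obtain ⟨w | w, rfl⟩ := e.surjective q
        · exact ⟨.inl (.inl w), rfl⟩
        · exact ⟨.inr w, rfl⟩
  have kx : P.edge (g (e (.inl x))) = F (.inl (P₁.kinkEdge x (.inl x))) := by
    rw [kinkEdge_self, hgw0]; rfl
  have k1 : ∀ y, y ≠ a → y ≠ P₁.edge a →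
      P.edge (g (e (.inl y))) = F (.inl (P₁.kinkEdge x (.inl y))) := by
    intro y hya hya'
    by_cases hyx : y = x
    · subst hyx; exact kx
    have hQy := h5 y hya hya'
    by_cases hyx' : y = P₁.edge x
    · have hxy : x = P₁.edge y := by rw [hyx', edge_edge]
      have : g (e (.inl y)) = g (Q.edge (e (.inl x))) := by
        rw [hxy, ← hQy, edge_edge]
      rw [this, hgw1, hyx', kinkEdge_edge]; rfl
    · rw [kinkEdge_inl hyx hyx', hoff _ (by simpa using hyx), hQy]
      · rfl
      · rw [Ne, ← edge_eq_iff, hQy, e.injective.eq_iff, Sum.inl.injEq, edge_eq_iff]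
        exact hyx'
  have k2 : x ≠ a → x ≠ P₁.edge a → P.edge (corner z 2) = F (.inl (P₁.kinkEdge x (.inr 2))) :=
    fun hxa hxa' => hw1.trans (congrArg g (h5 x hxa hxa'))
  have k : ∀ X, (X ≠ .inr 2 ∨ (x ≠ a ∧ x ≠ P₁.edge a)) →
      (∀ y, X = .inl y → y ≠ x → y ≠ a ∧ y ≠ P₁.edge a) →
      P.edge (F (.inl X)) = F (.inl (P₁.kinkEdge x X)) := by
    rintro (y | c) hX hX'
    · by_cases hyx : y = x
      · subst hyx; exact kx
      · obtain ⟨i1, i2⟩ := hX' y rfl hyx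
        exact k1 y i1 i2
    · fin_cases c
      · exact hz
      · exact hz'
      · obtain ⟨i1, i2⟩ := hX.resolve_left fun hh => hh rfl
        exact k2 i1 i2
      · exact hx
  have kr : ∀ y, y ≠ b → y ≠ P₂.edge b → P.edge (F (.inr y)) = F (.inr (P₂.edge y)) := by
    intro y hyb hyb'
    have hQy := h6 y hyb hyb'
    refine (hoff _ (by simp) fun hh => ?_).trans (congrArg g hQy)
    rw [← edge_eq_iff, hQy] at hh
    exact Sum.inr_ne_inl (e.injective hh)
  have hrot1 : ∀ X, P.rot (F (.inl X)) = F (.inl (P₁.kinkRot X)) := by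
    rintro (y | c)
    · change P.rot (g (e (.inl y))) = g (e (.inl (P₁.rot y)))
      rw [← hg.rot, h1]
    · exact rot_corner z c
  have hrot2 : ∀ y, P.rot (F (.inr y)) = F (.inr (P₂.rot y)) := by
    intro y
    change P.rot (g (e (.inr y))) = g (e (.inr (P₂.rot y)))
    rw [← hg.rot, h2]
  refine Or.inr (Or.inr ?_)
  -- If the kink lies on one of the two arcs that connect the summands, the summand with the kink is
  -- to be cut between the kink and `edge x`; otherwise it is cut where it was before.
  by_cases hxa : x = a
  · subst hxa
    refine ⟨.inr 2, b, Equiv.ofBijective F hF, hrot1, hrot2, ?_, ?_, fun X i1 i2 => k X ?_ ?_, kr⟩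
    · exact hw1.trans (congrArg g h3)
    · refine (hoff _ ?_ ?_).trans (congrArg g h4)
      · simpa using P₁.edge_ne x
      · rw [h3]; simp
    · exact Or.inl i1
    · rintro y rfl hyx
      exact ⟨hyx, fun hh => i2 (congrArg Sum.inl hh)⟩
  · by_cases hxa' : x = P₁.edge a
    · subst hxa'
      have ha : P₁.kinkEdge (P₁.edge a) (.inl a) = .inr 2 := by
        have := kinkEdge_edge (P₁.edge a)
        rwa [edge_edge] at this
      refine ⟨.inl a, b, Equiv.ofBijective F hF, hrot1, hrot2, ?_, ?_, fun X i1 i2 => k X ?_ ?_, kr⟩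
      · refine (hoff _ ?_ ?_).trans (congrArg g h3)
        · simpa using (P₁.edge_ne a).symm
        · rw [h4]; simp
      · change P.edge (F (.inl (P₁.kinkEdge _ (.inl a)))) = _
        rw [ha]
        exact hw1.trans (congrArg g h4)
      · exact Or.inl fun hh => i2 (hh.trans ha.symm)
      · rintro y rfl hyx
        exact ⟨fun hh => i1 (congrArg Sum.inl hh), hyx⟩
    · have ha : P₁.kinkEdge x (.inl a) = .inl (P₁.edge a) :=
        kinkEdge_inl (Ne.symm hxa) (by rwa [Ne, ← edge_eq_iff, eq_comm])
      refine ⟨.inl a, b, Equiv.ofBijective F hF, hrot1, hrot2, ?_, ?_, fun X i1 i2 => k X ?_ ?_, kr⟩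
      · refine (hoff _ ?_ ?_).trans (congrArg g h3)
        · simpa using Ne.symm hxa
        · rw [h5 x hxa hxa', Ne, e.injective.eq_iff, Sum.inl.injEq, ← edge_eq_iff]
          exact Ne.symm hxa'
      · change P.edge (F (.inl (P₁.kinkEdge _ (.inl a)))) = _
        rw [ha]
        refine (hoff _ ?_ ?_).trans (congrArg g h4)
        · simpa using Ne.symm hxa'
        · rw [h5 x hxa hxa', Ne, e.injective.eq_iff, Sum.inl.injEq, edge_inj]
          exact Ne.symm hxa
      · exact Or.inr ⟨hxa, hxa'⟩
      · rintro y rfl hyx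
        exact ⟨fun hh => i1 (congrArg Sum.inl hh), fun hh => i2 ((congrArg Sum.inl hh).trans ha.symm)⟩

theorem eliminatesIn_of_mem_riClass_torus (h : P ∈ riClass torusProjections) :
    EliminatesIn P.adj 1 ∧ ¬ EliminatesIn P.adj 0 := by
  obtain ⟨Q, ⟨l, hl, hQ⟩, hPQ⟩ := h
  rw [hPQ.eliminatesIn_iff, hPQ.eliminatesIn_iff]
  exact torus_eliminatesIn (by omega) hQ

theorem RIMinus.mem_riClass {S : Set KnotProjection} (h : P.RIMinus Q) (hQ : Q ∈ riClass S) :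
    P ∈ riClass S := by
  obtain ⟨R, hR, hQR⟩ := hQ
  exact ⟨R, hR, .trans _ _ _ (.rel _ _ (Or.inr h)) hQR⟩

/-- The set of connected sums is not closed under `∼` by definition. It is closed under adding a
kink because the kink can be put on an arc of one summand, which does not leave its class. -/
theorem RIMinus.mem_connectedSums (h : P.RIMinus Q)
    (hQ : Q ∈ connectedSums (riClass torusProjections) (riClass torusProjections)) :
    P ∈ connectedSums (riClass torusProjections) (riClass torusProjections) := by
  obtain ⟨P₁, hP₁, P₂, hP₂, hs⟩ := hQ
  have hne : ∀ P ∈ riClass torusProjections, ¬ P.IsSimpleClosedCurve := fun P hP hP' =>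
    (eliminatesIn_of_mem_riClass_torus hP).2 (Unknots.done P hP').eliminatesIn
  obtain ⟨z, hz, hs'⟩ := riMinus_iff.1 h
  obtain ⟨g, hg⟩ := isSplice_iff.1 hs'
  have hz' : P.edge (P.rot z) = z := by rw [← hz, edge_edge]
  have hsymm := hs.symm
  rcases hs with hs | hs | ⟨a, b, e, h1, h2, h3, h4, h5, h6⟩
  · exact absurd hs.1 (hne _ hP₁)
  · exact absurd hs.1 (hne _ hP₂)
  -- If the two ends at the corner of the kink were joined to each other, `P` would have no further
  -- double point and `Q` none at all.
  have hmem : P.edge (P.rot (P.rot (P.rot z))) ∉ P.dartsAt (P.rot z) := by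
    rw [dartsAt_rot]
    rintro (h7 | h7 | h7 | h7)
    · rw [edge_eq_iff, hz, rot_inj] at h7
      exact P.rot_two_ne _ h7
    · rw [edge_eq_iff, hz'] at h7
      exact rot_three_ne _ h7
    · have hall := closed_univ (S := P.dartsAt z) (fun y hy => by
        rcases hy with rfl | rfl | rfl | rfl
        · simp [hz, mem_dartsAt]
        · simp [hz', mem_dartsAt]
        · rw [← h7, edge_edge]; simp [mem_dartsAt]
        · rw [h7]; simp [mem_dartsAt])
        (fun y hy => by rwa [rot_mem_dartsAt, rot_mem_dartsAt]) (self_mem_dartsAt z)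
      exact hg.notMem (e (.inl a)) (by rw [dartsAt_rot]; exact hall _)
    · exact P.edge_ne _ h7
  obtain ⟨q, hq⟩ := hg.exists_eq hmem
  obtain ⟨x | x, rfl⟩ := e.surjective q
  · exact ⟨_, (addKink_rIMinus x).mem_riClass hP₁, P₂, hP₂,
      IsConnectedSum.addKink hz hg h1 h2 h3 h4 h5 h6 hq.symm⟩
  · have h3' : Q.edge (e (.inr b)) = e (.inl a) := by rw [← h3, edge_edge]
    have h4' : Q.edge (e (.inr (P₂.edge b))) = e (.inl (P₁.edge a)) := by rw [← h4, edge_edge]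
    exact ⟨_, (addKink_rIMinus x).mem_riClass hP₂, P₁, hP₁,
      IsConnectedSum.addKink (e := (Equiv.sumComm _ _).trans e) hz hg h2 h1 h3' h4' h6 h5 hq.symm⟩

theorem mem_connectedSums_of_reflTransGen (h : Relation.ReflTransGen RIMinus P Q)
    (hQ : Q ∈ connectedSums (riClass torusProjections) (riClass torusProjections)) :
    P ∈ connectedSums (riClass torusProjections) (riClass torusProjections) := by
  induction h using Relation.ReflTransGen.head_induction_on with
  | refl => exact hQ
  | head h _ ih => exact h.mem_connectedSums ih

/-! ### The cases `u⁻ = 1` and `u⁻ = 2`. -/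

theorem uMinus_eq_one_iff : P.uMinus = 1 ↔ P ∈ riClass torusProjections := by
  rw [uMinus_eq_succ_iff]
  refine ⟨fun ⟨h1, h0⟩ => ?_, eliminatesIn_of_mem_riClass_torus⟩
  obtain ⟨Q, hPQ, hQ⟩ := exists_noOneGon P
  rw [← eliminatesIn_iff_of_reflTransGen hPQ] at h0 h1
  exact ⟨Q, hQ.mem_torusProjections h1 h0, rIEquiv_of_reflTransGen hPQ⟩

theorem uMinus_eq_two_iff : P.uMinus = 2 ↔
    P ∈ riClass rationalProjections ∪ riClass pretzelProjections ∪
      connectedSums (riClass torusProjections) (riClass torusProjections) := by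
  rw [uMinus_eq_succ_iff]
  constructor
  · rintro ⟨h2, h1⟩
    obtain ⟨Q, hPQ, hQ⟩ := exists_noOneGon P
    rw [← eliminatesIn_iff_of_reflTransGen hPQ] at h1 h2
    have hR := rIEquiv_of_reflTransGen hPQ
    rcases hQ.mem_of_two h2 h1 with (h | h) | h
    · exact Or.inl (Or.inl ⟨Q, h, hR⟩)
    · exact Or.inl (Or.inr ⟨Q, h, hR⟩)
    · exact Or.inr (mem_connectedSums_of_reflTransGen hPQ h)
  · rintro ((⟨Q, ⟨m, n, hm, hn, hQ⟩, hPQ⟩ | ⟨Q, ⟨p, q, r, hp, hq, hr, hQ⟩, hPQ⟩) | h)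
    · rw [hPQ.eliminatesIn_iff, hPQ.eliminatesIn_iff]
      exact rational_eliminatesIn hm hn hQ
    · rw [hPQ.eliminatesIn_iff, hPQ.eliminatesIn_iff]
      exact pretzel_eliminatesIn hp hq hr hQ
    · obtain ⟨P₁, hP₁, P₂, hP₂, h⟩ := h
      exact connectedSum_eliminatesIn h (eliminatesIn_of_mem_riClass_torus hP₁)
        (eliminatesIn_of_mem_riClass_torus hP₂)

end KnotProjection

theorem theorem1 (P : KnotProjection) :
    (P.uMinus = 1 ↔ P ∈ KnotProjection.riClass KnotProjection.torusProjections) ∧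
    (P.uMinus = 2 ↔
      P ∈ KnotProjection.riClass KnotProjection.rationalProjections ∪
        KnotProjection.riClass KnotProjection.pretzelProjections ∪
        KnotProjection.connectedSums (KnotProjection.riClass KnotProjection.torusProjections)
          (KnotProjection.riClass KnotProjection.torusProjections)) :=
  ⟨KnotProjection.uMinus_eq_one_iff, KnotProjection.uMinus_eq_two_iff⟩
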